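/- Fix a local dimension $d\ge 1$. Let $(G_n)_{n\in\mathbb N}$, $G_n=(V_n,E_n)$, be a sequence of finite connected simple graphs with $V_n\subseteq V_{n+1}$ for all $n$ and $|V_n|\to\infty$. For $p\in[0,1]$ let $$\rho(p)=p\,|\phi^+\rangle\langle\phi^+|+\frac{1-p}{d^2}\,\mathbb 1,\qquad |\phi^+\rangle=\frac1{\sqrt d}\sum_{i=1}^d|ii\rangle,$$ be the isotropic state on $\mathbb C^d\otimes\mathbb C^d$, and let $\sigma(G_n,p)=\bigotimes_{e\in E_n}\rho_e(p)$ be the isotropic network state, in which the two qudits of the copy $\rho_e(p)$ are held by the two end vertices of $e$; each vertex is a party and holds one qudit for each edge incident to it. An LOCC map is one implemented by local operations of the parties and finitely many rounds of classical communication. The fidelity is $F(\rho,\sigma)=\bigl(\operatorname{tr}\sqrt{\sqrt\rho\,\sigma\sqrt\rho}\bigr)^2$. Suppose that the minimum degrees satisfy $\delta_{\min}(G_n)=\Omega(|V_n|)$, i.e. there is $c>0$ with $\delta_{\min}(G_n)\ge c|V_n|$ for all sufficiently large $n$, and that the edge-connectivity $\lambda(G_n)$ (the least number of edges whose removal disconnects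 $G_n$) tends to infinity. Then $(G_n)$ has partial distillability: there exists $p_0<1$, depending only on the sequence and $d$, such that for every $m\in\mathbb N$, every set $V_0\subseteq\bigcup_n V_n$ of $m$ parties and every pure state $\psi$ on $\bigotimes_{v\in V_0}\mathbb C^d$, there are LOCC maps $\Lambda_{n,p}$ (for all $n$ with $V_0\subseteq V_n$) from states of the network $G_n$ to states on $\bigotimes_{v\in V_0}\mathbb C^d$, where party $v\in V_0$ holds the $v$-th qudit, such that $$\lim_{n\to\infty}F\bigl(\Lambda_{n,p}(\sigma(G_n,p)),\psi\bigr)=1\qquad\text{for all } p\in(p_0,1]\cap[0,1].$$ -/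

import Mathlib

open Filter Topology
open scoped ComplexOrder MatrixOrder Matrix

universe u

/-! ### Graph sequences -/

/-- The minimum number of edges whose removal disconnects `G`. -/
noncomputable def edgeConnectivity {V : Type u} (G : SimpleGraph V) : ℕ :=
  sInf {k : ℕ | ∃ F : Finset (Sym2 V),
    (F : Set (Sym2 V)) ⊆ G.edgeSet ∧ F.card = k ∧ ¬ (G.deleteEdges (F : Set (Sym2 V))).Connected}

open Classical in
/-- The minimum degree of a finite graph. -/
noncomputable def minDeg {V : Type u} [Fintype V] (G : SimpleGraph V) : ℕ := G.minDegree

/-- A sequence of finite connected simple graphs with nested vertex sets (inside an ambient type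
of vertices `α`) whose orders tend to infinity. -/
structure GraphSequence (α : Type u) where
  verts : ℕ → Finset α
  graph : ∀ n, SimpleGraph (verts n)
  connected : ∀ n, (graph n).Connected
  verts_subset_succ : ∀ n, verts n ⊆ verts (n + 1)
  order_tendsto : Tendsto (fun n => (verts n).card) atTop atTop

/-! ### States and fidelity

Operators on a Hilbert space with orthonormal basis indexed by a finite type `ι` are written as
matrices `Matrix ι ι ℂ`. -/

/-- A pure state: the rank-one projector onto a unit vector. -/
def IsPureState {ι : Type u} [Fintype ι] (ρ : Matrix ι ι ℂ) : Prop :=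
  ∃ φ : ι → ℂ, ∑ i, ‖φ i‖ ^ 2 = 1 ∧ ρ = Matrix.vecMulVec φ (star φ)

/-- The fidelity `(tr √(√ρ σ √ρ))²`. -/
noncomputable def fidelity {ι : Type u} [Fintype ι] [DecidableEq ι] (ρ σ : Matrix ι ι ℂ) : ℝ :=
  (CFC.sqrt (CFC.sqrt ρ * σ * CFC.sqrt ρ)).trace.re ^ 2

/-- The vector `(1/√d) ∑ᵢ |ii⟩`. -/
noncomputable def maxEntangledVec (d : ℕ) : Fin d × Fin d → ℂ :=
  fun i => if i.1 = i.2 then ((1 / Real.sqrt d : ℝ) : ℂ) else 0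

/-- The isotropic state of visibility `p` and local dimension `d`. -/
noncomputable def isotropic (d : ℕ) (p : ℝ) : Matrix (Fin d × Fin d) (Fin d × Fin d) ℂ :=
  (p : ℂ) • Matrix.vecMulVec (maxEntangledVec d) (star (maxEntangledVec d)) +
    (((1 - p) / (d : ℝ) ^ 2 : ℝ) : ℂ) • 1

/-- The isotropic state does not depend on the order of the two subsystems. -/
theorem isotropic_swap (d : ℕ) (p : ℝ) (i j : Fin d × Fin d) :
    isotropic d p i.swap j.swap = isotropic d p i j := by
  simp [isotropic, maxEntangledVec, Matrix.vecMulVec_apply, Matrix.one_apply, eq_comm,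
    Prod.swap_inj]

/-! ### Isotropic network states -/

/-- Basis of the Hilbert space of party `v`: one qudit for each edge at `v`. -/
abbrev PartyIdx {V : Type u} (G : SimpleGraph V) (d : ℕ) (v : V) : Type u :=
  G.incidenceSet v → Fin d

/-- Basis of the Hilbert space of the whole network, the tensor product over all parties. -/
abbrev NetIdx {V : Type u} (G : SimpleGraph V) (d : ℕ) : Type u :=
  ∀ v : V, PartyIdx G d v

/-- The basis label of the two qudits belonging to the edge `e`. The edge is oriented by an
arbitrary choice, which is immaterial by `isotropic_swap`. -/
noncomputable def edgeIdx {V : Type u} (G : SimpleGraph V) (d : ℕ) (x : NetIdx G d)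
    (e : G.edgeSet) : Fin d × Fin d :=
  (x (Quot.out e.1).1 ⟨e.1, e.2, Sym2.out_fst_mem e.1⟩,
    x (Quot.out e.1).2 ⟨e.1, e.2, Sym2.out_snd_mem e.1⟩)

open Classical in
/-- The isotropic network state: the tensor product over all edges of isotropic states. -/
noncomputable def networkState {V : Type u} [Fintype V] (G : SimpleGraph V) (d : ℕ) (p : ℝ) :
    Matrix (NetIdx G d) (NetIdx G d) ℂ :=
  Matrix.of fun x y => ∏ e : G.edgeSet, isotropic d p (edgeIdx G d x e) (edgeIdx G d y e)

/-! ### LOCC maps -/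

/-- The tensor product `⨂ᵥ Aᵥ` of local operators. -/
def tensorOp {P : Type u} [Fintype P] {I I' : P → Type u} (A : ∀ v, Matrix (I' v) (I v) ℂ) :
    Matrix (∀ v, I' v) (∀ v, I v) ℂ :=
  Matrix.of fun x y => ∏ v, A v (x v) (y v)

/-- Maps implementable by local operations and (finitely many rounds of) classical communication
among the parties `P`, from local spaces with bases `I v` to local spaces with bases `O v`.

In one round a party `k` performs a measurement on its system with Kraus operators `A j k` and
announces the outcome `j`. The other parties may apply local isometries `A j v` depending on `j`,
so that the local spaces are now those with bases `I' j v`, and the protocol goes on in a way that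
depends on `j`. Outcomes are discarded at the end, so that the resulting maps
are summed. General local channels and instruments arise by ignoring (part of) an outcome. -/
inductive IsLOCC {P : Type u} [Fintype P] [DecidableEq P] {O : P → Type u}
    [∀ v, Fintype (O v)] [∀ v, DecidableEq (O v)] :
    (I : P → Type u) → [∀ v, Fintype (I v)] → [∀ v, DecidableEq (I v)] →
    (Matrix (∀ v, I v) (∀ v, I v) ℂ → Matrix (∀ v, O v) (∀ v, O v) ℂ) → Prop
  | done : IsLOCC O (fun ρ => ρ)
  | round {I : P → Type u} [∀ v, Fintype (I v)] [∀ v, DecidableEq (I v)]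
      (k : P) {J : Type} [Fintype J] (I' : J → P → Type u)
      [∀ j v, Fintype (I' j v)] [∀ j v, DecidableEq (I' j v)]
      (A : ∀ j v, Matrix (I' j v) (I v) ℂ)
      (measurement : ∑ j, (A j k)ᴴ * A j k = 1)
      (isometry : ∀ j v, v ≠ k → (A j v)ᴴ * A j v = 1)
      (Λ : ∀ j, Matrix (∀ v, I' j v) (∀ v, I' j v) ℂ → Matrix (∀ v, O v) (∀ v, O v) ℂ)
      (rest : ∀ j, IsLOCC (I' j) (Λ j)) :
      IsLOCC I (fun ρ => ∑ j, Λ j (tensorOp (A j) * ρ * (tensorOp (A j))ᴴ))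

/-- Basis of the output space of party `v` for targets on `V₀`: one qudit if `v ∈ V₀`, and the
trivial one-dimensional space otherwise. -/
abbrev OutIdx {α : Type u} (V₀ : Finset α) (d : ℕ) (v : α) : Type u :=
  {w : V₀ // (w : α) = v} → Fin d

/-- The output space of all parties is the target space with one qudit for each element of `V₀`. -/
def outEquiv {α : Type u} {V V₀ : Finset α} (h : V₀ ⊆ V) (d : ℕ) :
    (∀ v : V, OutIdx V₀ d (v : α)) ≃ (V₀ → Fin d) where
  toFun f w := f ⟨w, h w.2⟩ ⟨w, rfl⟩
  invFun g _ w := g w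
  left_inv f := by
    funext v w
    obtain ⟨w, hw⟩ := w
    obtain rfl : v = ⟨w, h w.2⟩ := Subtype.ext hw.symm
    rfl
  right_inv _ := rfl

open Classical in
/-- `Λ` is an LOCC map from the network on `G` (all vertices being distinct parties) to states with
one qudit at each party in `V₀`. -/
def IsNetworkLOCC {α : Type u} {V : Finset α} (G : SimpleGraph V) (d : ℕ) {V₀ : Finset α}
    (h : V₀ ⊆ V)
    (Λ : Matrix (NetIdx G d) (NetIdx G d) ℂ → Matrix (V₀ → Fin d) (V₀ → Fin d) ℂ) : Prop :=
  ∃ Γ : Matrix (NetIdx G d) (NetIdx G d) ℂ →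
      Matrix (∀ v : V, OutIdx V₀ d (v : α)) (∀ v : V, OutIdx V₀ d (v : α)) ℂ,
    IsLOCC (PartyIdx G d) Γ ∧ ∀ ρ, Λ ρ = Matrix.reindex (outEquiv h d) (outEquiv h d) (Γ ρ)

/-! ### Partial distillability -/

open Classical in
/-- Partial distillability for local dimension `d`. For a set `V₀` of parties only the indices `n`
with `V₀ ⊆ Vₙ` (all sufficiently large ones) are relevant. -/
def HasPartialDistillability {α : Type u} (S : GraphSequence α) (d : ℕ) : Prop :=
  ∃ p₀ : ℝ, p₀ < 1 ∧
    ∀ (m : ℕ) (V₀ : Finset α), V₀.card = m → (∃ n, V₀ ⊆ S.verts n) →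
    ∀ ψ : Matrix (V₀ → Fin d) (V₀ → Fin d) ℂ, IsPureState ψ →
      ∃ Λ : ∀ n : ℕ, ℝ → Matrix (NetIdx (S.graph n) d) (NetIdx (S.graph n) d) ℂ →
          Matrix (V₀ → Fin d) (V₀ → Fin d) ℂ,
        (∀ n p (h : V₀ ⊆ S.verts n), IsNetworkLOCC (S.graph n) d h (Λ n p)) ∧
        ∀ p : ℝ, 0 ≤ p → p ≤ 1 → p₀ < p →
          Tendsto (fun n => fidelity (Λ n p (networkState (S.graph n) d p)) ψ) atTop (𝓝 1)

/-!
A party prepares the target state, encodes each of its qudits in a concatenated Shor code, and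
sends the encoded qudits to their targets by teleportation along edge-disjoint paths. In a graph of
minimum degree at least `c * N` a shortest path has length at most `6 / c`, even after boundedly
many edges have been deleted, and by edge-connectivity the graph stays connected when the edges of
the paths chosen so far are deleted; hence the paths can be chosen greedily, of length at most a
constant `L`. An isotropic state is a mixture of the maximally entangled state and of product states
with weight `1 - p`, so a qudit sent along a path is damaged with probability at most `L * (1 - p)`,
independently for distinct qudits. At level `r` the code corrects all errors that do not cover one
of at most `81 ^ 2 ^ r` sets of `2 ^ r` qudits. Hence the failure probability is at most
`#V₀ * (81 * L * (1 - p)) ^ 2 ^ r`, which is arbitrarily small for large `r` if `p` is near `1`.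
-/

/-! ### Product operators and Kraus families -/

section PiTensor

variable {R ι : Type*} [Fintype ι] [CommSemiring R] {l m n : ι → Type*}

/-- The tensor product of a finite family of matrices. The operator `tensorOp` of an LOCC round is
the case in which the index set and the bases live in one universe. -/
def piTensor (A : ∀ i, Matrix (m i) (n i) R) : Matrix (∀ i, m i) (∀ i, n i) R :=
  Matrix.of fun x y => ∏ i, A i (x i) (y i)

lemma piTensor_apply (A : ∀ i, Matrix (m i) (n i) R) (x : ∀ i, m i) (y : ∀ i, n i) :
    piTensor A x y = ∏ i, A i (x i) (y i) := rfl

lemma piTensor_mul [DecidableEq ι] [∀ i, Fintype (m i)] (A : ∀ i, Matrix (l i) (m i) R)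
    (B : ∀ i, Matrix (m i) (n i) R) :
    piTensor A * piTensor B = piTensor fun i => A i * B i := by
  ext x y
  simp only [Matrix.mul_apply, piTensor_apply, ← Finset.prod_mul_distrib]
  rw [Fintype.prod_sum]

lemma piTensor_conjTranspose [StarRing R] (A : ∀ i, Matrix (m i) (n i) R) :
    (piTensor A)ᴴ = piTensor fun i => (A i)ᴴ := by
  ext x y
  simp [Matrix.conjTranspose_apply, piTensor_apply]

lemma piTensor_one [∀ i, DecidableEq (n i)] :
    piTensor (fun i => (1 : Matrix (n i) (n i) R)) = 1 := by
  ext x y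
  simp [piTensor_apply, Matrix.one_apply, Finset.prod_ite_zero, funext_iff]

lemma piTensor_smul (c : ι → R) (A : ∀ i, Matrix (m i) (n i) R) :
    piTensor (fun i => c i • A i) = (∏ i, c i) • piTensor A := by
  ext x y
  simp [piTensor_apply, Finset.prod_mul_distrib]

lemma sum_piTensor [DecidableEq ι] {J : ι → Type*} [∀ i, Fintype (J i)]
    (A : ∀ i, J i → Matrix (m i) (n i) R) :
    ∑ t : ∀ i, J i, piTensor (fun i => A i (t i)) = piTensor fun i => ∑ j, A i j := by
  ext x y
  simp only [Matrix.sum_apply, piTensor_apply]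
  exact (Fintype.prod_sum fun i j => A i j (x i) (y i)).symm

lemma piTensor_update_apply [DecidableEq ι] (A : ∀ i, Matrix (m i) (n i) R) (k : ι)
    (M : Matrix (m k) (n k) R) (x : ∀ i, m i) (y : ∀ i, n i) :
    piTensor (Function.update A k M) x y
      = M (x k) (y k) * ∏ i ∈ Finset.univ.erase k, A i (x i) (y i) := by
  rw [piTensor_apply, ← Finset.mul_prod_erase _ _ (Finset.mem_univ k), Function.update_self]
  congr 1
  exact Finset.prod_congr rfl fun i hi => by rw [Function.update_of_ne (Finset.ne_of_mem_erase hi)]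

lemma sum_piTensor_update [DecidableEq ι] {J : Type*} [Fintype J]
    (A : ∀ i, Matrix (m i) (n i) R) (k : ι) (B : J → Matrix (m k) (n k) R) :
    ∑ j, piTensor (Function.update A k (B j)) = piTensor (Function.update A k (∑ j, B j)) := by
  ext x y
  simp only [Matrix.sum_apply, piTensor_update_apply, Finset.sum_mul]

lemma piTensor_update_one_apply [DecidableEq ι] [∀ i, DecidableEq (n i)] (k : ι)
    (M : Matrix (n k) (n k) R) (x y : ∀ i, n i) :
    piTensor (Function.update (fun i => (1 : Matrix (n i) (n i) R)) k M) x y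
      = if ∀ i ≠ k, x i = y i then M (x k) (y k) else 0 := by
  simp only [piTensor_update_apply, Matrix.one_apply, Finset.prod_ite_zero, Finset.mem_erase,
    Finset.mem_univ, and_true, Finset.prod_const_one, mul_ite, mul_one, mul_zero]

lemma piTensor_update_mul_mulVec [DecidableEq ι] [∀ i, Fintype (m i)] [∀ i, Fintype (n i)]
    (B : ∀ i, Matrix (m i) (n i) R) (k : ι) (N : Matrix (m k) (m k) R) (Ψ : (∀ i, n i) → R)
    (x : ∀ i, m i) :
    (piTensor (Function.update B k (N * B k)) *ᵥ Ψ) x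
      = ∑ a, N (x k) a * (piTensor B *ᵥ Ψ) (Function.update x k a) := by
  have erase_update (a : m k) (y : ∀ i, n i) :
      ∏ i ∈ Finset.univ.erase k, B i (Function.update x k a i) (y i)
        = ∏ i ∈ Finset.univ.erase k, B i (x i) (y i) :=
    Finset.prod_congr rfl fun i hi => by rw [Function.update_of_ne (Finset.ne_of_mem_erase hi)]
  have entry (y : ∀ i, n i) : piTensor (Function.update B k (N * B k)) x y
      = ∑ a, N (x k) a * piTensor B (Function.update x k a) y := by
    simp only [piTensor_update_apply, Matrix.mul_apply, Finset.sum_mul, piTensor_apply B,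
      ← Finset.mul_prod_erase _ _ (Finset.mem_univ k), Function.update_self, erase_update,
      mul_assoc]
  simp only [Matrix.mulVec, dotProduct, entry, Finset.sum_mul, Finset.mul_sum, mul_assoc]
  exact Finset.sum_comm

lemma piTensor_eq_submatrix_curry {X X' m n : Type*} [Fintype X] [Fintype X']
    (A : X × X' → Matrix m n R) :
    piTensor A = (piTensor fun i => piTensor fun j => A (i, j)).submatrix
      (Equiv.curry X X' m) (Equiv.curry X X' n) := by
  ext a b
  simp only [Matrix.submatrix_apply, piTensor_apply]
  exact Fintype.prod_prod_type _

lemma tensorOp_eq_piTensor {P : Type u} [Fintype P] {I I' : P → Type u}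
    (A : ∀ v, Matrix (I' v) (I v) ℂ) : tensorOp A = piTensor A := rfl

end PiTensor

section IsKrausFamily

variable {J m n : Type*} [Fintype J] [Fintype m] [DecidableEq n]

/-- `K` is a complete family of Kraus operators, that is, a measurement whose outcome `j`
transforms the state by `K j`. -/
def IsKrausFamily (K : J → Matrix m n ℂ) : Prop :=
  ∑ j, (K j)ᴴ * K j = 1

lemma isKrausFamily_of_isometry [Unique J] {A : Matrix m n ℂ} (hA : Aᴴ * A = 1) :
    IsKrausFamily fun _ : J => A := by
  simpa [IsKrausFamily] using hA

lemma IsKrausFamily.sum_conjTranspose_mul_self {l : Type*} {K : J → Matrix m n ℂ}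
    [Fintype n] (hK : IsKrausFamily K) (L : Matrix n l ℂ) :
    ∑ j, (K j * L)ᴴ * (K j * L) = Lᴴ * L := by
  calc ∑ j, (K j * L)ᴴ * (K j * L)
      = Lᴴ * (∑ j, (K j)ᴴ * K j) * L := by
        simp only [Matrix.conjTranspose_mul, Matrix.mul_sum, Matrix.sum_mul, Matrix.mul_assoc]
    _ = Lᴴ * L := by rw [hK, Matrix.mul_one]

lemma IsKrausFamily.sigma_mul {l : Type*} [Fintype l] {J' : J → Type*}
    [∀ j, Fintype (J' j)] {m : J → Type*} [∀ j, Fintype (m j)] [∀ j, DecidableEq (m j)]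
    {L : ∀ j, Matrix (m j) n ℂ} {K : ∀ j, J' j → Matrix l (m j) ℂ}
    (hL : ∑ j, (L j)ᴴ * L j = 1) (hK : ∀ j, IsKrausFamily (K j)) :
    IsKrausFamily fun s : Σ j, J' j => K s.1 s.2 * L s.1 := by
  rw [IsKrausFamily, Fintype.sum_sigma]
  simp only [fun j => (hK j).sum_conjTranspose_mul_self (L j), hL]

lemma IsKrausFamily.prod_mul {J' l : Type*} [Fintype J'] [Fintype l] [DecidableEq m]
    {K : J → Matrix l m ℂ} {L : J' → Matrix m n ℂ} (hK : IsKrausFamily K)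
    (hL : IsKrausFamily L) : IsKrausFamily fun s : J × J' => K s.1 * L s.2 := by
  rw [IsKrausFamily, Fintype.sum_prod_type_right]
  simp only [hK.sum_conjTranspose_mul_self]
  exact hL

lemma IsKrausFamily.mul_mul {l k : Type*} [Fintype l] [Fintype k] [DecidableEq l]
    [DecidableEq m] {K : J → Matrix l m ℂ} (hK : IsKrausFamily K) {U : Matrix k l ℂ}
    (hU : Uᴴ * U = 1) {V : Matrix m n ℂ} (hV : Vᴴ * V = 1) :
    IsKrausFamily fun j => U * K j * V := by
  have cancel (j : J) : (U * K j * V)ᴴ * (U * K j * V) = (K j * V)ᴴ * (K j * V) := by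
    rw [Matrix.mul_assoc, Matrix.conjTranspose_mul U, Matrix.mul_assoc, ← Matrix.mul_assoc Uᴴ,
      hU, Matrix.one_mul]
  simp only [IsKrausFamily, cancel, hK.sum_conjTranspose_mul_self, hV]

lemma IsKrausFamily.submatrix {m' n' : Type*} [Fintype m'] [DecidableEq n']
    {K : J → Matrix m n ℂ} (hK : IsKrausFamily K) (f : m' ≃ m) (e : n' ≃ n) :
    IsKrausFamily fun j => (K j).submatrix f e := by
  have sum_submatrix : ∑ j, ((K j)ᴴ * K j).submatrix e e = (∑ j, (K j)ᴴ * K j).submatrix e e := by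
    ext a b
    simp [Matrix.sum_apply]
  simp only [IsKrausFamily, Matrix.conjTranspose_submatrix, Matrix.submatrix_mul_equiv,
    sum_submatrix]
  rw [hK, Matrix.submatrix_one_equiv]

lemma IsKrausFamily.piTensor {ι : Type*} [Fintype ι] [DecidableEq ι] {J m n : ι → Type*}
    [∀ i, Fintype (J i)] [∀ i, Fintype (m i)] [∀ i, DecidableEq (n i)]
    {K : ∀ i, J i → Matrix (m i) (n i) ℂ} (hK : ∀ i, IsKrausFamily (K i)) :
    IsKrausFamily fun t : ∀ i, J i => piTensor fun i => K i (t i) := by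
  rw [IsKrausFamily]
  simp only [piTensor_conjTranspose, piTensor_mul]
  rw [sum_piTensor fun i j => (K i j)ᴴ * K i j, ← piTensor_one]
  exact congrArg _ (funext hK)

end IsKrausFamily

/-! ### LOCC protocols for pure states -/

lemma sum_tensorOp_conjTranspose_mul {P : Type u} [Fintype P] [DecidableEq P] {I : P → Type u}
    [∀ v, DecidableEq (I v)] {J : Type*} [Fintype J] {I' : J → P → Type u}
    [∀ j v, Fintype (I' j v)] (k : P) (A : ∀ j v, Matrix (I' j v) (I v) ℂ)
    (measurement : ∑ j, (A j k)ᴴ * A j k = 1)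
    (isometry : ∀ j v, v ≠ k → (A j v)ᴴ * A j v = 1) :
    ∑ j, (tensorOp (A j))ᴴ * tensorOp (A j) = 1 := by
  have gram (j : J) : (tensorOp (A j))ᴴ * tensorOp (A j)
      = piTensor (Function.update (fun v => (1 : Matrix (I v) (I v) ℂ)) k ((A j k)ᴴ * A j k)) := by
    rw [tensorOp_eq_piTensor, piTensor_conjTranspose, piTensor_mul]
    congr 1
    exact Function.eq_update_iff.2 ⟨rfl, isometry j⟩
  simp only [gram]
  rw [sum_piTensor_update, measurement, ← piTensor_one]
  exact congrArg piTensor (Function.update_eq_self k fun v => (1 : Matrix (I v) (I v) ℂ))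

section LOCC

variable {P : Type u} [Fintype P] [DecidableEq P] {O : P → Type u}
  [∀ v, Fintype (O v)] [∀ v, DecidableEq (O v)] {I : P → Type u} [∀ v, Fintype (I v)]
  [∀ v, DecidableEq (I v)]

lemma IsLOCC.exists_kraus
    {Λ : Matrix (∀ v, I v) (∀ v, I v) ℂ → Matrix (∀ v, O v) (∀ v, O v) ℂ} (h : IsLOCC I Λ) :
    ∃ (ι : Type) (_ : Fintype ι) (K : ι → Matrix (∀ v, O v) (∀ v, I v) ℂ),
      (∀ ρ, Λ ρ = ∑ i, K i * ρ * (K i)ᴴ) ∧ IsKrausFamily K := by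
  induction h with
  | done => exact ⟨Unit, inferInstance, fun _ => 1, by simp, by simp [IsKrausFamily]⟩
  | round k _ A measurement isometry _ _ ih =>
    choose ι _ K hΛ hK using ih
    have hA := sum_tensorOp_conjTranspose_mul k A measurement isometry
    refine ⟨Σ j, ι j, inferInstance, fun s => K s.1 s.2 * tensorOp (A s.1), fun ρ => ?_, ?_⟩
    · simp only [hΛ, Fintype.sum_sigma, Matrix.conjTranspose_mul, Matrix.mul_assoc]
    · exact IsKrausFamily.sigma_mul (L := fun j => tensorOp (A j)) (K := K) hA hK

/-- There is an LOCC protocol which sends every (unnormalised) pure state in `S` to a multiple of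
the pure state `ψ`. -/
def Distills (ψ : (∀ v, O v) → ℂ) (I : P → Type u) [∀ v, Fintype (I v)] [∀ v, DecidableEq (I v)]
    (S : Set ((∀ v, I v) → ℂ)) : Prop :=
  ∃ Λ : Matrix (∀ v, I v) (∀ v, I v) ℂ → Matrix (∀ v, O v) (∀ v, O v) ℂ, IsLOCC I Λ ∧
    ∀ Φ ∈ S, ∃ c : ℂ, Λ (Matrix.vecMulVec Φ (star Φ)) = c • Matrix.vecMulVec ψ (star ψ)

lemma mul_vecMulVec_star_mul_conjTranspose {m n : Type*} [Fintype n] (A : Matrix m n ℂ)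
    (Φ : n → ℂ) :
    A * Matrix.vecMulVec Φ (star Φ) * Aᴴ = Matrix.vecMulVec (A *ᵥ Φ) (star (A *ᵥ Φ)) := by
  rw [Matrix.mul_vecMulVec, Matrix.vecMulVec_mul, Matrix.star_mulVec]

variable {ψ : (∀ v, O v) → ℂ}

lemma Distills.mono {S S' : Set ((∀ v, I v) → ℂ)} (h : Distills ψ I S') (hS : S ⊆ S') :
    Distills ψ I S := by
  obtain ⟨Λ, hΛ, hΛS'⟩ := h
  exact ⟨Λ, hΛ, fun Φ hΦ => hΛS' Φ (hS hΦ)⟩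

lemma Distills.of_forall_eq_smul {S : Set ((∀ v, O v) → ℂ)}
    (hS : ∀ Φ ∈ S, ∃ c : ℂ, Φ = c • ψ) : Distills ψ O S := by
  refine ⟨_, IsLOCC.done, fun Φ hΦ => ?_⟩
  obtain ⟨c, rfl⟩ := hS Φ hΦ
  exact ⟨c * star c, by rw [star_smul, Matrix.smul_vecMulVec, Matrix.vecMulVec_smul, smul_smul]⟩

lemma Distills.round {I' : P → Type u} [∀ v, Fintype (I' v)] [∀ v, DecidableEq (I' v)]
    (k : P) {J : Type*} [Fintype J] (A : J → ∀ v, Matrix (I' v) (I v) ℂ)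
    (measurement : IsKrausFamily fun j => A j k)
    (isometry : ∀ j v, v ≠ k → (A j v)ᴴ * A j v = 1) {S : Set ((∀ v, I v) → ℂ)}
    (h : ∀ j, Distills ψ I' ((tensorOp (A j) *ᵥ ·) '' S)) :
    Distills ψ I S := by
  let e := (Fintype.equivFin J).symm
  choose Λ hΛ hΛψ using h
  refine ⟨_, IsLOCC.round (J := Fin (Fintype.card J)) k (fun _ => I') (fun j => A (e j)) ?_
    (fun j v hv => isometry (e j) v hv) (fun j => Λ (e j)) (fun j => hΛ (e j)), fun Φ hΦ => ?_⟩
  · rw [e.sum_comp fun j => (A j k)ᴴ * A j k]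
    exact measurement
  · choose c hc using fun j => hΛψ j _ (Set.mem_image_of_mem _ hΦ)
    exact ⟨∑ j, c (e j), by simp only [mul_vecMulVec_star_mul_conjTranspose, hc, Finset.sum_smul]⟩

section MeasureAll

variable {J : P → Type*}

/-- The local basis of `v` while the parties measure one after another: `I v` as long as `b` says
that the measurement of `v` is pending, and `O v` afterwards. -/
def PendingIdx (O I : P → Type u) (b : Bool) (v : P) : Type u := cond b (I v) (O v)

instance (b : Bool) (v : P) : Fintype (PendingIdx O I b v) :=
  match b with
  | true => inferInstanceAs (Fintype (I v))
  | false => inferInstanceAs (Fintype (O v))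

instance (b : Bool) (v : P) : DecidableEq (PendingIdx O I b v) :=
  match b with
  | true => inferInstanceAs (DecidableEq (I v))
  | false => inferInstanceAs (DecidableEq (O v))

/-- The operator which still has to be applied at `v` in order to obtain the outcome `j`. -/
def pendingOp (A : ∀ v, J v → Matrix (O v) (I v) ℂ) :
    ∀ (b : Bool) (v : P), J v → Matrix (O v) (PendingIdx O I b v) ℂ
  | true, v, j => A v j
  | false, v, _ => (1 : Matrix (O v) (O v) ℂ)

/-- The operator applied at `v` in a round which turns the status of `v` from `b` into `b'`; no
measurement is ever undone, and the value in that case is irrelevant. -/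
def pendingStep (A : ∀ v, J v → Matrix (O v) (I v) ℂ) :
    ∀ (b b' : Bool) (v : P), J v → Matrix (PendingIdx O I b' v) (PendingIdx O I b v) ℂ
  | true, false, v, j => A v j
  | true, true, v, _ => (1 : Matrix (I v) (I v) ℂ)
  | false, false, v, _ => (1 : Matrix (O v) (O v) ℂ)
  | false, true, _, _ => 0

omit [Fintype P] [DecidableEq P] [∀ v, Fintype (O v)] [∀ v, Fintype (I v)] in
lemma pendingStep_self (A : ∀ v, J v → Matrix (O v) (I v) ℂ) (b : Bool) (v : P) (j : J v) :
    pendingStep A b b v j = 1 := by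
  cases b <;> rfl

omit [Fintype P] [DecidableEq P] in
lemma pendingStep_isometry (A : ∀ v, J v → Matrix (O v) (I v) ℂ) {b b' : Bool} (hb : b' = b)
    (v : P) (j : J v) : (pendingStep A b b' v j)ᴴ * pendingStep A b b' v j = 1 := by
  subst hb
  rw [pendingStep_self, Matrix.conjTranspose_one, Matrix.mul_one]

omit [Fintype P] [DecidableEq P] in
lemma IsKrausFamily.pendingStep {A : ∀ v, J v → Matrix (O v) (I v) ℂ} {v : P}
    [Fintype (J v)] (hA : IsKrausFamily (A v)) {b b' : Bool} (hb : b = true) (hb' : b' = false) :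
    IsKrausFamily fun j => pendingStep A b b' v j := by
  subst hb hb'
  exact hA

omit [Fintype P] [DecidableEq P] in
lemma pendingOp_false_mul_pendingStep (A : ∀ v, J v → Matrix (O v) (I v) ℂ) (v : P)
    (i j : J v) : pendingOp A false v i * pendingStep A true false v j = pendingOp A true v j :=
  Matrix.one_mul (A v j)

lemma tensorOp_pendingOp_mul_pendingStep (A : ∀ v, J v → Matrix (O v) (I v) ℂ) {f : P → Bool}
    {k : P} (hk : f k = true) (i j : ∀ v, J v) :
    tensorOp (fun v => pendingOp A (Function.update f k false v) v (i v))
        * tensorOp (fun v => pendingStep A (f v) (Function.update f k false v) v (j v))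
      = tensorOp fun v => pendingOp A (f v) v (Function.update i k (j k) v) := by
  simp only [tensorOp_eq_piTensor, piTensor_mul]
  congr 1
  funext v
  by_cases hv : v = k
  · subst hv
    rw [hk, Function.update_self, Function.update_self]
    exact pendingOp_false_mul_pendingStep A v _ _
  · rw [Function.update_of_ne hv, Function.update_of_ne hv, pendingStep_self, Matrix.mul_one]

lemma Distills.of_pending [∀ v, Fintype (J v)] [∀ v, Nonempty (J v)]
    {A : ∀ v, J v → Matrix (O v) (I v) ℂ} (hA : ∀ v, IsKrausFamily (A v)) (s : Finset P) :
    ∀ (f : P → Bool), (∀ v, f v = true ↔ v ∈ s) → ∀ S : Set ((∀ v, PendingIdx O I (f v) v) → ℂ),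
      (∀ Φ ∈ S, ∀ j : ∀ v, J v,
        ∃ c : ℂ, tensorOp (fun v => pendingOp A (f v) v (j v)) *ᵥ Φ = c • ψ) →
      Distills ψ (fun v => PendingIdx O I (f v) v) S := by
  have j₀ : ∀ v, J v := fun v => Classical.arbitrary _
  induction s using Finset.induction_on with
  | empty =>
    intro f hf S hS
    obtain rfl : f = fun _ => false := funext fun v => by simpa using hf v
    have tensorOp_one : tensorOp (fun v => pendingOp A false v (j₀ v))
        = (1 : Matrix (∀ v, O v) (∀ v, O v) ℂ) := piTensor_one
    refine Distills.of_forall_eq_smul (O := O) (S := S) fun Φ hΦ => ?_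
    obtain ⟨c, hc⟩ := hS Φ hΦ j₀
    exact ⟨c, (Matrix.one_mulVec Φ).symm.trans (tensorOp_one ▸ hc)⟩
  | insert k s hks ih =>
    intro f hf S hS
    have hk : f k = true := (hf k).2 (Finset.mem_insert_self k s)
    let f' := Function.update f k false
    have hf' (v : P) : f' v = true ↔ v ∈ s := by
      by_cases hv : v = k
      · simp [f', hv, hks]
      · simp [f', hv, hf]
    refine Distills.round (J := J k) k
      (fun j v => pendingStep A (f v) (f' v) v (Function.update j₀ k j v)) ?_ ?_
      fun j => ih f' hf' _ ?_
    · simp only [Function.update_self]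
      exact (hA k).pendingStep hk (Function.update_self k false f)
    · exact fun j v hv => pendingStep_isometry A (Function.update_of_ne hv false f) v _
    · rintro _ ⟨Φ, hΦ, rfl⟩ i
      obtain ⟨c, hc⟩ := hS Φ hΦ (Function.update i k j)
      refine ⟨c, ?_⟩
      rw [Matrix.mulVec_mulVec, tensorOp_pendingOp_mul_pendingStep A hk, Function.update_self, hc]

lemma Distills.measure_all [∀ v, Fintype (J v)] [∀ v, Nonempty (J v)]
    (A : ∀ v, J v → Matrix (O v) (I v) ℂ) (hA : ∀ v, IsKrausFamily (A v))
    {S : Set ((∀ v, I v) → ℂ)}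
    (hS : ∀ Φ ∈ S, ∀ j : ∀ v, J v, ∃ c : ℂ, tensorOp (fun v => A v (j v)) *ᵥ Φ = c • ψ) :
    Distills ψ I S :=
  Distills.of_pending (I := I) hA Finset.univ (fun _ => true) (by simp) S hS

end MeasureAll

lemma Distills.reindex [Nonempty P] {I' : P → Type u} [∀ v, Fintype (I' v)]
    [∀ v, DecidableEq (I' v)]
    (e : ∀ v, I v ≃ I' v) {S : Set ((∀ v, I v) → ℂ)} {S' : Set ((∀ v, I' v) → ℂ)}
    (h : Distills ψ I' S') (hS : ∀ Φ ∈ S, (fun y => Φ fun v => (e v).symm (y v)) ∈ S') :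
    Distills ψ I S := by
  let U (v : P) : Matrix (I' v) (I v) ℂ := (1 : Matrix (I v) (I v) ℂ).submatrix (e v).symm id
  have hU (v : P) : (U v)ᴴ * U v = 1 := by
    simp [U, Matrix.conjTranspose_submatrix]
  refine Distills.round (Classical.arbitrary P) (J := Unit) (fun _ => U)
    (isKrausFamily_of_isometry (hU _)) (fun _ v _ => hU v) fun _ => h.mono ?_
  rintro _ ⟨Φ, hΦ, rfl⟩
  have tensorOp_eq : tensorOp U = (1 : Matrix (∀ v, I v) (∀ v, I v) ℂ).submatrix
      (Equiv.piCongrRight e).symm id := by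
    rw [← piTensor_one]
    rfl
  convert hS Φ hΦ using 1
  funext y
  rw [tensorOp_eq]
  exact congrFun (Matrix.one_mulVec Φ) _

end LOCC

/-! ### Measurements of some of the qudits -/

section LocalOp

variable {X W G R : Type*} [Semiring R]

lemma sum_eq_sum_extend [Fintype X] [Fintype W] [Fintype G] [DecidableEq X] [DecidableEq W]
    {M : Type*} [AddCommMonoid M] {ι : X → W} (hι : ι.Injective) (b : W → G) (f : (W → G) → M)
    (hf : ∀ c, (∃ w ∉ Set.range ι, c w ≠ b w) → f c = 0) :
    ∑ c, f c = ∑ z : X → G, f (Function.extend ι z b) := by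
  classical
  have extend_injective : (fun z : X → G => Function.extend ι z b).Injective := fun z z' h => by
    rw [← Function.extend_comp hι z b, ← Function.extend_comp hι z' b]
    exact congrArg (· ∘ ι) h
  rw [← Finset.sum_image (g := fun z : X → G => Function.extend ι z b) (f := f)
    extend_injective.injOn]
  refine (Finset.sum_subset (Finset.subset_univ _) fun c _ hc => hf c ?_).symm
  by_contra! h
  refine hc (Finset.mem_image.2 ⟨c ∘ ι, Finset.mem_univ _, funext fun w => ?_⟩)
  by_cases hw : w ∈ Set.range ι
  · obtain ⟨x, rfl⟩ := hw
    rw [hι.extend_apply, Function.comp_apply]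
  · rw [Function.extend_apply' _ _ _ hw, h w hw]

open Classical in
/-- The operator `K` on the qudits in the range of `ι`, tensored with the identity. -/
noncomputable def localOp (ι : X → W) (K : Matrix (X → G) (X → G) R) :
    Matrix (W → G) (W → G) R :=
  Matrix.of fun a b => if ∀ w ∉ Set.range ι, a w = b w then K (a ∘ ι) (b ∘ ι) else 0

open Classical in
lemma localOp_apply (ι : X → W) (K : Matrix (X → G) (X → G) R) (a b : W → G) :
    localOp ι K a b = if ∀ w ∉ Set.range ι, a w = b w then K (a ∘ ι) (b ∘ ι) else 0 := rfl

lemma localOp_comp {Y : Type*} {ι : X → W} (hι : ι.Injective) (κ : Y → X)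
    (K : Matrix (Y → G) (Y → G) R) : localOp ι (localOp κ K) = localOp (ι ∘ κ) K := by
  have agree_iff (a b : W → G) : (∀ w ∉ Set.range (ι ∘ κ), a w = b w) ↔
      (∀ w ∉ Set.range ι, a w = b w) ∧ ∀ x ∉ Set.range κ, a (ι x) = b (ι x) := by
    refine ⟨fun h => ⟨fun w hw => h w fun hw' => hw (Set.range_comp_subset_range κ ι hw'),
      fun x hx => h (ι x) ?_⟩, fun h w hw => ?_⟩
    · rintro ⟨y, hy⟩
      exact hx ⟨y, hι hy⟩
    · by_cases hwι : w ∈ Set.range ι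
      · obtain ⟨x, rfl⟩ := hwι
        refine h.2 x ?_
        rintro ⟨y, rfl⟩
        exact hw ⟨y, rfl⟩
      · exact h.1 w hwι
  classical
  ext a b
  simp only [localOp_apply, agree_iff, ite_and, Function.comp_apply, Function.comp_assoc]

lemma localOp_mulVec_apply [Fintype X] [Fintype W] [Fintype G] [DecidableEq X] [DecidableEq W]
    {ι : X → W} (hι : ι.Injective) (K : Matrix (X → G) (X → G) R) (Φ : (W → G) → R) (y : W → G) :
    (localOp ι K *ᵥ Φ) y = ∑ z, K (y ∘ ι) z * Φ (Function.extend ι z y) := by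
  rw [Matrix.mulVec, dotProduct, sum_eq_sum_extend hι y]
  · refine Finset.sum_congr rfl fun z _ => ?_
    have agree (w : W) (hw : w ∉ Set.range ι) : y w = Function.extend ι z y w :=
      (Function.extend_apply' z y w hw).symm
    rw [localOp_apply, if_pos agree, Function.extend_comp hι]
  · rintro c ⟨w, hw, h⟩
    rw [localOp_apply, if_neg fun h' => h (h' w hw).symm, zero_mul]

lemma localOp_mul [Fintype X] [Fintype W] [Fintype G] [DecidableEq X] [DecidableEq W]
    {ι : X → W} (hι : ι.Injective) (K K' : Matrix (X → G) (X → G) R) :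
    localOp ι K * localOp ι K' = localOp ι (K * K') := by
  classical
  ext a b
  have agree_iff (z : X → G) : (∀ w ∉ Set.range ι, Function.extend ι z a w = b w)
      ↔ ∀ w ∉ Set.range ι, a w = b w :=
    forall₂_congr fun w hw => by rw [Function.extend_apply' _ _ _ hw]
  have entry : (localOp ι K * localOp ι K') a b = (localOp ι K *ᵥ fun c => localOp ι K' c b) a :=
    rfl
  simp only [entry, localOp_mulVec_apply hι, localOp_apply, agree_iff, Function.extend_comp hι]
  split_ifs
  · rw [Matrix.mul_apply]
  · simp only [mul_zero, Finset.sum_const_zero]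

lemma localOp_conjTranspose [StarRing R] (ι : X → W) (K : Matrix (X → G) (X → G) R) :
    (localOp ι K)ᴴ = localOp ι Kᴴ := by
  classical
  ext a b
  simp only [localOp_apply, Matrix.conjTranspose_apply, apply_ite star, star_zero, @eq_comm _ (b _)]

lemma localOp_one [DecidableEq (X → G)] [DecidableEq (W → G)] (ι : X → W) :
    localOp ι (1 : Matrix (X → G) (X → G) R) = 1 := by
  classical
  ext a b
  have eq_iff : a = b ↔ (∀ w ∉ Set.range ι, a w = b w) ∧ a ∘ ι = b ∘ ι := by
    refine ⟨by rintro rfl; exact ⟨fun _ _ => rfl, rfl⟩, fun h => funext fun w => ?_⟩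
    by_cases hw : w ∈ Set.range ι
    · obtain ⟨x, rfl⟩ := hw
      exact congrFun h.2 x
    · exact h.1 w hw
  simp only [localOp_apply, Matrix.one_apply, eq_iff, ite_and]

lemma sum_localOp {J : Type*} [Fintype J] (ι : X → W) (K : J → Matrix (X → G) (X → G) R) :
    ∑ j, localOp ι (K j) = localOp ι (∑ j, K j) := by
  ext a b
  simp only [localOp_apply, Matrix.sum_apply]
  split_ifs
  · rfl
  · exact Finset.sum_const_zero

lemma IsKrausFamily.localOp [Fintype X] [Fintype W] [Fintype G] [DecidableEq X] [DecidableEq W]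
    [DecidableEq G] {J : Type*} [Fintype J] {ι : X → W} (hι : ι.Injective)
    {K : J → Matrix (X → G) (X → G) ℂ} (hK : IsKrausFamily K) :
    IsKrausFamily fun j => localOp ι (K j) := by
  simp only [IsKrausFamily, localOp_conjTranspose, localOp_mul hι]
  rw [sum_localOp, hK, localOp_one]

end LocalOp

section Owned

variable {P : Type u} [Fintype P] [DecidableEq P] {O : P → Type u}
  [∀ v, Fintype (O v)] [∀ v, DecidableEq (O v)] {ψ : (∀ v, O v) → ℂ}
  {Q Q' : Type u} [Fintype Q] [DecidableEq Q] [Fintype Q'] [DecidableEq Q']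
  {G : Type} [Fintype G] [DecidableEq G]

/-- Labels of all qudits, grouped by owner. -/
def ownedEquiv (G : Type) {P Q : Type u} (own : Q → P) :
    (∀ v, {q // own q = v} → G) ≃ (Q → G) where
  toFun f q := f (own q) ⟨q, rfl⟩
  invFun y _ q := y q
  left_inv f := by
    funext v ⟨q, hq⟩
    subst hq
    rfl
  right_inv _ := rfl

/-- `Distills` for a system of qudits `Q` in which `q` is held by the party `own q`. -/
def OwnedDistills (ψ : (∀ v, O v) → ℂ) (own : Q → P) (S : Set ((Q → G) → ℂ)) : Prop :=
  Distills ψ (fun v => {q // own q = v} → G) {Φ | Φ ∘ (ownedEquiv G own).symm ∈ S}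

lemma OwnedDistills.mono {own : Q → P} {S S' : Set ((Q → G) → ℂ)} (h : OwnedDistills ψ own S')
    (hS : S ⊆ S') : OwnedDistills ψ own S :=
  Distills.mono h fun _ hΦ => hS hΦ

lemma OwnedDistills.relabel [Nonempty P] {own : Q → P} {own' : Q' → P} (σ : Q ≃ Q')
    (hσ : ∀ q, own' (σ q) = own q) {S : Set ((Q → G) → ℂ)} {S' : Set ((Q' → G) → ℂ)}
    (h : OwnedDistills ψ own' S') (hS : ∀ Φ ∈ S, (fun y => Φ (y ∘ σ)) ∈ S') :
    OwnedDistills ψ own S :=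
  Distills.reindex (fun v => Equiv.arrowCongr (σ.subtypeEquiv fun q => by rw [hσ]) (Equiv.refl G))
    h fun _ hΦ => hS _ hΦ

omit [Fintype Q] [DecidableEq Q] [Fintype G] [DecidableEq G] in
lemma tensorOp_update_one_submatrix_ownedEquiv (own : Q → P) (u : P)
    (M : Matrix ({q // own q = u} → G) ({q // own q = u} → G) ℂ)
    [∀ v, DecidableEq ({q // own q = v} → G)] :
    (tensorOp (Function.update
        (fun v => (1 : Matrix ({q // own q = v} → G) ({q // own q = v} → G) ℂ)) u M)).submatrix
        (ownedEquiv G own).symm (ownedEquiv G own).symm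
      = localOp (Subtype.val : {q // own q = u} → Q) M := by
  classical
  ext x y
  have agree_iff : (∀ v ≠ u, (ownedEquiv G own).symm x v = (ownedEquiv G own).symm y v)
      ↔ ∀ w ∉ Set.range (Subtype.val : {q // own q = u} → Q), x w = y w := by
    refine ⟨fun h w hw => congrFun (h (own w) fun hwu => hw ⟨⟨w, hwu⟩, rfl⟩) ⟨w, rfl⟩,
      fun h v hv => funext fun q => h q ?_⟩
    rintro ⟨q', hq'⟩
    exact hv (by rw [← q.2, ← hq', q'.2])
  rw [Matrix.submatrix_apply, tensorOp_eq_piTensor, piTensor_update_one_apply, localOp_apply]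
  exact if_congr agree_iff rfl rfl

lemma OwnedDistills.measure {own : Q → P} {X : Type*} [Fintype X] [DecidableEq X] (u : P)
    {ι : X → Q} (hι : ι.Injective) (hu : ∀ x, own (ι x) = u) {J : Type*} [Fintype J]
    {K : J → Matrix (X → G) (X → G) ℂ} (hK : IsKrausFamily K) {S : Set ((Q → G) → ℂ)}
    (h : ∀ j, OwnedDistills ψ own ((localOp ι (K j) *ᵥ ·) '' S)) :
    OwnedDistills ψ own S := by
  let ι' (x : X) : {q // own q = u} := ⟨ι x, hu x⟩
  have hι' : ι'.Injective := fun x x' hx => hι (congrArg Subtype.val hx)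
  let A (j : J) : ∀ v, Matrix ({q // own q = v} → G) ({q // own q = v} → G) ℂ :=
    Function.update (fun _ => 1) u (localOp ι' (K j))
  refine Distills.round u A ?_ ?_ fun j => Distills.mono (h j) ?_
  · simp only [A, Function.update_self]
    exact hK.localOp hι'
  · intro j v hv
    simp only [A, Function.update_of_ne hv, Matrix.conjTranspose_one, Matrix.mul_one]
  · rintro _ ⟨Φ, hΦ, rfl⟩
    refine ⟨_, hΦ, ?_⟩
    have localOp_eq := localOp_comp (Subtype.val_injective (p := fun q => own q = u)) ι' (K j)
    rw [← tensorOp_update_one_submatrix_ownedEquiv] at localOp_eq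
    change localOp (Subtype.val ∘ ι') (K j) *ᵥ _ = _
    rw [← localOp_eq, Matrix.submatrix_mulVec_equiv, Function.comp_assoc, Equiv.symm_symm,
      Equiv.symm_comp_self]
    rfl

end Owned

/-! ### Teleportation -/

lemma star_inv_sqrt (x : ℝ) : star ((Real.sqrt x : ℂ)⁻¹) = (Real.sqrt x : ℂ)⁻¹ := by
  rw [← Complex.ofReal_inv]
  exact Complex.conj_ofReal _

lemma inv_sqrt_natCast_mul_self {n : ℕ} (hn : n ≠ 0) :
    (Real.sqrt n : ℂ)⁻¹ * (Real.sqrt n : ℂ)⁻¹ * n = 1 := by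
  rw [← mul_inv, ← Complex.ofReal_mul, Real.mul_self_sqrt (Nat.cast_nonneg _),
    Complex.ofReal_natCast, inv_mul_cancel₀ (Nat.cast_ne_zero.2 hn)]

section Bell

variable {G : Type*} [Fintype G] [DecidableEq G] [AddCommGroup G]

/-- The generalised Pauli (Heisenberg–Weyl) operators of a finite abelian group: shifts composed
with characters. -/
def weyl (s : G × AddChar G ℂ) : Matrix G G ℂ :=
  Matrix.of fun i j => if i = j + s.1 then s.2 j else 0

omit [Fintype G] in
lemma weyl_apply (s : G × AddChar G ℂ) (i j : G) :
    weyl s i j = if i = j + s.1 then s.2 j else 0 := rfl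

omit [Fintype G] in
lemma weyl_apply_mul_star [Finite G] (s : G × AddChar G ℂ) (i j i' j' : G) :
    weyl s i j * star (weyl s i' j')
      = if s.1 = i - j ∧ s.1 = i' - j' then s.2 (j - j') else 0 := by
  have shift_iff (a b : G) : a = b + s.1 ↔ s.1 = a - b := by
    rw [eq_sub_iff_add_eq, add_comm, eq_comm]
  have map_sub : s.2 (j - j') = s.2 j * star (s.2 j') := by
    rw [sub_eq_add_neg, AddChar.map_add_eq_mul, AddChar.map_neg_eq_conj, starRingEnd_apply]
  simp only [weyl_apply, shift_iff, map_sub, apply_ite star, star_zero, ite_mul, mul_ite, zero_mul,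
    mul_zero, ite_and]
  split_ifs <;> rfl

lemma weyl_conjTranspose_mul (s : G × AddChar G ℂ) : (weyl s)ᴴ * weyl s = 1 := by
  have star_mul_self (j : G) : star (s.2 j) * s.2 j = 1 := by
    rw [← starRingEnd_apply, ← AddChar.map_neg_eq_conj, ← AddChar.map_add_eq_mul, neg_add_cancel,
      AddChar.map_zero_eq_one]
  ext j j'
  simp only [Matrix.mul_apply, Matrix.conjTranspose_apply, weyl_apply, Matrix.one_apply,
    apply_ite star, star_zero, ite_mul, zero_mul, Finset.sum_ite_eq', Finset.mem_univ,
    if_true, mul_ite, mul_zero, add_left_inj, @eq_comm _ j' j]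
  split_ifs with h
  · rw [h, star_mul_self]
  · rfl

lemma weyl_mul_conjTranspose (s : G × AddChar G ℂ) : weyl s * (weyl s)ᴴ = 1 :=
  mul_eq_one_comm.1 (weyl_conjTranspose_mul s)

lemma sum_weyl_apply_mul_star (i j i' j' : G) :
    ∑ s, weyl s i j * star (weyl s i' j')
      = if i = i' ∧ j = j' then (Fintype.card G : ℂ) else 0 := by
  have eq_iff : i - j = i' - j' ∧ j - j' = 0 ↔ i = i' ∧ j = j' := by
    refine ⟨fun ⟨hi, hj⟩ => ?_, by rintro ⟨rfl, rfl⟩; simp⟩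
    obtain rfl := sub_eq_zero.1 hj
    exact ⟨sub_left_injective hi, rfl⟩
  simp only [weyl_apply_mul_star, Fintype.sum_prod_type, ite_and, Finset.sum_ite_irrel,
    Finset.sum_const_zero, Finset.sum_ite_eq', Finset.mem_univ, if_true, AddChar.sum_apply_eq_ite]
  rw [← ite_and, ← ite_and]
  exact if_congr eq_iff rfl rfl

/-- The Kraus operators of the measurement of two qudits in the basis of the maximally entangled
states `weyl s`. After the measurement the two qudits are reset to `0`. -/
noncomputable def bellMeasurement (s : G × AddChar G ℂ) : Matrix (G × G) (G × G) ℂ :=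
  Matrix.of fun x y =>
    if x = 0 then (Real.sqrt (Fintype.card G) : ℂ)⁻¹ * star (weyl s y.1 y.2) else 0

lemma isKrausFamily_bellMeasurement : IsKrausFamily (bellMeasurement (G := G)) := by
  set c : ℂ := (Real.sqrt (Fintype.card G) : ℂ)⁻¹ with hc
  have star_c : star c = c := star_inv_sqrt _
  have c_mul_c : c * c * Fintype.card G = 1 := inv_sqrt_natCast_mul_self Fintype.card_ne_zero
  have gram (s : G × AddChar G ℂ) (x y : G × G) : ((bellMeasurement s)ᴴ * bellMeasurement s) x y
      = c * c * (weyl s x.1 x.2 * star (weyl s y.1 y.2)) := by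
    simp only [Matrix.mul_apply, Matrix.conjTranspose_apply, bellMeasurement, Matrix.of_apply,
      apply_ite star, star_zero, ite_mul, zero_mul, Finset.sum_ite_eq', Finset.mem_univ, if_true,
      star_mul', star_star, star_c, ← hc]
    ring
  ext x y
  simp only [Matrix.sum_apply, gram, ← Finset.mul_sum, sum_weyl_apply_mul_star, Matrix.one_apply,
    mul_ite, c_mul_c, mul_zero, Prod.ext_iff]

end Bell

section Teleport

variable {P : Type u} [Fintype P] [DecidableEq P] {O : P → Type u}
  [∀ v, Fintype (O v)] [∀ v, DecidableEq (O v)] {ψ : (∀ v, O v) → ℂ}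
  {Q : Type u} [Fintype Q] [DecidableEq Q]
  {G : Type} [Fintype G] [DecidableEq G]

omit [Fintype Q] [Fintype G] [DecidableEq G] in
lemma extend_unit_eq_update (b : Q) (z : Unit → G) (y : Q → G) :
    Function.extend (fun _ => b) z y = Function.update y b (z ()) := by
  have hinj : Function.Injective fun _ : Unit => b := fun _ _ _ => rfl
  refine Function.eq_update_iff.2 ⟨hinj.extend_apply z y (), fun w hw => ?_⟩
  exact Function.extend_apply' z y w fun ⟨_, h⟩ => hw h.symm

omit [Fintype Q] [Fintype G] [DecidableEq G] [DecidableEq Q] in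
lemma cond_injective {q a : Q} (hqa : q ≠ a) : Function.Injective fun x : Bool => cond x a q := by
  rintro (_ | _) (_ | _) h
  exacts [rfl, absurd h hqa, absurd h hqa.symm, rfl]

omit [Fintype Q] [Fintype G] [DecidableEq G] in
lemma extend_bool_eq_update {q a : Q} (hqa : q ≠ a) (z : Bool → G) (y : Q → G) :
    Function.extend (fun x : Bool => cond x a q) z y
      = Function.update (Function.update y q (z false)) a (z true) := by
  refine Function.eq_update_iff.2 ⟨(cond_injective hqa).extend_apply z y true, fun w hwa => ?_⟩
  by_cases hwq : w = q
  · rw [hwq, Function.update_self]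
    exact (cond_injective hqa).extend_apply z y false
  · rw [Function.update_of_ne hwq, Function.extend_apply']
    rintro ⟨_ | _, h⟩
    exacts [hwq h.symm, hwa h.symm]

lemma OwnedDistills.measure_single {own : Q → P} (b : Q) {J : Type*} [Fintype J]
    {K : J → Matrix G G ℂ} (hK : IsKrausFamily K) {S : Set ((Q → G) → ℂ)}
    (h : ∀ j, OwnedDistills ψ own
      ((fun Φ y => ∑ k, K j (y b) k * Φ (Function.update y b k)) '' S)) :
    OwnedDistills ψ own S := by
  let e : (Unit → G) ≃ G := Equiv.funUnique Unit G
  have hinj : Function.Injective fun _ : Unit => b := fun _ _ _ => rfl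
  refine OwnedDistills.measure (own b) hinj (fun _ => rfl) (hK.submatrix e e) fun j => (h j).mono ?_
  rintro _ ⟨Φ, hΦ, rfl⟩
  refine ⟨Φ, hΦ, funext fun y => ?_⟩
  simp only [localOp_mulVec_apply hinj, extend_unit_eq_update, Matrix.submatrix_apply]
  exact (e.sum_comp fun k => K j (y b) k * Φ (Function.update y b k)).symm

lemma OwnedDistills.measure_pair {own : Q → P} {q a : Q} (hqa : q ≠ a) (hown : own a = own q)
    {J : Type*} [Fintype J] {K : J → Matrix (G × G) (G × G) ℂ} (hK : IsKrausFamily K)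
    {S : Set ((Q → G) → ℂ)}
    (h : ∀ j, OwnedDistills ψ own ((fun Φ y => ∑ z : G × G, K j (y q, y a) z *
      Φ (Function.update (Function.update y q z.1) a z.2)) '' S)) :
    OwnedDistills ψ own S := by
  let e : (Bool → G) ≃ G × G := Equiv.boolArrowEquivProd G
  have hinj := cond_injective hqa
  refine OwnedDistills.measure (own q) hinj (Bool.forall_bool.2 ⟨rfl, hown⟩) (hK.submatrix e e)
    fun j => (h j).mono ?_
  rintro _ ⟨Φ, hΦ, rfl⟩
  refine ⟨Φ, hΦ, funext fun y => ?_⟩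
  simp only [localOp_mulVec_apply hinj, extend_bool_eq_update hqa, Matrix.submatrix_apply]
  exact (e.sum_comp fun z => K j (y q, y a) z *
    Φ (Function.update (Function.update y q z.1) a z.2)).symm

omit [Fintype Q] [Fintype G] [DecidableEq G] in
lemma update_comp_swap {q a b : Q} (hqb : q ≠ b) (hab : a ≠ b) (y : Q → G) (i j k : G) :
    Function.update (Function.update (Function.update (y ∘ Equiv.swap q b) b k) q i) a j
      = Function.update (Function.update (Function.update y q i) a j) b k := by
  funext w
  by_cases hwa : w = a
  · simp [hwa, hab]
  by_cases hwb : w = b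
  · simp [hwb, hqb.symm, hab.symm]
  by_cases hwq : w = q
  · simp [hwq, hqb, hwq ▸ hwa]
  · simp [hwa, hwb, hwq, Equiv.swap_apply_of_ne_of_ne]

/-- The unnormalised state after `q` has been teleported through the pair `a`, `b`, where `s` is
the outcome of the Bell measurement of `q` and `a`. The qudit which was called `b` takes the name
of `q`, and `a` and `b` become the two qudits reset by the measurement. -/
noncomputable def teleportVec [AddCommGroup G] (q a b : Q) (s : G × AddChar G ℂ)
    (Φ : (Q → G) → ℂ) : (Q → G) → ℂ := fun y =>
  if y a = 0 ∧ y b = 0 then ∑ k, ∑ i, ∑ j, (Real.sqrt (Fintype.card G) : ℂ)⁻¹ *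
    (weyl s (y q) k * star (weyl s i j) *
      Φ (Function.update (Function.update (Function.update y q i) a j) b k)) else 0

lemma OwnedDistills.teleport [AddCommGroup G] {own : Q → P} {q a b : Q} (hqa : q ≠ a)
    (hqb : q ≠ b) (hab : a ≠ b) (hown : own a = own q) {S S' : Set ((Q → G) → ℂ)}
    (h : OwnedDistills ψ (own ∘ Equiv.swap q b) S')
    (hS : ∀ Φ ∈ S, ∀ s, teleportVec q a b s Φ ∈ S') :
    OwnedDistills ψ own S := by
  have : Nonempty P := ⟨own q⟩
  refine OwnedDistills.measure_pair hqa hown isKrausFamily_bellMeasurement fun s => ?_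
  refine OwnedDistills.measure_single b (J := Unit)
    (isKrausFamily_of_isometry (weyl_conjTranspose_mul s)) fun _ => ?_
  refine OwnedDistills.relabel (Equiv.swap q b) (own' := own ∘ Equiv.swap q b) (by simp) h ?_
  rintro _ ⟨_, ⟨Φ, hΦ, rfl⟩, rfl⟩
  convert hS Φ hΦ s using 1
  funext y
  simp only [teleportVec, update_comp_swap hqb hab, bellMeasurement, Matrix.of_apply,
    Function.update_of_ne hqb, Function.update_of_ne hab, Function.comp_apply,
    Equiv.swap_apply_left, Equiv.swap_apply_right, Equiv.swap_apply_of_ne_of_ne hqa.symm hab,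
    Prod.mk_eq_zero, and_comm (a := y b = 0), Fintype.sum_prod_type]
  split_ifs
  · simp only [Finset.mul_sum]
    refine Finset.sum_congr rfl fun k _ => Finset.sum_congr rfl fun i _ =>
      Finset.sum_congr rfl fun j _ => ?_
    ring
  · simp only [zero_mul, Finset.sum_const_zero, mul_zero]

end Teleport

/-! ### Transport of data qudits along edge-disjoint routes -/

section Transport

variable {P : Type u} {Z E : Type u} {G : Type} [Fintype G]

/-- `A` is a multiple of the identity. -/
def IsScalarOp {n : Type*} [DecidableEq n] (A : Matrix n n ℂ) : Prop := ∃ c : ℂ, A = c • 1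

/-- Data qudits `Z` in the state `Ψ`, with the operators `B` applied to them, together with pairs
of qudits `E` in the states with coefficients `M`. The two qudits of a pair are distinguished by a
Boolean, its sides. -/
def dataPairState [Fintype Z] [DecidableEq Z] [Fintype E] (Ψ : (Z → G) → ℂ) (B : Z → Matrix G G ℂ)
    (M : E → Matrix G G ℂ) : (Z ⊕ (E × Bool) → G) → ℂ := fun y =>
  (piTensor B *ᵥ Ψ) (y ∘ Sum.inl) * ∏ e, M e (y (Sum.inr (e, false))) (y (Sum.inr (e, true)))

/-- The coefficients of a pair seen from side `β`. -/
def pairSide (β : Bool) (M : Matrix G G ℂ) : Matrix G G ℂ := cond β Mᵀ M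

omit [Fintype G] in
lemma transpose_pairSide_smul_one [DecidableEq G] (β : Bool) (m : ℂ) :
    (pairSide β (m • (1 : Matrix G G ℂ)))ᵀ = m • 1 := by
  cases β <;> simp [pairSide]

lemma isScalarOp_smul_weyl_conj_pairSide_mul [DecidableEq G] [AddCommGroup G] {M B : Matrix G G ℂ}
    (hM : IsScalarOp M) (hB : IsScalarOp B) (β : Bool) (s : G × AddChar G ℂ) (c : ℂ) :
    IsScalarOp (c • (weyl s * (pairSide β M)ᵀ * (weyl s)ᴴ) * B) := by
  obtain ⟨m, rfl⟩ := hM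
  obtain ⟨b, rfl⟩ := hB
  refine ⟨c * m * b, ?_⟩
  rw [transpose_pairSide_smul_one, mul_smul_comm, mul_one, mul_smul_comm, mul_one,
    smul_mul_assoc, weyl_mul_conjTranspose, smul_smul, smul_smul]
  congr 1
  ring

variable [Fintype Z] [DecidableEq Z] [Fintype E] [DecidableEq E]

lemma dataPairState_update (Ψ : (Z → G) → ℂ) (B : Z → Matrix G G ℂ) (M : E → Matrix G G ℂ)
    (z : Z) (e : E) (β : Bool) (y : Z ⊕ (E × Bool) → G) (i j k : G) :
    dataPairState Ψ B M (Function.update (Function.update (Function.update y (Sum.inl z) i)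
      (Sum.inr (e, β)) j) (Sum.inr (e, !β)) k)
    = (piTensor B *ᵥ Ψ) (Function.update (y ∘ Sum.inl) z i) * (pairSide β (M e) j k *
      ∏ e' ∈ Finset.univ.erase e, M e' (y (Sum.inr (e', false))) (y (Sum.inr (e', true)))) := by
  rw [dataPairState, ← Finset.mul_prod_erase _ _ (Finset.mem_univ e)]
  congr 2
  · funext w
    by_cases hw : w = z
    · simp [hw]
    · simp [hw]
  · cases β <;> simp [pairSide]
  · refine Finset.prod_congr rfl fun e' he' => ?_
    simp [Finset.ne_of_mem_erase he']

lemma teleportVec_dataPairState [DecidableEq G] [AddCommGroup G] (Ψ : (Z → G) → ℂ)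
    (B : Z → Matrix G G ℂ) (M : E → Matrix G G ℂ) (z : Z) (e : E) (β : Bool)
    (s : G × AddChar G ℂ) :
    teleportVec (Sum.inl z) (Sum.inr (e, β)) (Sum.inr (e, !β)) s (dataPairState Ψ B M)
      = dataPairState Ψ (Function.update B z ((Real.sqrt (Fintype.card G) : ℂ)⁻¹ •
          (weyl s * (pairSide β (M e))ᵀ * (weyl s)ᴴ) * B z))
        (Function.update M e (Matrix.single 0 0 1)) := by
  funext y
  have other_pairs : ∏ e' ∈ Finset.univ.erase e, (Function.update M e (Matrix.single 0 0 1)) e'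
        (y (Sum.inr (e', false))) (y (Sum.inr (e', true)))
      = ∏ e' ∈ Finset.univ.erase e, M e' (y (Sum.inr (e', false))) (y (Sum.inr (e', true))) :=
    Finset.prod_congr rfl fun e' he' => by rw [Function.update_of_ne (Finset.ne_of_mem_erase he')]
  have reset_pair :
      (Matrix.single 0 0 1 : Matrix G G ℂ) (y (Sum.inr (e, false))) (y (Sum.inr (e, true)))
        = if y (Sum.inr (e, β)) = 0 ∧ y (Sum.inr (e, !β)) = 0 then 1 else 0 := by
    rw [Matrix.single_apply]
    refine if_congr ?_ rfl rfl
    cases β <;> simp [eq_comm, and_comm]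
  rw [teleportVec, dataPairState, ← Finset.mul_prod_erase _ _ (Finset.mem_univ e),
    piTensor_update_mul_mulVec, Function.update_self, other_pairs, reset_pair]
  simp only [dataPairState_update]
  split_ifs
  · simp only [Finset.sum_mul, one_mul, Matrix.smul_apply, Matrix.mul_apply, Finset.mul_sum,
      smul_eq_mul, Matrix.transpose_apply, Matrix.conjTranspose_apply, Function.comp_apply]
    rw [Finset.sum_comm]
    refine Finset.sum_congr rfl fun i _ => ?_
    rw [Finset.sum_comm]
    refine Finset.sum_congr rfl fun j _ => Finset.sum_congr rfl fun k _ => ?_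
    ring
  · rw [zero_mul, mul_zero]

/-- A list of pairs, each with the side on which it is entered, leading from `u` to `w`. -/
def IsRoute (own : E × Bool → P) : P → List (E × Bool) → P → Prop
  | u, [], w => u = w
  | u, s :: l, w => own s = u ∧ IsRoute own (own (s.1, !s.2)) l w

omit [Fintype E] [DecidableEq E] in
lemma IsRoute.congr {own own' : E × Bool → P} {l : List (E × Bool)} :
    ∀ {u w : P}, IsRoute own u l w → (∀ e ∈ l.map Prod.fst, ∀ β, own' (e, β) = own (e, β)) →
      IsRoute own' u l w := by
  induction l with
  | nil => exact fun h _ => h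
  | cons s l ih =>
    rintro u w ⟨hs, hl⟩ h
    have own'_eq := h s.1 List.mem_cons_self
    refine ⟨(own'_eq s.2).trans hs, ?_⟩
    rw [own'_eq]
    exact ih hl fun e he β => h e (List.mem_cons_of_mem _ he) β

/-- Routes which lead all data qudits from their owners to their targets and use no pair more than
once. -/
structure IsDisjointRouting (own : Z ⊕ (E × Bool) → P) (tgt : Z → P)
    (r : Z → List (E × Bool)) : Prop where
  isRoute : ∀ z, IsRoute (own ∘ Sum.inr) (own (Sum.inl z)) (r z) (tgt z)
  nodup : ∀ z, ((r z).map Prod.fst).Nodup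
  disjoint : ∀ z z', z ≠ z' → ((r z).map Prod.fst).Disjoint ((r z').map Prod.fst)

section Advance

variable {tgt : Z → P} {r : Z → List (E × Bool)} {z : Z} {e : E} {β : Bool} {l : List (E × Bool)}

omit [Fintype Z] [Fintype E] [DecidableEq E] in
lemma map_fst_update_tail_sublist (hz : r z = (e, β) :: l) (z' : Z) :
    ((Function.update r z l z').map Prod.fst).Sublist ((r z').map Prod.fst) := by
  by_cases hzz : z' = z
  · subst hzz
    rw [Function.update_self, hz]
    exact List.sublist_cons_self _ _
  · rw [Function.update_of_ne hzz]

variable {own : Z ⊕ (E × Bool) → P}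

omit [Fintype Z] [Fintype E] [DecidableEq E] in
lemma IsDisjointRouting.notMem_update_tail (h : IsDisjointRouting own tgt r)
    (hz : r z = (e, β) :: l) (z' : Z) : e ∉ (Function.update r z l z').map Prod.fst := by
  by_cases hzz : z' = z
  · subst hzz
    have nodup := h.nodup z'
    rw [hz] at nodup
    rw [Function.update_self]
    exact (List.nodup_cons.1 nodup).1
  · rw [Function.update_of_ne hzz]
    refine h.disjoint z z' (Ne.symm hzz) ?_
    rw [hz]
    exact List.mem_cons_self

omit [Fintype Z] [Fintype E] in
lemma IsDisjointRouting.advance (h : IsDisjointRouting own tgt r) (hz : r z = (e, β) :: l) :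
    IsDisjointRouting (own ∘ Equiv.swap (Sum.inl z) (Sum.inr (e, !β))) tgt
      (Function.update r z l) where
  isRoute z' := by
    refine IsRoute.congr (own := own ∘ Sum.inr) ?_ fun e' he' γ => ?_
    · by_cases hzz : z' = z
      · subst hzz
        have isRoute := h.isRoute z'
        rw [hz] at isRoute
        rw [Function.update_self, Function.comp_apply, Equiv.swap_apply_left]
        exact isRoute.2
      · rw [Function.update_of_ne hzz, Function.comp_apply,
          Equiv.swap_apply_of_ne_of_ne (Sum.inl_injective.ne hzz) Sum.inl_ne_inr]
        exact h.isRoute z'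
    · have hee : e' ≠ e := fun hee => h.notMem_update_tail hz z' (hee ▸ he')
      simp [Equiv.swap_apply_of_ne_of_ne, hee]
  nodup z' := (h.nodup z').sublist (map_fst_update_tail_sublist hz z')
  disjoint z₁ z₂ hne _ h₁ h₂ := h.disjoint z₁ z₂ hne
    ((map_fst_update_tail_sublist hz z₁).subset h₁) ((map_fst_update_tail_sublist hz z₂).subset h₂)

end Advance

variable [DecidableEq G]

/-- The states of data qudits and pairs in which the data qudits that are damaged, or have a
damaged pair on their remaining route, form a set in `𝒢`. -/
def routeStates (Ψ : (Z → G) → ℂ) (𝒢 : Set (Set Z)) (r : Z → List (E × Bool)) :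
    Set ((Z ⊕ (E × Bool) → G) → ℂ) :=
  {Φ | ∃ (B : Z → Matrix G G ℂ) (M : E → Matrix G G ℂ),
    {z | ¬ (IsScalarOp (B z) ∧ ∀ e ∈ (r z).map Prod.fst, IsScalarOp (M e))} ∈ 𝒢 ∧
      Φ = dataPairState Ψ B M}

lemma teleportVec_mem_routeStates [AddCommGroup G] {Ψ : (Z → G) → ℂ} {𝒢 : Set (Set Z)}
    (h𝒢 : IsLowerSet 𝒢) {tgt : Z → P} {own : Z ⊕ (E × Bool) → P} {r : Z → List (E × Bool)}
    (hr : IsDisjointRouting own tgt r) {z : Z} {e : E} {β : Bool} {l : List (E × Bool)}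
    (hz : r z = (e, β) :: l) {Φ : (Z ⊕ (E × Bool) → G) → ℂ} (hΦ : Φ ∈ routeStates Ψ 𝒢 r)
    (s : G × AddChar G ℂ) :
    teleportVec (Sum.inl z) (Sum.inr (e, β)) (Sum.inr (e, !β)) s Φ
      ∈ routeStates Ψ 𝒢 (Function.update r z l) := by
  obtain ⟨B, M, bad_mem, rfl⟩ := hΦ
  refine ⟨_, _, h𝒢 ?_ bad_mem, teleportVec_dataPairState Ψ B M z e β s⟩
  intro z' bad good
  refine bad ⟨?_, fun e' he' => ?_⟩
  · by_cases hzz : z' = z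
    · subst hzz
      rw [Function.update_self]
      refine isScalarOp_smul_weyl_conj_pairSide_mul (good.2 e ?_) good.1 β s _
      rw [hz]
      exact List.mem_cons_self
    · rw [Function.update_of_ne hzz]
      exact good.1
  · have hee : e' ≠ e := by
      rintro rfl
      exact hr.notMem_update_tail hz z' he'
    rw [Function.update_of_ne hee]
    exact good.2 e' ((map_fst_update_tail_sublist hz z').subset he')

lemma OwnedDistills.transport [Fintype P] [DecidableEq P] {O : P → Type u} [∀ v, Fintype (O v)]
    [∀ v, DecidableEq (O v)] {ψ : (∀ v, O v) → ℂ} [AddCommGroup G] (Ψ : (Z → G) → ℂ)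
    (tgt : Z → P) {𝒢 : Set (Set Z)} (h𝒢 : IsLowerSet 𝒢)
    (h : ∀ own : Z ⊕ (E × Bool) → P, (∀ z, own (Sum.inl z) = tgt z) →
      OwnedDistills ψ own (routeStates Ψ 𝒢 fun _ => [])) (n : ℕ) :
    ∀ (own : Z ⊕ (E × Bool) → P) (r : Z → List (E × Bool)), ∑ z, (r z).length = n →
      IsDisjointRouting own tgt r → OwnedDistills ψ own (routeStates Ψ 𝒢 r) := by
  induction n with
  | zero =>
    intro own r hn hr
    obtain rfl : r = fun _ => [] := funext fun z =>
      List.eq_nil_of_length_eq_zero (Finset.sum_eq_zero_iff.1 hn z (Finset.mem_univ z))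
    exact h own hr.isRoute
  | succ n ih =>
    intro own r hn hr
    obtain ⟨z, hz⟩ : ∃ z, r z ≠ [] := by
      by_contra! hnil
      simp [hnil] at hn
    obtain ⟨⟨e, β⟩, l, hz⟩ := List.exists_cons_of_ne_nil hz
    have own_start : own (Sum.inr (e, β)) = own (Sum.inl z) := by
      have isRoute := hr.isRoute z
      rw [hz] at isRoute
      exact isRoute.1
    have sum_length : ∑ z', (Function.update r z l z').length = n := by
      have lengths : (fun z' => (Function.update r z l z').length)
          = Function.update (fun z' => (r z').length) z l.length :=
        funext fun z' => Function.apply_update (fun _ => List.length) r z l z'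
      rw [lengths, Finset.sum_update_of_mem (Finset.mem_univ z)]
      rw [← Finset.add_sum_erase _ _ (Finset.mem_univ z), hz, List.length_cons] at hn
      rw [Finset.sdiff_singleton_eq_erase]
      omega
    exact OwnedDistills.teleport Sum.inl_ne_inr Sum.inl_ne_inr (by simp) own_start
      (ih _ _ sum_length (hr.advance hz)) fun _ hΦ => teleportVec_mem_routeStates h𝒢 hr hz hΦ

end Transport

/-! ### Error-correcting codes -/

/-- A code which encodes one qudit with local basis `G` in the qudits `X`, with a recovery
operation: a measurement whose outcome is ignored. -/
structure QuantumCode (X G : Type) [Fintype X] [DecidableEq X] [Fintype G] [DecidableEq G] where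
  Outcome : Type
  fintypeOutcome : Fintype Outcome
  enc : Matrix (X → G) G ℂ
  enc_isometry : encᴴ * enc = 1
  recover : Outcome → Matrix G (X → G) ℂ
  isKrausFamily_recover : IsKrausFamily recover

attribute [instance] QuantumCode.fintypeOutcome

namespace QuantumCode

variable {X X' G : Type} [Fintype X] [DecidableEq X] [Fintype X'] [DecidableEq X'] [Fintype G]
  [DecidableEq G]

/-- The operator on the encoded qudit caused by the errors `A` after recovery with outcome `s`. -/
def effect (C : QuantumCode X G) (A : X → Matrix G G ℂ) (s : C.Outcome) : Matrix G G ℂ :=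
  C.recover s * piTensor A * C.enc

/-- Arbitrary errors on the qudits in `F` are corrected. -/
def Corrects (C : QuantumCode X G) (F : Set X) : Prop :=
  ∀ A : X → Matrix G G ℂ, (∀ i ∉ F, IsScalarOp (A i)) → ∀ s, IsScalarOp (C.effect A s)

lemma Corrects.mono {C : QuantumCode X G} {F F' : Set X} (h : C.Corrects F) (hF : F' ⊆ F) :
    C.Corrects F' :=
  fun A hA s => h A (fun i hi => hA i fun h' => hi (hF h')) s

/-- Concatenation: every qudit of the outer code `C` is encoded with the inner code `C'`. -/
def comp (C : QuantumCode X G) (C' : QuantumCode X' G) : QuantumCode (X × X') G where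
  Outcome := C.Outcome × (X → C'.Outcome)
  fintypeOutcome := inferInstance
  enc := (piTensor (fun _ : X => C'.enc) * C.enc).submatrix (Equiv.curry X X' G) (Equiv.refl G)
  enc_isometry := by
    rw [Matrix.conjTranspose_submatrix, Matrix.submatrix_mul_equiv, Matrix.conjTranspose_mul,
      piTensor_conjTranspose, Matrix.mul_assoc, ← Matrix.mul_assoc _ _ C.enc, piTensor_mul]
    simp only [C'.enc_isometry]
    rw [piTensor_one, Matrix.one_mul, C.enc_isometry, Matrix.submatrix_one_equiv]
  recover s := (C.recover s.1 * piTensor (fun i => C'.recover (s.2 i))).submatrix (Equiv.refl G)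
    (Equiv.curry X X' G)
  isKrausFamily_recover :=
    (C.isKrausFamily_recover.prod_mul
      (IsKrausFamily.piTensor fun _ => C'.isKrausFamily_recover)).submatrix _ _

lemma effect_comp (C : QuantumCode X G) (C' : QuantumCode X' G) (A : X × X' → Matrix G G ℂ)
    (s : C.Outcome) (t : X → C'.Outcome) :
    (C.comp C').effect A (s, t)
      = C.effect (fun i => C'.effect (fun j => A (i, j)) (t i)) s := by
  simp only [effect, comp]
  rw [piTensor_eq_submatrix_curry, Matrix.submatrix_mul_equiv, Matrix.submatrix_mul_equiv]
  simp only [← piTensor_mul, Matrix.mul_assoc]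
  rfl

lemma Corrects.comp {C : QuantumCode X G} {C' : QuantumCode X' G} {F : Set (X × X')}
    (h : C.Corrects {i | ¬ C'.Corrects {j | (i, j) ∈ F}}) : (C.comp C').Corrects F := by
  rintro A hA ⟨s, t⟩
  rw [effect_comp]
  refine h _ (fun i hi => ?_) _
  exact not_not.1 hi _ (fun j hj => hA _ hj) _

/-- The code that leaves a single qudit as it is. -/
def trivial (G : Type) [Fintype G] [DecidableEq G] : QuantumCode Unit G where
  Outcome := Unit
  fintypeOutcome := inferInstance
  enc := (1 : Matrix G G ℂ).submatrix (Equiv.funUnique Unit G) (Equiv.refl G)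
  enc_isometry := by
    rw [Matrix.conjTranspose_submatrix, Matrix.submatrix_mul_equiv, Matrix.conjTranspose_one,
      Matrix.one_mul, Matrix.submatrix_one_equiv]
  recover _ := (1 : Matrix G G ℂ).submatrix (Equiv.refl G) (Equiv.funUnique Unit G)
  isKrausFamily_recover :=
    (isKrausFamily_of_isometry (by rw [Matrix.conjTranspose_one, Matrix.one_mul])).submatrix _ _

lemma trivial_corrects {F : Set Unit} (h : () ∉ F) : (trivial G).Corrects F := by
  intro A hA s
  obtain ⟨c, hc⟩ := hA () h
  have piTensor_eq : piTensor A
      = (A ()).submatrix (Equiv.funUnique Unit G) (Equiv.funUnique Unit G) := by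
    ext a b
    simp [piTensor_apply]
  refine ⟨c, ?_⟩
  rw [effect, piTensor_eq, hc]
  simp only [trivial, Matrix.submatrix_mul_equiv, Matrix.one_mul, Matrix.mul_one]
  rfl

end QuantumCode

/-! ### Threefold repetition codes -/

section Syndrome

variable {H : Type*} [AddCommGroup H] [DecidableEq H]

/-- The error on three sites deduced from the two differences `s`, by majority. -/
def majorityError (s : H × H) : Fin 3 → H :=
  if s.1 = s.2 then ![-s.1, 0, 0] else ![0, s.1, s.2]

lemma majorityError_one_sub (s : H × H) : majorityError s 1 - majorityError s 0 = s.1 := by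
  rw [majorityError]
  split_ifs <;> simp

lemma majorityError_two_sub (s : H × H) : majorityError s 2 - majorityError s 0 = s.2 := by
  rw [majorityError]
  split_ifs with h <;> simp [h]

lemma majorityError_eq_zero (s : H × H) {j k : Fin 3} (hjk : j ≠ k)
    (h : majorityError s j = majorityError s k) : majorityError s j = 0 := by
  rw [majorityError] at h ⊢
  split_ifs at h ⊢ <;> fin_cases j <;> fin_cases k <;> simp_all [eq_comm]

/-- Labels of three sites are given by their differences `s` and the common value that is left
after subtraction of `majorityError s`. -/
def majorityEquiv : (H × H) × H ≃ (Fin 3 → H) where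
  toFun t i := t.2 + majorityError t.1 i
  invFun y := ((y 1 - y 0, y 2 - y 0), y 0 - majorityError (y 1 - y 0, y 2 - y 0) 0)
  left_inv := by
    rintro ⟨s, x⟩
    simp only [add_sub_add_left_eq_sub, majorityError_one_sub, majorityError_two_sub,
      add_sub_cancel_right]
  right_inv y := by
    have h₁ := sub_eq_iff_eq_add.1 (majorityError_one_sub (y 1 - y 0, y 2 - y 0))
    have h₂ := sub_eq_iff_eq_add.1 (majorityError_two_sub (y 1 - y 0, y 2 - y 0))
    funext i
    fin_cases i
    · simp
    · simp [h₁]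
    · simp [h₂]

end Syndrome

lemma exists_pair_ne_of_fin_three (i : Fin 3) : ∃ j k : Fin 3, j ≠ i ∧ k ≠ i ∧ j ≠ k := by
  decide +revert

lemma isScalarOp_of_isDiag {G : Type*} [AddGroup G] [DecidableEq G] {M : Matrix G G ℂ}
    (hM : M.IsDiag) (shift : ∀ t x y, M (x + t) (y + t) = M x y) : IsScalarOp M := by
  refine ⟨M 0 0, ?_⟩
  ext x y
  rw [Matrix.smul_apply, Matrix.one_apply]
  split_ifs with hxy
  · rw [← hxy, smul_eq_mul, mul_one, ← shift x 0 0, zero_add]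
  · rw [hM hxy, smul_zero]

namespace QuantumCode

section BitRepetition

variable {G : Type} [Fintype G] [DecidableEq G] [AddCommGroup G]

/-- The threefold repetition code. -/
def bitRepetition (G : Type) [Fintype G] [DecidableEq G] [AddCommGroup G] :
    QuantumCode (Fin 3) G where
  Outcome := G × G
  fintypeOutcome := inferInstance
  enc := Matrix.of fun y x => if y = fun _ => x then 1 else 0
  enc_isometry := by
    ext x x'
    simp only [Matrix.mul_apply, Matrix.conjTranspose_apply, Matrix.of_apply, mul_ite, mul_one,
      mul_zero, Finset.sum_ite_eq', Finset.mem_univ, if_true]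
    simp [Matrix.one_apply, funext_iff, eq_comm]
  recover s := Matrix.of fun x y => if y = majorityEquiv (s, x) then 1 else 0
  isKrausFamily_recover := by
    ext y y'
    simp only [Matrix.sum_apply, Matrix.mul_apply, Matrix.conjTranspose_apply, Matrix.of_apply]
    rw [← Fintype.sum_prod_type' fun s x => star (if y = majorityEquiv (s, x) then (1 : ℂ) else 0) *
        if y' = majorityEquiv (s, x) then (1 : ℂ) else 0,
      majorityEquiv.sum_comp fun w => star (if y = w then (1 : ℂ) else 0) *
        if y' = w then (1 : ℂ) else 0]
    simp [Matrix.one_apply]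

lemma effect_bitRepetition (A : Fin 3 → Matrix G G ℂ) (s : G × G) (x x' : G) :
    (bitRepetition G).effect A s x x' = ∏ i, A i (x + majorityError s i) x' := by
  simp only [effect, bitRepetition, Matrix.mul_apply, Matrix.of_apply, ite_mul, one_mul, zero_mul,
    Finset.sum_ite_eq', Finset.mem_univ, if_true, mul_ite, mul_one, mul_zero]
  rfl

-- Two sites without damage force the label `x'` to agree with `x` up to two of the deduced errors,
-- and these can only agree where the deduced error is zero.
lemma isDiag_effect_bitRepetition (A : Fin 3 → Matrix G G ℂ) (i : Fin 3)
    (hA : ∀ j ≠ i, IsScalarOp (A j)) (s : G × G) :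
    ((bitRepetition G).effect A s).IsDiag := by
  intro x x' hx
  rw [effect_bitRepetition]
  by_contra hprod
  have shift_eq (j : Fin 3) (hj : j ≠ i) : x + majorityError s j = x' := by
    obtain ⟨c, hc⟩ := hA j hj
    by_contra hne
    exact Finset.prod_ne_zero_iff.1 hprod j (Finset.mem_univ j) (by simp [hc, hne])
  obtain ⟨j, k, hj, hk, hjk⟩ := exists_pair_ne_of_fin_three i
  have error_eq_zero : majorityError s j = 0 :=
    majorityError_eq_zero s hjk (add_left_cancel ((shift_eq j hj).trans (shift_eq k hk).symm))
  exact hx (by rw [← shift_eq j hj, error_eq_zero, add_zero])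

lemma isScalarOp_effect_bitRepetition (A : Fin 3 → Matrix G G ℂ) (i : Fin 3)
    (hA : ∀ j ≠ i, IsScalarOp (A j)) (hi : ∀ t x y, A i (x + t) (y + t) = A i x y) (s : G × G) :
    IsScalarOp ((bitRepetition G).effect A s) := by
  refine isScalarOp_of_isDiag (isDiag_effect_bitRepetition A i hA s) fun t x x' => ?_
  simp only [effect_bitRepetition]
  refine Finset.prod_congr rfl fun j _ => ?_
  rw [add_right_comm]
  by_cases hj : j = i
  · rw [hj, hi]
  · obtain ⟨c, hc⟩ := hA j hj
    simp [hc, Matrix.one_apply]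

end BitRepetition

section ChangeBasis

variable {X G H : Type} [Fintype X] [DecidableEq X] [Fintype G] [DecidableEq G] [Fintype H]
  [DecidableEq H]

/-- The code `C` written in another basis by means of the unitary `U`. -/
def changeBasis (C : QuantumCode X H) (U : Matrix G H ℂ) (hU : Uᴴ * U = 1) (hU' : U * Uᴴ = 1) :
    QuantumCode X G where
  Outcome := C.Outcome
  fintypeOutcome := inferInstance
  enc := (piTensor (fun _ : X => U) * C.enc : Matrix (X → G) H ℂ) * Uᴴ
  enc_isometry := by
    simpa only [IsKrausFamily, Fintype.sum_unique] using
      (isKrausFamily_of_isometry (J := Unit) C.enc_isometry).mul_mul (U := piTensor fun _ => U)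
        (by simp only [piTensor_conjTranspose, piTensor_mul, hU, piTensor_one])
        (V := Uᴴ) (by rw [Matrix.conjTranspose_conjTranspose, hU'])
  recover s := U * C.recover s * piTensor fun _ => Uᴴ
  isKrausFamily_recover := C.isKrausFamily_recover.mul_mul hU
    (by simp only [piTensor_conjTranspose, piTensor_mul, Matrix.conjTranspose_conjTranspose, hU',
      piTensor_one])

lemma effect_changeBasis (C : QuantumCode X H) {U : Matrix G H ℂ} (hU : Uᴴ * U = 1)
    (hU' : U * Uᴴ = 1) (A : X → Matrix G G ℂ) (s : C.Outcome) :
    (C.changeBasis U hU hU').effect A s = U * C.effect (fun i => Uᴴ * A i * U) s * Uᴴ := by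
  simp only [effect, changeBasis, ← piTensor_mul, Matrix.mul_assoc]

end ChangeBasis

section PhaseRepetition

variable {G : Type} [Fintype G] [AddCommGroup G]

/-- The unitary Fourier transform of a finite abelian group. -/
noncomputable def fourierMatrix (G : Type) [Fintype G] [AddCommGroup G] :
    Matrix G (AddChar G ℂ) ℂ :=
  Matrix.of fun g χ => (Real.sqrt (Fintype.card G) : ℂ)⁻¹ * χ g

lemma fourierMatrix_mul_conjTranspose [DecidableEq G] :
    fourierMatrix G * (fourierMatrix G)ᴴ = 1 := by
  ext g g'
  have map_sub (χ : AddChar G ℂ) : χ g * star (χ g') = χ (g - g') := by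
    rw [sub_eq_add_neg, AddChar.map_add_eq_mul, AddChar.map_neg_eq_conj, starRingEnd_apply]
  simp only [fourierMatrix, Matrix.mul_apply, Matrix.conjTranspose_apply, Matrix.of_apply,
    star_mul', star_inv_sqrt, mul_mul_mul_comm _ _ _ (star _), map_sub, ← Finset.mul_sum,
    AddChar.sum_apply_eq_ite, sub_eq_zero, Matrix.one_apply, mul_ite, mul_zero,
    inv_sqrt_natCast_mul_self Fintype.card_ne_zero]

lemma conjTranspose_fourierMatrix_mul [DecidableEq (AddChar G ℂ)] :
    (fourierMatrix G)ᴴ * fourierMatrix G = 1 := by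
  classical
  exact (Matrix.mul_eq_one_comm_of_card_eq _ _ _ AddChar.card_eq.symm).1
    fourierMatrix_mul_conjTranspose

lemma conjTranspose_fourierMatrix_mul_mul_apply_add {D : Matrix G G ℂ} (hD : D.IsDiag)
    (t χ χ' : AddChar G ℂ) :
    ((fourierMatrix G)ᴴ * D * fourierMatrix G) (χ + t) (χ' + t)
      = ((fourierMatrix G)ᴴ * D * fourierMatrix G) χ χ' := by
  classical
  have star_mul_self (g : G) : star (t g) * t g = 1 := by
    rw [← starRingEnd_apply, ← AddChar.map_neg_eq_conj, ← AddChar.map_add_eq_mul, neg_add_cancel,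
      AddChar.map_zero_eq_one]
  rw [← hD.diagonal_diag]
  simp only [Matrix.mul_apply (M := _ * _), Matrix.mul_diagonal, fourierMatrix,
    Matrix.conjTranspose_apply, Matrix.of_apply, AddChar.add_apply, star_mul']
  refine Finset.sum_congr rfl fun g _ => ?_
  linear_combination (star (Real.sqrt (Fintype.card G) : ℂ)⁻¹ * star (χ g) * D.diag g *
    ((Real.sqrt (Fintype.card G) : ℂ)⁻¹ * χ' g)) * star_mul_self g

open Classical in
/-- The threefold repetition code in the Fourier transformed basis, for the dual group. -/
noncomputable def phaseRepetition (G : Type) [Fintype G] [DecidableEq G] [AddCommGroup G] :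
    QuantumCode (Fin 3) G :=
  (bitRepetition (AddChar G ℂ)).changeBasis (fourierMatrix G) conjTranspose_fourierMatrix_mul
    fourierMatrix_mul_conjTranspose

lemma isScalarOp_effect_phaseRepetition [DecidableEq G] (A : Fin 3 → Matrix G G ℂ) (i : Fin 3)
    (hi : (A i).IsDiag) (hA : ∀ j ≠ i, IsScalarOp (A j)) (s : (phaseRepetition G).Outcome) :
    IsScalarOp ((phaseRepetition G).effect A s) := by
  classical
  have scalar (j : Fin 3) (hj : j ≠ i) :
      IsScalarOp ((fourierMatrix G)ᴴ * A j * fourierMatrix G) := by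
    obtain ⟨c, hc⟩ := hA j hj
    exact ⟨c, by rw [hc, Matrix.mul_smul, Matrix.mul_one, Matrix.smul_mul,
      conjTranspose_fourierMatrix_mul]⟩
  obtain ⟨c, hc⟩ := isScalarOp_effect_bitRepetition _ i scalar
    (conjTranspose_fourierMatrix_mul_mul_apply_add hi) s
  refine ⟨c, (effect_changeBasis (bitRepetition (AddChar G ℂ)) _ _ A s).trans ?_⟩
  rw [hc, Matrix.mul_smul, Matrix.mul_one, Matrix.smul_mul, fourierMatrix_mul_conjTranspose]

end PhaseRepetition

section Shor

variable {G : Type} [Fintype G] [DecidableEq G] [AddCommGroup G]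

/-- Shor's code with nine qudits, which corrects an arbitrary error on a single qudit. -/
noncomputable def shor (G : Type) [Fintype G] [DecidableEq G] [AddCommGroup G] :
    QuantumCode (Fin 3 × Fin 3) G :=
  (phaseRepetition G).comp (bitRepetition G)

lemma shor_corrects {F : Set (Fin 3 × Fin 3)} (hF : F.Subsingleton) : (shor G).Corrects F := by
  rintro A hA ⟨s, t⟩
  obtain ⟨i, hi⟩ : ∃ i, F ⊆ {i} := by
    rcases hF.eq_empty_or_singleton with h | ⟨i, h⟩
    · exact ⟨0, by simp [h]⟩
    · exact ⟨i, h.le⟩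
  change IsScalarOp (((phaseRepetition G).comp (bitRepetition G)).effect A (s, t))
  rw [effect_comp]
  refine isScalarOp_effect_phaseRepetition _ i.1 ?_ (fun k hk => ?_) s
  · refine isDiag_effect_bitRepetition _ i.2 (fun j hj => hA _ fun h => ?_) _
    exact hj (congrArg Prod.snd (hi h))
  · have undamaged (j : Fin 3) : IsScalarOp (A (k, j)) :=
      hA _ fun h => hk (congrArg Prod.fst (hi h))
    refine isScalarOp_effect_bitRepetition _ 0 (fun j _ => undamaged j) (fun u x y => ?_) _
    obtain ⟨c, hc⟩ := undamaged 0
    simp [hc, Matrix.one_apply]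

end Shor

end QuantumCode

/-! ### Concatenated codes -/

section PairedSets

variable {X Y : Type*} [DecidableEq X] [DecidableEq Y] [Fintype Y]

/-- The unions of two members of `W`, placed in different blocks `Y`. They are the error sets that
a code of `Y` blocks may miss if it corrects the failure of a single block and `W` lists the error
sets that make a block fail. -/
def pairedSets (Y : Type*) [Fintype Y] [DecidableEq Y] (W : Finset (Finset X)) :
    Finset (Finset (Y × X)) :=
  ((Finset.univ : Finset Y).offDiag ×ˢ (W ×ˢ W)).image fun a =>
    ({a.1.1} ×ˢ a.2.1) ∪ ({a.1.2} ×ˢ a.2.2)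

lemma mem_pairedSets {W : Finset (Finset X)} {T : Finset (Y × X)} :
    T ∈ pairedSets Y W ↔ ∃ i j : Y, i ≠ j ∧ ∃ T₁ ∈ W, ∃ T₂ ∈ W, {i} ×ˢ T₁ ∪ {j} ×ˢ T₂ = T := by
  simp only [pairedSets, Finset.mem_image, Finset.mem_product, Finset.mem_offDiag, Finset.mem_univ,
    true_and, Prod.exists]
  grind

lemma card_pairedSets_le (W : Finset (Finset X)) :
    (pairedSets Y W).card ≤ Fintype.card Y ^ 2 * W.card ^ 2 := by
  refine Finset.card_image_le.trans ?_
  rw [Finset.card_product, Finset.card_product, Finset.offDiag_card, Finset.card_univ, ← sq, ← sq]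
  exact Nat.mul_le_mul_right _ (Nat.sub_le _ _)

lemma card_eq_of_mem_pairedSets {W : Finset (Finset X)} {k : ℕ} (hW : ∀ T ∈ W, T.card = k)
    {T : Finset (Y × X)} (hT : T ∈ pairedSets Y W) : T.card = 2 * k := by
  obtain ⟨i, j, hij, T₁, h₁, T₂, h₂, rfl⟩ := mem_pairedSets.1 hT
  have disjoint : Disjoint ({i} ×ˢ T₁) ({j} ×ˢ T₂) :=
    Finset.disjoint_product.2 (Or.inl (Finset.disjoint_singleton.2 hij))
  rw [Finset.card_union_of_disjoint disjoint, Finset.singleton_product, Finset.singleton_product,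
    Finset.card_map, Finset.card_map, hW _ h₁, hW _ h₂, two_mul]

end PairedSets

namespace QuantumCode

variable {X Y G : Type} [Fintype X] [DecidableEq X] [Fintype Y] [DecidableEq Y] [Fintype G]
  [DecidableEq G]

lemma Corrects.comp_of_pairedSets {C : QuantumCode Y G} {C' : QuantumCode X G}
    {W : Finset (Finset X)} (hC : ∀ F : Set Y, F.Subsingleton → C.Corrects F)
    (hC' : ∀ F : Set X, (∀ T ∈ W, ¬ (T : Set X) ⊆ F) → C'.Corrects F) (F : Set (Y × X))
    (hF : ∀ T ∈ pairedSets Y W, ¬ (T : Set (Y × X)) ⊆ F) : (C.comp C').Corrects F := by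
  refine Corrects.comp (hC _ fun i hi j hj => ?_)
  have exists_subset {k : Y} (hk : ¬ C'.Corrects {x | (k, x) ∈ F}) :
      ∃ T ∈ W, (T : Set X) ⊆ {x | (k, x) ∈ F} := by
    by_contra! h
    exact hk (hC' _ h)
  by_contra hij
  obtain ⟨T₁, h₁, hT₁⟩ := exists_subset hi
  obtain ⟨T₂, h₂, hT₂⟩ := exists_subset hj
  refine hF _ (mem_pairedSets.2 ⟨i, j, hij, T₁, h₁, T₂, h₂, rfl⟩) ?_
  rintro ⟨k, x⟩ hx
  rcases Finset.mem_union.1 hx with hx | hx <;>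
    obtain ⟨hk, hx'⟩ := Finset.mem_product.1 hx <;>
    obtain rfl := Finset.mem_singleton.1 hk
  exacts [hT₁ hx', hT₂ hx']

lemma exists_concatenated (G : Type) [Fintype G] [DecidableEq G] [AddCommGroup G] (r : ℕ) :
    ∃ (X : Type) (_ : Fintype X) (_ : DecidableEq X) (C : QuantumCode X G)
      (W : Finset (Finset X)), 81 * W.card ≤ 81 ^ 2 ^ r ∧ (∀ T ∈ W, T.card = 2 ^ r) ∧
      ∀ F : Set X, (∀ T ∈ W, ¬ (T : Set X) ⊆ F) → C.Corrects F := by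
  induction r with
  | zero =>
    refine ⟨Unit, inferInstance, inferInstance, trivial G, {{()}}, by simp, by simp, ?_⟩
    intro F hF
    exact trivial_corrects fun h => hF {()} (by simp) (by simpa using h)
  | succ r ih =>
    obtain ⟨X, _, _, C, W, card_W, card_of_mem, corrects⟩ := ih
    refine ⟨(Fin 3 × Fin 3) × X, inferInstance, inferInstance, (shor G).comp C,
      pairedSets _ W, ?_, fun T hT => ?_, Corrects.comp_of_pairedSets (fun _ => shor_corrects)
        corrects⟩
    · calc 81 * (pairedSets (Fin 3 × Fin 3) W).card
          ≤ 81 * (81 * W.card ^ 2) := Nat.mul_le_mul_left _ (card_pairedSets_le W)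
        _ = (81 * W.card) ^ 2 := by ring
        _ ≤ (81 ^ 2 ^ r) ^ 2 := Nat.pow_le_pow_left card_W 2
        _ = 81 ^ 2 ^ (r + 1) := by rw [← pow_mul, pow_succ]
    · rw [card_eq_of_mem_pairedSets card_of_mem hT, pow_succ']

end QuantumCode

/-! ### Sending an encoded state through the network -/

lemma IsKrausFamily.nonempty {J m n : Type*} [Fintype J] [Fintype m] [DecidableEq n] [Nonempty n]
    {K : J → Matrix m n ℂ} (hK : IsKrausFamily K) : Nonempty J := by
  by_contra hJ
  rw [not_nonempty_iff] at hJ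
  rw [IsKrausFamily, Fintype.sum_empty] at hK
  obtain ⟨b⟩ := ‹Nonempty n›
  simpa using congrFun (congrFun hK b) b

section Prepare

/-- The operator which adjoins a system in the state `χ`. -/
def prepareOp {m n : Type*} [DecidableEq n] (χ : m → ℂ) : Matrix (m × n) n ℂ :=
  Matrix.of fun a b => χ a.1 * if a.2 = b then 1 else 0

lemma conjTranspose_prepareOp_mul_self {m n : Type*} [Fintype m] [Fintype n] [DecidableEq n]
    {χ : m → ℂ} (hχ : ∑ x, star (χ x) * χ x = 1) :
    (prepareOp (n := n) χ)ᴴ * prepareOp (n := n) χ = 1 := by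
  ext b b'
  have term (x : m) (c : n) : star (χ x * if c = b then 1 else 0) * (χ x * if c = b' then 1 else 0)
      = if c = b then star (χ x) * χ x * (1 : Matrix n n ℂ) b b' else 0 := by
    by_cases hc : c = b
    · subst hc
      simp [Matrix.one_apply]
    · simp [hc]
  simp only [prepareOp, Matrix.mul_apply, Matrix.conjTranspose_apply, Matrix.of_apply, term,
    Fintype.sum_prod_type, Finset.sum_ite_eq', Finset.mem_univ, if_true, ← Finset.sum_mul, hχ,
    one_mul]

variable {P Z H : Type u} [DecidableEq P] {G : Type}

/-- The labels of the qudits of one party, split into two kinds. -/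
def ownedSumEquiv (G : Type) (own : Z ⊕ H → P) (v : P) :
    ({q // own q = v} → G) ≃ ({z // own (Sum.inl z) = v} → G) × ({q // own (Sum.inr q) = v} → G) :=
  (Equiv.arrowCongr Equiv.subtypeSum (Equiv.refl G)).trans (Equiv.sumArrowEquivProdArrow _ _ _)

/-- The state of the qudits `Z` of party `v` if all qudits `Z` are held by `v₀` and are in the
state `Ψ`. -/
def preparedVec {own : Z → P} {v₀ : P} (hown : ∀ z, own z = v₀) (Ψ : (Z → G) → ℂ) (v : P)
    (f : {z // own z = v} → G) : ℂ :=
  if hv : v₀ = v then Ψ fun z => f ⟨z, (hown z).trans hv⟩ else 1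

lemma sum_star_mul_preparedVec [Fintype Z] [DecidableEq Z] [Fintype G] {own : Z → P} {v₀ : P}
    (hown : ∀ z, own z = v₀) {Ψ : (Z → G) → ℂ} (hΨ : ∑ z, star (Ψ z) * Ψ z = 1) (v : P) :
    ∑ f, star (preparedVec hown Ψ v f) * preparedVec hown Ψ v f = 1 := by
  by_cases hv : v₀ = v
  · let e : (Z → G) ≃ ({z // own z = v} → G) :=
      Equiv.arrowCongr (Equiv.subtypeUnivEquiv fun z => (hown z).trans hv).symm (Equiv.refl G)
    rw [← e.sum_comp, ← hΨ]
    simp only [preparedVec, dif_pos hv]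
    rfl
  · have : IsEmpty {z // own z = v} := ⟨fun z => hv ((hown z).symm.trans z.2)⟩
    simp [preparedVec, hv]

variable [Fintype H] [DecidableEq G] {own : Z ⊕ H → P} {v₀ : P}

/-- The local operators by which `v₀` adjoins new qudits `Z` in the state `Ψ`. -/
def prepareOps (hown : ∀ z, own (Sum.inl z) = v₀) (Ψ : (Z → G) → ℂ) (v : P) :
    Matrix ({q // own q = v} → G) ({q // own (Sum.inr q) = v} → G) ℂ :=
  (prepareOp (preparedVec hown Ψ v)).submatrix (ownedSumEquiv G own v) id

lemma tensorOp_prepareOps_mulVec [Fintype P] [DecidableEq H] [Fintype G]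
    (hown : ∀ z, own (Sum.inl z) = v₀) (Ψ : (Z → G) → ℂ)
    (Φ : (∀ v, {q // own (Sum.inr q) = v} → G) → ℂ) :
    (tensorOp (prepareOps hown Ψ) *ᵥ Φ) ∘ (ownedEquiv G own).symm = fun y =>
      Ψ (y ∘ Sum.inl) * (Φ ∘ (ownedEquiv G (own ∘ Sum.inr)).symm) (y ∘ Sum.inr) := by
  funext y
  have entry (x : H → G) : tensorOp (prepareOps hown Ψ) ((ownedEquiv G own).symm y)
      ((ownedEquiv G (own ∘ Sum.inr)).symm x)
      = Ψ (y ∘ Sum.inl) * if y ∘ Sum.inr = x then 1 else 0 := by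
    have snd_eq_iff : (∀ v, (ownedSumEquiv G own v ((ownedEquiv G own).symm y v)).2
        = (ownedEquiv G (own ∘ Sum.inr)).symm x v) ↔ y ∘ Sum.inr = x := by
      rw [← (ownedEquiv G (own ∘ Sum.inr)).symm.injective.eq_iff, funext_iff]
      rfl
    have preparedVec_prod : ∏ v, preparedVec hown Ψ v
        (ownedSumEquiv G own v ((ownedEquiv G own).symm y v)).1 = Ψ (y ∘ Sum.inl) := by
      rw [Finset.prod_eq_single v₀ (fun v _ hv => dif_neg hv.symm) (by simp), preparedVec,
        dif_pos rfl]
      rfl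
    rw [tensorOp_eq_piTensor, piTensor_apply]
    simp only [prepareOps, prepareOp, Matrix.submatrix_apply, Matrix.of_apply, id,
      Finset.prod_mul_distrib, Finset.prod_ite_zero, Finset.mem_univ, true_implies,
      Finset.prod_const_one, preparedVec_prod]
    congr 1
    exact if_congr snd_eq_iff rfl rfl
  refine ((ownedEquiv G (own ∘ Sum.inr)).symm.sum_comp fun x =>
    tensorOp (prepareOps hown Ψ) ((ownedEquiv G own).symm y) x * Φ x).symm.trans ?_
  simp only [entry, Function.comp_apply, mul_assoc, ite_mul, one_mul, zero_mul, mul_ite, mul_zero,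
    Finset.sum_ite_eq, Finset.mem_univ, if_true]

variable [Fintype P] [DecidableEq H] [Fintype Z] [DecidableEq Z] [Fintype G] {O : P → Type u}
  [∀ v, Fintype (O v)] [∀ v, DecidableEq (O v)] {ψ : (∀ v, O v) → ℂ}

lemma OwnedDistills.prepare (hown : ∀ z, own (Sum.inl z) = v₀) {Ψ : (Z → G) → ℂ}
    (hΨ : ∑ z, star (Ψ z) * Ψ z = 1) {S : Set ((H → G) → ℂ)} {S' : Set ((Z ⊕ H → G) → ℂ)}
    (h : OwnedDistills ψ own S')
    (hS : ∀ Φ ∈ S, (fun y => Ψ (y ∘ Sum.inl) * Φ (y ∘ Sum.inr)) ∈ S') :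
    OwnedDistills ψ (own ∘ Sum.inr) S := by
  have isometry (v : P) : (prepareOps hown Ψ v)ᴴ * prepareOps hown Ψ v = 1 := by
    rw [prepareOps, Matrix.conjTranspose_submatrix, Matrix.submatrix_mul_equiv,
      conjTranspose_prepareOp_mul_self (sum_star_mul_preparedVec hown hΨ v),
      Matrix.submatrix_id_id]
  refine Distills.round v₀ (J := Unit) (fun _ => prepareOps hown Ψ)
    (isKrausFamily_of_isometry (isometry v₀)) (fun _ v _ => isometry v) fun _ =>
    Distills.mono h ?_
  rintro _ ⟨Φ, hΦ, rfl⟩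
  have image_mem := hS _ hΦ
  rwa [← tensorOp_prepareOps_mulVec hown Ψ Φ] at image_mem

end Prepare

section Discard

/-- The Kraus operator for the outcome `d` of the computational basis measurement of a system which
is then discarded, while `K` is applied to the rest. -/
def discardOp {m n D : Type*} [DecidableEq D] (K : Matrix m n ℂ) (d : D) : Matrix m (n × D) ℂ :=
  Matrix.of fun x y => K x y.1 * if y.2 = d then 1 else 0

lemma IsKrausFamily.discardOp {J m n D : Type*} [Fintype J] [Fintype m] [DecidableEq n] [Fintype D]
    [DecidableEq D] {K : J → Matrix m n ℂ} (hK : IsKrausFamily K) :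
    IsKrausFamily fun s : J × D => discardOp (K s.1) s.2 := by
  ext y y'
  have gram (j : J) (d : D) : ((_root_.discardOp (K j) d)ᴴ * _root_.discardOp (K j) d) y y'
      = if y.2 = d then ((K j)ᴴ * K j) y.1 y'.1 * if y'.2 = d then 1 else 0 else 0 := by
    simp only [_root_.discardOp, Matrix.mul_apply, Matrix.conjTranspose_apply, Matrix.of_apply]
    split_ifs <;> simp
  have complete : ∑ j, ((K j)ᴴ * K j) y.1 y'.1 = (1 : Matrix n n ℂ) y.1 y'.1 := by
    rw [← hK, Matrix.sum_apply]
  simp only [Fintype.sum_prod_type, Matrix.sum_apply, gram, Finset.sum_ite_eq, Finset.mem_univ,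
    if_true]
  refine (Finset.sum_mul Finset.univ (fun j => ((K j)ᴴ * K j) y.1 y'.1)
    (if y'.2 = y.2 then 1 else 0)).symm.trans ?_
  rw [complete]
  simp [Matrix.one_apply, Prod.ext_iff, ← ite_and, and_comm, eq_comm]

end Discard

section EncodeAll

variable {T : Type*} [Fintype T] [DecidableEq T] {G X : Type} [Fintype G] [DecidableEq G]
  [Fintype X] [DecidableEq X]

/-- The state `ψ`, with every qudit encoded in `C`. -/
def QuantumCode.encodeAll (C : QuantumCode X G) (ψ : (T → G) → ℂ) : (T × X → G) → ℂ :=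
  (piTensor (fun _ : T => C.enc) *ᵥ ψ) ∘ Equiv.curry T X G

lemma QuantumCode.sum_star_mul_encodeAll (C : QuantumCode X G) (ψ : (T → G) → ℂ) :
    ∑ y, star (C.encodeAll ψ y) * C.encodeAll ψ y = ∑ x, star (ψ x) * ψ x := by
  let U : Matrix (T → X → G) (T → G) ℂ := piTensor fun _ : T => C.enc
  have hU : Uᴴ * U = 1 := by
    simp only [U, piTensor_conjTranspose, piTensor_mul, C.enc_isometry, piTensor_one]
  calc ∑ y, star (C.encodeAll ψ y) * C.encodeAll ψ y
      = star (U *ᵥ ψ) ⬝ᵥ (U *ᵥ ψ) :=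
        (Equiv.curry T X G).sum_comp fun y => star ((U *ᵥ ψ) y) * (U *ᵥ ψ) y
    _ = star ψ ⬝ᵥ ψ := by
        rw [Matrix.star_mulVec, Matrix.dotProduct_mulVec, Matrix.vecMul_vecMul, hU,
          Matrix.vecMul_one]

lemma QuantumCode.piTensor_mulVec_encodeAll (C : QuantumCode X G) (ψ : (T → G) → ℂ)
    (B : T × X → Matrix G G ℂ) :
    piTensor B *ᵥ C.encodeAll ψ
      = ((piTensor fun t => (piTensor fun i => B (t, i)) * C.enc) *ᵥ ψ) ∘ Equiv.curry T X G := by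
  rw [piTensor_eq_submatrix_curry, QuantumCode.encodeAll, Matrix.submatrix_mulVec_equiv,
    Function.comp_assoc, Equiv.self_comp_symm, Function.comp_id, Matrix.mulVec_mulVec, piTensor_mul]

lemma QuantumCode.recover_mulVec_encodeAll (C : QuantumCode X G) (ψ : (T → G) → ℂ)
    {B : T × X → Matrix G G ℂ} {s : T → C.Outcome} {c : T → ℂ}
    (hc : ∀ t, C.effect (fun i => B (t, i)) (s t) = c t • 1) :
    (piTensor fun t => C.recover (s t)).submatrix id (Equiv.curry T X G)
      *ᵥ (piTensor B *ᵥ C.encodeAll ψ) = (∏ t, c t) • ψ := by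
  have effect_eq : (fun t => C.recover (s t) * ((piTensor fun i => B (t, i)) * C.enc))
      = fun t => c t • (1 : Matrix G G ℂ) :=
    funext fun t => (Matrix.mul_assoc _ _ _).symm.trans (hc t)
  rw [C.piTensor_mulVec_encodeAll, Matrix.submatrix_mulVec_equiv, Function.comp_assoc,
    Equiv.self_comp_symm, Function.comp_id, Function.comp_id, Matrix.mulVec_mulVec, piTensor_mul,
    effect_eq, piTensor_smul, piTensor_one, Matrix.smul_mulVec, Matrix.one_mulVec]

end EncodeAll

section Decode

variable {P : Type u} [DecidableEq P] {T H : Type u} [Fintype T] [Fintype H]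
  {G X : Type} [Fintype G] [DecidableEq G] [Fintype X] [DecidableEq X]
  {own : (T × X) ⊕ H → P} {tgt : T → P}

/-- The labels of the qudits of one party which holds the blocks `X` of its targets. -/
def ownedDataEquiv (G : Type) (hown : ∀ z, own (Sum.inl z) = tgt z.1) (v : P) :
    ({q // own q = v} → G) ≃ ({w // tgt w = v} → X → G) × ({q // own (Sum.inr q) = v} → G) :=
  (ownedSumEquiv G own v).trans (Equiv.prodCongr
    { toFun := fun y w i => y ⟨(w.1, i), (hown _).trans w.2⟩
      invFun := fun y z => y ⟨z.1.1, (hown _).symm.trans z.2⟩ z.1.2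
      left_inv := fun _ => rfl
      right_inv := fun _ => rfl }
    (Equiv.refl _))

/-- The outcomes at party `v` when all blocks are recovered and all other qudits are discarded. -/
abbrev DecodeOutcome (C : QuantumCode X G) (own : (T × X) ⊕ H → P) (tgt : T → P) (v : P) :
    Type u :=
  ({w // tgt w = v} → C.Outcome) × ({q // own (Sum.inr q) = v} → G)

/-- The Kraus operators for recovering all blocks at party `v` and discarding all other qudits. -/
def decodeOp (C : QuantumCode X G) (hown : ∀ z, own (Sum.inl z) = tgt z.1) (v : P)
    (j : DecodeOutcome C own tgt v) :
    Matrix ({w // tgt w = v} → G) ({q // own q = v} → G) ℂ :=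
  (discardOp (piTensor fun w => C.recover (j.1 w)) j.2).submatrix (Equiv.refl _)
    (ownedDataEquiv G hown v)

variable [DecidableEq T] [DecidableEq H]

lemma isKrausFamily_decodeOp (C : QuantumCode X G) (hown : ∀ z, own (Sum.inl z) = tgt z.1)
    (v : P) : IsKrausFamily (decodeOp C hown v) :=
  (IsKrausFamily.piTensor fun _ : {w // tgt w = v} => C.isKrausFamily_recover).discardOp.submatrix
    _ _

variable [Fintype P]

omit [DecidableEq T] [DecidableEq H] in
lemma tensorOp_decodeOp_apply (C : QuantumCode X G) (hown : ∀ z, own (Sum.inl z) = tgt z.1)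
    (j : ∀ v, DecodeOutcome C own tgt v) (x : ∀ v, {w // tgt w = v} → G)
    (y : (T × X) ⊕ H → G) :
    tensorOp (fun v => decodeOp C hown v (j v)) x ((ownedEquiv G own).symm y)
      = (piTensor fun t => C.recover (ownedEquiv C.Outcome tgt (fun v => (j v).1) t))
          (ownedEquiv G tgt x) (Equiv.curry T X G (y ∘ Sum.inl))
        * if y ∘ Sum.inr = ownedEquiv G (own ∘ Sum.inr) (fun v => (j v).2) then 1 else 0 := by
  have snd_eq_iff : (∀ v, (ownedDataEquiv G hown v ((ownedEquiv G own).symm y v)).2 = (j v).2)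
      ↔ y ∘ Sum.inr = ownedEquiv G (own ∘ Sum.inr) (fun v => (j v).2) := by
    rw [← (ownedEquiv G (own ∘ Sum.inr)).symm_apply_eq, funext_iff]
    rfl
  have recover_prod : ∏ v, piTensor (fun w => C.recover ((j v).1 w)) (x v)
      (ownedDataEquiv G hown v ((ownedEquiv G own).symm y v)).1
      = (piTensor fun t => C.recover (ownedEquiv C.Outcome tgt (fun v => (j v).1) t))
          (ownedEquiv G tgt x) (Equiv.curry T X G (y ∘ Sum.inl)) := by
    simp only [piTensor_apply]
    rw [← (Equiv.sigmaFiberEquiv tgt).prod_comp, Fintype.prod_sigma]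
    refine Finset.prod_congr rfl fun v _ => Finset.prod_congr rfl fun w _ => ?_
    obtain ⟨w, rfl⟩ := w
    rfl
  rw [tensorOp_eq_piTensor, piTensor_apply]
  simp only [decodeOp, discardOp, Matrix.submatrix_apply, Matrix.of_apply, Equiv.refl_apply,
    Finset.prod_mul_distrib, Finset.prod_ite_zero, Finset.mem_univ, true_implies,
    Finset.prod_const_one, recover_prod]
  congr 1
  exact if_congr snd_eq_iff rfl rfl

lemma tensorOp_decodeOp_mulVec (C : QuantumCode X G) (hown : ∀ z, own (Sum.inl z) = tgt z.1)
    (j : ∀ v, DecodeOutcome C own tgt v) (Φ : (∀ v, {q // own q = v} → G) → ℂ) :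
    tensorOp (fun v => decodeOp C hown v (j v)) *ᵥ Φ
      = ((piTensor fun t => C.recover (ownedEquiv C.Outcome tgt (fun v => (j v).1) t)).submatrix id
          (Equiv.curry T X G) *ᵥ fun y => (Φ ∘ (ownedEquiv G own).symm)
            (Sum.elim y (ownedEquiv G (own ∘ Sum.inr) fun v => (j v).2))) ∘ ownedEquiv G tgt := by
  funext x
  refine (((Equiv.sumArrowEquivProdArrow (T × X) H G).symm.trans
    (ownedEquiv G own).symm).sum_comp fun y =>
      tensorOp (fun v => decodeOp C hown v (j v)) x y * Φ y).symm.trans ?_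
  simp only [Equiv.trans_apply, tensorOp_decodeOp_apply, Fintype.sum_prod_type]
  refine Finset.sum_congr rfl fun y _ => ?_
  refine (Finset.sum_eq_single (ownedEquiv G (own ∘ Sum.inr) fun v => (j v).2)
    (fun d _ hd => mul_eq_zero_of_left (mul_eq_zero_of_right _ (if_neg hd)) _) (by simp)).trans ?_
  congr 1
  exact (congrArg (_ * ·) (if_pos rfl)).trans (mul_one _)

end Decode

section Protocol

variable {P : Type u} [Fintype P] [DecidableEq P] {G : Type} [Fintype G] [DecidableEq G]
  {T E : Type u} [Fintype T] [DecidableEq T] [Fintype E] [DecidableEq E] {X : Type} [Fintype X]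
  [DecidableEq X]

/-- The target state, as a state of all parties. -/
def partyState (tgt : T → P) (ψ : (T → G) → ℂ) : (∀ v, {w // tgt w = v} → G) → ℂ :=
  ψ ∘ ownedEquiv G tgt

lemma OwnedDistills.decode [Nonempty G] {own : (T × X) ⊕ (E × Bool) → P} {tgt : T → P}
    (hown : ∀ z, own (Sum.inl z) = tgt z.1) (C : QuantumCode X G) (ψ : (T → G) → ℂ) :
    OwnedDistills (partyState tgt ψ) own
      (routeStates (C.encodeAll ψ) {F | ∀ t, C.Corrects {i | (t, i) ∈ F}} fun _ => []) := by
  have : Nonempty C.Outcome := C.isKrausFamily_recover.nonempty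
  refine Distills.measure_all (decodeOp C hown) (isKrausFamily_decodeOp C hown) ?_
  rintro Φ ⟨B, M, hF, hΦ⟩ j
  let s : T → C.Outcome := ownedEquiv C.Outcome tgt fun v => (j v).1
  let h : E × Bool → G := ownedEquiv G (own ∘ Sum.inr) fun v => (j v).2
  have effect_isScalarOp (t : T) : IsScalarOp (C.effect (fun i => B (t, i)) (s t)) :=
    hF t _ (fun i hi => by simpa using hi) _
  choose c hc using effect_isScalarOp
  have data_eq : (fun y => (Φ ∘ (ownedEquiv G own).symm) (Sum.elim y h))
      = (∏ e, M e (h (e, false)) (h (e, true))) • (piTensor B *ᵥ C.encodeAll ψ) := by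
    rw [hΦ]
    funext y
    exact mul_comm _ _
  refine ⟨(∏ e, M e (h (e, false)) (h (e, true))) * ∏ t, c t, ?_⟩
  rw [tensorOp_decodeOp_mulVec, data_eq, Matrix.mulVec_smul, C.recover_mulVec_encodeAll ψ hc,
    smul_smul]
  rfl

omit [Fintype T] [DecidableEq T] in
lemma isLowerSet_forall_corrects (C : QuantumCode X G) :
    IsLowerSet {F : Set (T × X) | ∀ t, C.Corrects {i | (t, i) ∈ F}} :=
  fun _ _ hF h t => (h t).mono fun _ hi => hF hi

lemma OwnedDistills.network [AddCommGroup G] (v₀ : P) {own : E × Bool → P} {tgt : T → P}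
    (C : QuantumCode X G) {ψ : (T → G) → ℂ} (hψ : ∑ x, star (ψ x) * ψ x = 1)
    {r : T × X → List (E × Bool)}
    (hr : IsDisjointRouting (Sum.elim (fun _ => v₀) own) (fun z => tgt z.1) r) :
    OwnedDistills (partyState tgt ψ) own
      {Φ | ∃ M : E → Matrix G G ℂ,
        (∀ t, C.Corrects {i | ¬ ∀ e ∈ (r (t, i)).map Prod.fst, IsScalarOp (M e)}) ∧
        Φ = fun y => ∏ e, M e (y (e, false)) (y (e, true))} := by
  refine OwnedDistills.prepare (own := Sum.elim (fun _ => v₀) own) (fun _ => rfl)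
    (by rw [C.sum_star_mul_encodeAll, hψ])
    (OwnedDistills.transport (C.encodeAll ψ) (fun z => tgt z.1) (isLowerSet_forall_corrects C)
      (fun _ hown => OwnedDistills.decode hown C ψ) _ _ r rfl hr) ?_
  rintro _ ⟨M, hM, rfl⟩
  refine ⟨fun _ => 1, M, fun t => (hM t).mono fun i hi h => hi ⟨⟨1, (one_smul ℂ 1).symm⟩, h⟩, ?_⟩
  funext y
  rw [dataPairState, piTensor_one, Matrix.one_mulVec]
  rfl

end Protocol

lemma exists_isLOCC {P : Type u} [Fintype P] [DecidableEq P] {O : P → Type u}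
    [∀ v, Fintype (O v)] [∀ v, DecidableEq (O v)] [∀ v, Nonempty (O v)] (I : P → Type u)
    [∀ v, Fintype (I v)] [∀ v, DecidableEq (I v)] [∀ v, Nonempty (I v)] :
    ∃ Λ : Matrix (∀ v, I v) (∀ v, I v) ℂ → Matrix (∀ v, O v) (∀ v, O v) ℂ, IsLOCC I Λ := by
  have isKrausFamily_single (v : P) : IsKrausFamily fun j : I v =>
      (Matrix.single (Classical.arbitrary (O v)) j 1 : Matrix (O v) (I v) ℂ) := by
    simp only [IsKrausFamily, Matrix.conjTranspose_single, star_one,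
      Matrix.single_mul_single_same, mul_one]
    exact Matrix.sum_single_one
  obtain ⟨Λ, hΛ, -⟩ := Distills.measure_all (ψ := 0) (S := ∅) _ isKrausFamily_single (by simp)
  exact ⟨Λ, hΛ⟩

/-! ### Edge-disjoint short paths -/

section Graph

variable {V : Type u} {G : SimpleGraph V}

lemma connected_deleteEdges_of_card_lt {F : Finset (Sym2 V)}
    (hF : (F : Set (Sym2 V)) ⊆ G.edgeSet) (h : F.card < edgeConnectivity G) :
    (G.deleteEdges (F : Set (Sym2 V))).Connected := by
  by_contra hc
  exact h.not_ge (Nat.sInf_le ⟨F, hF, rfl, hc⟩)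

lemma exists_dist_eq_of_le_dist (hG : G.Connected) {u v : V} {k : ℕ} (hk : k ≤ G.dist u v) :
    ∃ x, G.dist u x = k := by
  obtain ⟨p, hp⟩ := hG.exists_walk_length_eq_dist u v
  have dist_le : G.dist u (p.getVert k) ≤ k :=
    (SimpleGraph.dist_le (p.take k)).trans (by
      rw [SimpleGraph.Walk.take_length]
      exact min_le_left _ _)
  have dist_le' : G.dist (p.getVert k) v ≤ p.length - k :=
    (SimpleGraph.dist_le (p.drop k)).trans_eq (SimpleGraph.Walk.drop_length _ _)
  have triangle := hG.dist_triangle (u := u) (v := p.getVert k) (w := v)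
  exact ⟨p.getVert k, by omega⟩

lemma disjoint_neighborFinset_of_add_three_le_dist [Fintype V] [DecidableRel G.Adj]
    (hG : G.Connected) {u x y : V} (h : G.dist u x + 3 ≤ G.dist u y) :
    Disjoint (G.neighborFinset x) (G.neighborFinset y) := by
  rw [Finset.disjoint_left]
  intro z hx hy
  rw [SimpleGraph.mem_neighborFinset] at hx hy
  have h₁ := hG.dist_triangle (u := u) (v := x) (w := y)
  have h₂ := hG.dist_triangle (u := x) (v := z) (w := y)
  rw [SimpleGraph.dist_eq_one_iff_adj.2 hx, SimpleGraph.dist_eq_one_iff_adj.2 hy.symm] at h₂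
  omega

lemma dist_div_three_add_one_mul_le_card [Fintype V] [DecidableRel G.Adj] (hG : G.Connected)
    {D : ℕ} (hD : ∀ v, D ≤ G.degree v) (u v : V) :
    (G.dist u v / 3 + 1) * D ≤ Fintype.card V := by
  classical
  have exists_dist : ∀ i : Fin (G.dist u v / 3 + 1), ∃ x, G.dist u x = 3 * i := fun i =>
    exists_dist_eq_of_le_dist hG (v := v) (by omega)
  choose x hx using exists_dist
  have disjoint_of_lt {i j : Fin (G.dist u v / 3 + 1)} (hij : i < j) :
      Disjoint (G.neighborFinset (x i)) (G.neighborFinset (x j)) :=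
    disjoint_neighborFinset_of_add_three_le_dist hG (u := u) (by
      rw [hx, hx]
      have : (i : ℕ) < j := hij
      omega)
  have disjoint : Pairwise fun i j =>
      Disjoint (G.neighborFinset (x i)) (G.neighborFinset (x j)) := fun i j hij =>
    hij.lt_or_gt.elim disjoint_of_lt fun h => (disjoint_of_lt h).symm
  calc (G.dist u v / 3 + 1) * D
      = ∑ _i : Fin (G.dist u v / 3 + 1), D := by simp
    _ ≤ ∑ i, (G.neighborFinset (x i)).card := Finset.sum_le_sum fun i _ => hD (x i)
    _ = (Finset.univ.biUnion fun i => G.neighborFinset (x i)).card :=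
        (Finset.card_biUnion fun i _ j _ => @disjoint i j).symm
    _ ≤ Fintype.card V := Finset.card_le_univ _

lemma dist_le_of_mul_card_le_degree [Fintype V] [DecidableRel G.Adj] (hG : G.Connected) {c : ℝ}
    (hc : 0 < c) {L : ℕ} (hL : 3 / c < L + 1) (hdeg : ∀ v, c * Fintype.card V ≤ G.degree v)
    (u v : V) : G.dist u v ≤ L := by
  have card_pos : (0 : ℝ) < Fintype.card V := by
    have : Nonempty V := ⟨u⟩
    exact_mod_cast Fintype.card_pos
  have mul_le : ((G.dist u v / 3 + 1 : ℕ) : ℝ) * (c * Fintype.card V) ≤ Fintype.card V :=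
    calc ((G.dist u v / 3 + 1 : ℕ) : ℝ) * (c * Fintype.card V)
        ≤ (G.dist u v / 3 + 1 : ℕ) * (⌈c * Fintype.card V⌉₊ : ℕ) := by
          gcongr
          exact Nat.le_ceil _
      _ ≤ Fintype.card V := by
          exact_mod_cast dist_div_three_add_one_mul_le_card hG
            (fun w => Nat.ceil_le.2 (hdeg w)) u v
  have mul_le_one : ((G.dist u v / 3 + 1 : ℕ) : ℝ) * c ≤ 1 := by
    rw [← mul_assoc] at mul_le
    exact le_of_mul_le_mul_right (by rwa [one_mul]) card_pos
  have dist_lt : (G.dist u v : ℝ) < (L + 1 : ℕ) :=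
    calc (G.dist u v : ℝ)
        ≤ 3 * (G.dist u v / 3 + 1 : ℕ) := by exact_mod_cast (by omega)
      _ ≤ 3 * (1 / c) := by
          gcongr
          rwa [le_div_iff₀ hc]
      _ = 3 / c := by ring
      _ < (L + 1 : ℕ) := by exact_mod_cast hL
  exact Nat.lt_succ_iff.1 (by exact_mod_cast dist_lt)

open Classical in
lemma degree_le_degree_deleteEdges_add_card [Fintype V] (G : SimpleGraph V)
    (F : Finset (Sym2 V)) (v : V) :
    G.degree v ≤ (G.deleteEdges (F : Set (Sym2 V))).degree v + F.card := by
  have neighborFinset_subset : G.neighborFinset v ⊆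
      (G.deleteEdges (F : Set (Sym2 V))).neighborFinset v ∪
        Finset.univ.filter fun w => s(v, w) ∈ F := by
    intro w hw
    rw [SimpleGraph.mem_neighborFinset] at hw
    simp only [Finset.mem_union, SimpleGraph.mem_neighborFinset, SimpleGraph.deleteEdges_adj,
      Finset.mem_filter, Finset.mem_univ, true_and, Finset.mem_coe]
    tauto
  have card_le : (Finset.univ.filter fun w => s(v, w) ∈ F).card ≤ F.card :=
    Finset.card_le_card_of_injOn (fun w => s(v, w)) (fun w hw => by simpa using hw)
      fun w _ w' _ h => Sym2.congr_right.1 h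
  exact (Finset.card_le_card neighborFinset_subset).trans
    ((Finset.card_union_le _ _).trans (Nat.add_le_add_left card_le _))

open Classical in
lemma exists_isPath_length_le_disjoint [Fintype V] {c : ℝ} (hc : 0 < c) {L : ℕ}
    (hL : 6 / c < L + 1) (hdeg : c * Fintype.card V ≤ minDeg G) {F : Finset (Sym2 V)}
    (hF : (F : Set (Sym2 V)) ⊆ G.edgeSet) (hcard : F.card ≤ c / 2 * Fintype.card V)
    (hconn : F.card < edgeConnectivity G) (u v : V) :
    ∃ p : G.Walk u v, p.IsPath ∧ p.length ≤ L ∧ ∀ e ∈ p.edges, e ∉ F := by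
  have connected := connected_deleteEdges_of_card_lt hF hconn
  have degree_ge (w : V) :
      c / 2 * Fintype.card V ≤ (G.deleteEdges (F : Set (Sym2 V))).degree w := by
    have h₁ : (minDeg G : ℝ) ≤ G.degree w := by exact_mod_cast G.minDegree_le_degree w
    have h₂ : (G.degree w : ℝ) ≤ (G.deleteEdges (F : Set (Sym2 V))).degree w + F.card := by
      exact_mod_cast degree_le_degree_deleteEdges_add_card G F w
    linarith
  have dist_le : (G.deleteEdges (F : Set (Sym2 V))).dist u v ≤ L :=
    dist_le_of_mul_card_le_degree connected (half_pos hc)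
      (by rwa [div_div_eq_mul_div, show (3 : ℝ) * 2 = 6 by norm_num]) degree_ge u v
  obtain ⟨p, isPath, length_eq⟩ := connected.exists_path_of_dist u v
  have hle : G.deleteEdges (F : Set (Sym2 V)) ≤ G := SimpleGraph.deleteEdges_le _
  refine ⟨p.mapLe hle, isPath.mapLe hle, ?_, fun e he => ?_⟩
  · rw [SimpleGraph.Walk.mapLe, SimpleGraph.Walk.length_map]
    exact length_eq.trans_le dist_le
  · rw [SimpleGraph.Walk.edges_mapLe_eq_edges] at he
    have mem := p.edges_subset_edgeSet he
    rw [SimpleGraph.edgeSet_deleteEdges] at mem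
    exact mem.2

lemma exists_edgeDisjoint_paths_of_forall_avoid {Z : Type*} [Fintype Z] {L : ℕ} (v₀ : V)
    (tgt : Z → V)
    (havoid : ∀ F : Finset (Sym2 V), (F : Set (Sym2 V)) ⊆ G.edgeSet → F.card ≤ Fintype.card Z * L →
      ∀ v, ∃ p : G.Walk v₀ v, p.IsPath ∧ p.length ≤ L ∧ ∀ e ∈ p.edges, e ∉ F) :
    ∃ p : ∀ z, G.Walk v₀ (tgt z), (∀ z, (p z).IsPath ∧ (p z).length ≤ L) ∧
      Pairwise fun z z' => (p z).edges.Disjoint (p z').edges := by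
  classical
  suffices h : ∀ A : Finset Z, ∃ p : ∀ z, G.Walk v₀ (tgt z),
      (∀ z, (p z).IsPath ∧ (p z).length ≤ L) ∧
        (A : Set Z).Pairwise fun z z' => (p z).edges.Disjoint (p z').edges by
    simpa only [Finset.coe_univ, Set.pairwise_univ] using h Finset.univ
  intro A
  induction A using Finset.induction_on with
  | empty =>
    choose p isPath length_le _ using fun z => havoid ∅ (by simp) (by simp) (tgt z)
    exact ⟨p, fun z => ⟨isPath z, length_le z⟩, by simp⟩
  | insert a A ha ih =>
    obtain ⟨p, hp, disjoint⟩ := ih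
    let F : Finset (Sym2 V) := A.biUnion fun z => (p z).edges.toFinset
    have mem_F {z : Z} (hz : z ∈ A) {e : Sym2 V} (he : e ∈ (p z).edges) : e ∈ F :=
      Finset.mem_biUnion.2 ⟨z, hz, List.mem_toFinset.2 he⟩
    have F_subset : (F : Set (Sym2 V)) ⊆ G.edgeSet := fun e he =>
      have ⟨z, _, hz⟩ := Finset.mem_biUnion.1 he
      (p z).edges_subset_edgeSet (List.mem_toFinset.1 hz)
    have card_F_le : F.card ≤ Fintype.card Z * L :=
      (Finset.card_biUnion_le_card_mul A _ L fun z _ => (List.toFinset_card_le _).trans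
        ((p z).length_edges.trans_le (hp z).2)).trans
          (Nat.mul_le_mul_right _ (Finset.card_le_univ A))
    obtain ⟨q, isPath, length_le, hq⟩ := havoid F F_subset card_F_le (tgt a)
    have ne_of_mem {z : Z} (hz : z ∈ A) : z ≠ a := fun h => ha (h ▸ hz)
    refine ⟨Function.update p a q, fun z => ?_, ?_⟩
    · rcases eq_or_ne z a with rfl | hz
      · simpa only [Function.update_self] using ⟨isPath, length_le⟩
      · simpa only [Function.update_of_ne hz] using hp z
    · rw [Finset.coe_insert, Set.pairwise_insert]
      refine ⟨fun z hz z' hz' hne => ?_, fun z hz _ => ?_⟩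
      · simpa only [Function.update_of_ne (ne_of_mem hz), Function.update_of_ne (ne_of_mem hz')]
          using disjoint hz hz' hne
      · have q_disjoint : q.edges.Disjoint (p z).edges := fun e he he' => hq e he (mem_F hz he')
        simpa only [Function.update_self, Function.update_of_ne (ne_of_mem hz)]
          using And.intro q_disjoint q_disjoint.symm

lemma exists_edgeDisjoint_paths [Fintype V] {c : ℝ} (hc : 0 < c) {L : ℕ} (hL : 6 / c < L + 1)
    {Z : Type*} [Fintype Z] (v₀ : V) (tgt : Z → V) (hdeg : c * Fintype.card V ≤ minDeg G)
    (hZ : (Fintype.card Z * L : ℕ) ≤ c / 2 * Fintype.card V)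
    (hconn : Fintype.card Z * L < edgeConnectivity G) :
    ∃ p : ∀ z, G.Walk v₀ (tgt z), (∀ z, (p z).IsPath ∧ (p z).length ≤ L) ∧
      Pairwise fun z z' => (p z).edges.Disjoint (p z').edges :=
  exists_edgeDisjoint_paths_of_forall_avoid v₀ tgt fun _ hF hcard v =>
    exists_isPath_length_le_disjoint hc hL hdeg hF
      (le_trans (by exact_mod_cast hcard) hZ) (hcard.trans_lt hconn) v₀ v

/-- The party holding a given half of an edge of the network; the half `false` is the first end of
the edge in the orientation used by `edgeIdx`. -/
noncomputable def halfEdgeOwner (G : SimpleGraph V) (q : G.edgeSet × Bool) : V :=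
  cond q.2 (Quot.out q.1.1).2 (Quot.out q.1.1).1

lemma exists_isRoute_of_walk {u w : V} (p : G.Walk u w) :
    ∃ l : List (G.edgeSet × Bool), IsRoute (halfEdgeOwner G) u l w ∧
      (l.map Prod.fst).map Subtype.val = p.edges := by
  induction p with
  | nil => exact ⟨[], rfl, rfl⟩
  | @cons u v w h p ih =>
    obtain ⟨l, hl, map_l⟩ := ih
    let e : G.edgeSet := ⟨s(u, v), h⟩
    have out_eq : s((Quot.out e.1).1, (Quot.out e.1).2) = s(u, v) := Quot.out_eq e.1
    have route {b : Bool} (hb : halfEdgeOwner G (e, b) = u) (hb' : halfEdgeOwner G (e, !b) = v) :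
        IsRoute (halfEdgeOwner G) u ((e, b) :: l) w := ⟨hb, hb' ▸ hl⟩
    rcases Sym2.eq_iff.1 out_eq with ⟨hu, hv⟩ | ⟨hv, hu⟩
    · exact ⟨(e, false) :: l, route hu hv, by simp [map_l, e]⟩
    · exact ⟨(e, true) :: l, route hu hv, by simp [map_l, e]⟩

end Graph

/-! ### Fidelity with pure states -/

section Fidelity

variable {m : Type u} [Fintype m]

lemma star_dotProduct_self_eq_sum_norm_sq (v : m → ℂ) :
    star v ⬝ᵥ v = ((∑ i, ‖v i‖ ^ 2 : ℝ) : ℂ) := by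
  simp only [dotProduct, Pi.star_apply, Complex.star_def, Complex.conj_mul', Complex.ofReal_sum,
    Complex.ofReal_pow]

lemma vecMulVec_star_mul_self (v : m → ℂ) :
    Matrix.vecMulVec v (star v) * Matrix.vecMulVec v (star v)
      = (star v ⬝ᵥ v) • Matrix.vecMulVec v (star v) := by
  rw [Matrix.vecMulVec_mul_vecMulVec, Matrix.vecMulVec_smul]

open Classical in
lemma sqrt_vecMulVec_star (v : m → ℂ) :
    CFC.sqrt (Matrix.vecMulVec v (star v))
      = (((√(∑ i, ‖v i‖ ^ 2))⁻¹ : ℝ) : ℂ) • Matrix.vecMulVec v (star v) := by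
  rcases eq_or_ne v 0 with rfl | hv
  · simp
  have sum_pos : 0 < ∑ i, ‖v i‖ ^ 2 := by
    obtain ⟨i, hi⟩ := Function.ne_iff.1 hv
    exact Finset.sum_pos' (fun _ _ => by positivity)
      ⟨i, Finset.mem_univ i, pow_pos (norm_pos_iff.2 hi) 2⟩
  refine CFC.sqrt_unique ?_ ?_
  · rw [smul_mul_smul_comm, vecMulVec_star_mul_self, star_dotProduct_self_eq_sum_norm_sq, smul_smul,
      ← Complex.ofReal_mul, ← Complex.ofReal_mul, ← mul_inv, Real.mul_self_sqrt sum_pos.le,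
      inv_mul_cancel₀ sum_pos.ne', Complex.ofReal_one, one_smul]
  · rw [Matrix.nonneg_iff_posSemidef]
    exact (Matrix.posSemidef_vecMulVec_self_star v).smul
      (Complex.zero_le_real.2 (inv_nonneg.2 (Real.sqrt_nonneg _)))

open Classical in
lemma trace_sqrt_vecMulVec_star (v : m → ℂ) :
    (CFC.sqrt (Matrix.vecMulVec v (star v))).trace = (√(∑ i, ‖v i‖ ^ 2) : ℂ) := by
  rw [sqrt_vecMulVec_star, Matrix.trace_smul, Matrix.trace_vecMulVec, dotProduct_comm,
    star_dotProduct_self_eq_sum_norm_sq, smul_eq_mul, ← Complex.ofReal_mul, inv_mul_eq_div,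
    Real.div_sqrt]

variable [DecidableEq m]

lemma fidelity_vecMulVec_star {ρ : Matrix m m ℂ} (hρ : ρ.PosSemidef) (φ : m → ℂ) :
    fidelity ρ (Matrix.vecMulVec φ (star φ)) = (star φ ⬝ᵥ ρ *ᵥ φ).re := by
  have sqrt_conjTranspose : (CFC.sqrt ρ)ᴴ = CFC.sqrt ρ :=
    (Matrix.nonneg_iff_posSemidef.1 (CFC.sqrt_nonneg ρ)).1
  have sandwich_eq : CFC.sqrt ρ * Matrix.vecMulVec φ (star φ) * CFC.sqrt ρ
      = Matrix.vecMulVec (CFC.sqrt ρ *ᵥ φ) (star (CFC.sqrt ρ *ᵥ φ)) := by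
    rw [← mul_vecMulVec_star_mul_conjTranspose, sqrt_conjTranspose]
  calc fidelity ρ (Matrix.vecMulVec φ (star φ))
      = ∑ i, ‖(CFC.sqrt ρ *ᵥ φ) i‖ ^ 2 := by
        rw [fidelity, sandwich_eq, trace_sqrt_vecMulVec_star, Complex.ofReal_re,
          Real.sq_sqrt (by positivity)]
    _ = (star (CFC.sqrt ρ *ᵥ φ) ⬝ᵥ CFC.sqrt ρ *ᵥ φ).re := by
        rw [star_dotProduct_self_eq_sum_norm_sq, Complex.ofReal_re]
    _ = (star φ ⬝ᵥ ρ *ᵥ φ).re := by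
        rw [Matrix.star_mulVec, Matrix.dotProduct_mulVec, Matrix.vecMul_vecMul, sqrt_conjTranspose,
          CFC.sqrt_mul_sqrt_self ρ (Matrix.nonneg_iff_posSemidef.2 hρ), ← Matrix.dotProduct_mulVec]

lemma fidelity_vecMulVec_star_self {φ : m → ℂ} (hφ : star φ ⬝ᵥ φ = 1) :
    fidelity (Matrix.vecMulVec φ (star φ)) (Matrix.vecMulVec φ (star φ)) = 1 := by
  rw [fidelity_vecMulVec_star (Matrix.posSemidef_vecMulVec_self_star φ), Matrix.vecMulVec_mulVec,
    hφ, MulOpposite.op_one, one_smul, hφ, Complex.one_re]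

lemma fidelity_le_re_trace {ρ : Matrix m m ℂ} (hρ : ρ.PosSemidef) {φ : m → ℂ}
    (hφ : star φ ⬝ᵥ φ = 1) : fidelity ρ (Matrix.vecMulVec φ (star φ)) ≤ ρ.trace.re := by
  let R : Matrix m m ℂ := 1 - Matrix.vecMulVec φ (star φ)
  have conjTranspose_R : Rᴴ = R := by
    rw [Matrix.conjTranspose_sub, Matrix.conjTranspose_one,
      (Matrix.posSemidef_vecMulVec_self_star φ).1]
  have R_mul_R : R * R = R := by
    simp only [R, mul_sub, sub_mul, one_mul, mul_one, vecMulVec_star_mul_self, hφ, one_smul,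
      sub_self, sub_zero]
  have trace_nonneg : 0 ≤ (R * ρ).trace := by
    have h := (hρ.mul_mul_conjTranspose_same R).trace_nonneg
    rwa [Matrix.trace_mul_comm, ← Matrix.mul_assoc, conjTranspose_R, R_mul_R] at h
  have trace_eq : (R * ρ).trace = ρ.trace - star φ ⬝ᵥ ρ *ᵥ φ := by
    rw [sub_mul, one_mul, Matrix.trace_sub, Matrix.vecMulVec_mul, Matrix.trace_vecMulVec,
      dotProduct_comm, ← Matrix.dotProduct_mulVec]
  rw [fidelity_vecMulVec_star hρ, ← sub_nonneg, ← Complex.sub_re, ← trace_eq]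
  exact (Complex.le_def.1 trace_nonneg).1

lemma fidelity_sum_smul {B : Type*} [Fintype B] {w : B → ℝ} (hw : ∀ b, 0 ≤ w b)
    {ρ : B → Matrix m m ℂ} (hρ : ∀ b, (ρ b).PosSemidef) (φ : m → ℂ) :
    fidelity (∑ b, (w b : ℂ) • ρ b) (Matrix.vecMulVec φ (star φ))
      = ∑ b, w b * fidelity (ρ b) (Matrix.vecMulVec φ (star φ)) := by
  have posSemidef : (∑ b, (w b : ℂ) • ρ b).PosSemidef :=
    Matrix.posSemidef_sum _ fun b _ => (hρ b).smul (Complex.zero_le_real.2 (hw b))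
  rw [fidelity_vecMulVec_star posSemidef, Matrix.sum_mulVec, dotProduct_sum, Complex.re_sum]
  refine Finset.sum_congr rfl fun b _ => ?_
  rw [Matrix.smul_mulVec, dotProduct_smul, smul_eq_mul, Complex.re_ofReal_mul,
    fidelity_vecMulVec_star (hρ b)]

lemma posSemidef_sum_mul_mul_conjTranspose {m n ι : Type*} [Finite m] [Fintype n]
    [Fintype ι] (K : ι → Matrix m n ℂ) {σ : Matrix n n ℂ} (hσ : σ.PosSemidef) :
    (∑ i, K i * σ * (K i)ᴴ).PosSemidef :=
  Matrix.posSemidef_sum _ fun i _ => hσ.mul_mul_conjTranspose_same (K i)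

variable {n ι : Type*} [Fintype n] [DecidableEq n] [Fintype ι] {K : ι → Matrix m n ℂ}

omit [DecidableEq m] in
lemma IsKrausFamily.trace_sum_mul_mul_conjTranspose (hK : IsKrausFamily K) (σ : Matrix n n ℂ) :
    (∑ i, K i * σ * (K i)ᴴ).trace = σ.trace :=
  calc (∑ i, K i * σ * (K i)ᴴ).trace
      = ((∑ i, (K i)ᴴ * K i) * σ).trace := by
        rw [Matrix.sum_mul, Matrix.trace_sum, Matrix.trace_sum]
        refine Finset.sum_congr rfl fun i _ => ?_
        rw [Matrix.trace_mul_comm, Matrix.mul_assoc]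
    _ = σ.trace := by rw [hK, one_mul]

lemma IsKrausFamily.fidelity_le_one (hK : IsKrausFamily K) {σ : Matrix n n ℂ}
    (hσ : σ.PosSemidef) (trace_σ : σ.trace = 1) {φ : m → ℂ} (hφ : star φ ⬝ᵥ φ = 1) :
    fidelity (∑ i, K i * σ * (K i)ᴴ) (Matrix.vecMulVec φ (star φ)) ≤ 1 := by
  refine (fidelity_le_re_trace (posSemidef_sum_mul_mul_conjTranspose K hσ) hφ).trans_eq ?_
  rw [hK.trace_sum_mul_mul_conjTranspose, trace_σ, Complex.one_re]

lemma IsKrausFamily.fidelity_eq_one (hK : IsKrausFamily K) {σ : Matrix n n ℂ}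
    (trace_σ : σ.trace = 1) {φ : m → ℂ} (hφ : star φ ⬝ᵥ φ = 1) {c : ℂ}
    (h : ∑ i, K i * σ * (K i)ᴴ = c • Matrix.vecMulVec φ (star φ)) :
    fidelity (∑ i, K i * σ * (K i)ᴴ) (Matrix.vecMulVec φ (star φ)) = 1 := by
  have c_eq : c = 1 := by
    have trace_eq := hK.trace_sum_mul_mul_conjTranspose σ
    rwa [h, trace_σ, Matrix.trace_smul, Matrix.trace_vecMulVec, dotProduct_comm, hφ, smul_eq_mul,
      mul_one] at trace_eq
  rw [h, c_eq, one_smul, fidelity_vecMulVec_star_self hφ]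

lemma IsKrausFamily.sum_le_fidelity (hK : IsKrausFamily K) {B : Type*} [Fintype B] {w : B → ℝ}
    (hw : ∀ b, 0 ≤ w b) {σ : B → Matrix n n ℂ} (hσ : ∀ b, (σ b).PosSemidef)
    (trace_σ : ∀ b, (σ b).trace = 1) {φ : m → ℂ} (hφ : star φ ⬝ᵥ φ = 1) {good : Finset B}
    (hgood : ∀ b ∈ good, ∃ c : ℂ, ∑ i, K i * σ b * (K i)ᴴ = c • Matrix.vecMulVec φ (star φ)) :
    ∑ b ∈ good, w b
      ≤ fidelity (∑ i, K i * (∑ b, (w b : ℂ) • σ b) * (K i)ᴴ) (Matrix.vecMulVec φ (star φ)) := by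
  have sum_eq : ∑ i, K i * (∑ b, (w b : ℂ) • σ b) * (K i)ᴴ
      = ∑ b, (w b : ℂ) • ∑ i, K i * σ b * (K i)ᴴ := by
    simp only [Matrix.mul_sum, Matrix.sum_mul, Finset.smul_sum, Matrix.mul_smul, Matrix.smul_mul]
    exact Finset.sum_comm
  rw [sum_eq, fidelity_sum_smul hw fun b => posSemidef_sum_mul_mul_conjTranspose K (hσ b)]
  calc ∑ b ∈ good, w b
      = ∑ b ∈ good, w b * fidelity (∑ i, K i * σ b * (K i)ᴴ) (Matrix.vecMulVec φ (star φ)) := by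
        refine Finset.sum_congr rfl fun b hb => ?_
        obtain ⟨c, hc⟩ := hgood b hb
        rw [hK.fidelity_eq_one (trace_σ b) hφ hc, mul_one]
    _ ≤ ∑ b, w b * fidelity (∑ i, K i * σ b * (K i)ᴴ) (Matrix.vecMulVec φ (star φ)) :=
        Finset.sum_le_sum_of_subset_of_nonneg (Finset.subset_univ _) fun b _ _ =>
          mul_nonneg (hw b) (sq_nonneg _)

end Fidelity

/-! ### Independent errors -/

section Errors

variable {E O ι : Type*}

lemma sum_filter_exists_le {f : E → ℝ} (hf : ∀ b, 0 ≤ f b) [Fintype E] (J : Finset ι)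
    (P : ι → E → Prop) [∀ j, DecidablePred (P j)] [DecidablePred fun b => ∃ j ∈ J, P j b] :
    ∑ b with ∃ j ∈ J, P j b, f b ≤ ∑ j ∈ J, ∑ b with P j b, f b := by
  simp only [Finset.sum_filter]
  rw [Finset.sum_comm]
  refine Finset.sum_le_sum fun b _ => ?_
  have term_nonneg (j : ι) : 0 ≤ if P j b then f b else 0 := by
    split_ifs
    exacts [hf b, le_rfl]
  split_ifs with h
  · obtain ⟨j, hj, hPj⟩ := h
    exact (if_pos hPj).symm.le.trans (Finset.single_le_sum (fun j _ => term_nonneg j) hj)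
  · exact Finset.sum_nonneg fun j _ => term_nonneg j

variable [Fintype E] [DecidableEq E] [Fintype O] {w : O → ℝ} (err : O → Prop) [DecidablePred err]

lemma sum_filter_forall_mem_prod (sum_w : ∑ o, w o = 1) (Y : Finset E) :
    ∑ b : E → O with ∀ e ∈ Y, err (b e), ∏ e, w (b e) = (∑ o with err o, w o) ^ Y.card := by
  classical
  have filter_eq : (Finset.univ.filter fun b : E → O => ∀ e ∈ Y, err (b e))
      = Fintype.piFinset fun e => if e ∈ Y then Finset.univ.filter err else Finset.univ := by
    ext b
    simp only [Finset.mem_filter, Finset.mem_univ, true_and, Fintype.mem_piFinset]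
    refine forall_congr' fun e => ?_
    by_cases he : e ∈ Y <;> simp [he]
  have sum_eq (e : E) : ∑ o ∈ if e ∈ Y then Finset.univ.filter err else Finset.univ, w o
      = if e ∈ Y then ∑ o with err o, w o else 1 := by
    split_ifs
    exacts [rfl, sum_w]
  rw [filter_eq, ← Finset.prod_univ_sum, Finset.prod_congr rfl fun e _ => sum_eq e,
    Finset.prod_ite_mem, Finset.univ_inter, Finset.prod_const]

lemma sum_filter_forall_exists_mem_prod_le (hw : ∀ o, 0 ≤ w o) (sum_w : ∑ o, w o = 1)
    {S : ι → Finset E} (hS : Pairwise (Function.onFun Disjoint S)) {L : ℕ}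
    (hL : ∀ i, (S i).card ≤ L) (A : Finset ι) :
    ∑ b : E → O with ∀ i ∈ A, ∃ e ∈ S i, err (b e), ∏ e, w (b e)
      ≤ (L * ∑ o with err o, w o) ^ A.card := by
  classical
  have filter_eq : (Finset.univ.filter fun b : E → O => ∀ i ∈ A, ∃ e ∈ S i, err (b e))
      = Finset.univ.filter fun b : E → O =>
        ∃ f ∈ A.pi S, ∀ e ∈ A.attach.image fun i => f i.1 i.2, err (b e) := by
    ext b
    simp only [Finset.mem_filter, Finset.mem_univ, true_and, Finset.mem_pi,
      Finset.forall_mem_image, Finset.mem_attach, forall_const, Subtype.forall]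
    constructor
    · intro h
      choose f mem_S h_err using h
      exact ⟨f, mem_S, h_err⟩
    · rintro ⟨f, mem_S, h_err⟩ i hi
      exact ⟨f i hi, mem_S i hi, h_err i hi⟩
  have card_image {f : ∀ i ∈ A, E} (hf : f ∈ A.pi S) :
      (A.attach.image fun i => f i.1 i.2).card = A.card := by
    rw [Finset.card_image_of_injective, Finset.card_attach]
    intro i j hij
    by_contra hne
    have mem_i := Finset.mem_pi.1 hf i.1 i.2
    have mem_j := Finset.mem_pi.1 hf j.1 j.2
    rw [← show f i.1 i.2 = f j.1 j.2 from hij] at mem_j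
    exact Finset.disjoint_left.1 (hS fun h => hne (Subtype.ext h)) mem_i mem_j
  have sum_nonneg : 0 ≤ ∑ o with err o, w o := Finset.sum_nonneg fun o _ => hw o
  calc ∑ b : E → O with ∀ i ∈ A, ∃ e ∈ S i, err (b e), ∏ e, w (b e)
      ≤ ∑ f ∈ A.pi S, ∑ b : E → O with ∀ e ∈ A.attach.image fun i => f i.1 i.2, err (b e),
          ∏ e, w (b e) := by
        rw [filter_eq]
        exact sum_filter_exists_le (fun b => Finset.prod_nonneg fun e _ => hw _) _ _
    _ = ∏ i ∈ A, (S i).card * ∑ o with err o, w o := by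
        rw [Finset.sum_congr rfl fun f hf => (sum_filter_forall_mem_prod err sum_w _).trans
          (congrArg _ (card_image hf)), Finset.sum_const, Finset.card_pi, nsmul_eq_mul,
          Finset.prod_mul_distrib, Finset.prod_const, Nat.cast_prod]
    _ ≤ ∏ _i ∈ A, L * ∑ o with err o, w o := by
        gcongr with i
        exact hL i
    _ = (L * ∑ o with err o, w o) ^ A.card := Finset.prod_const _

open Classical in
lemma sum_filter_exists_forall_exists_prod_le {T X : Type*} [Fintype T]
    (hw : ∀ o, 0 ≤ w o) (sum_w : ∑ o, w o = 1) {S : T × X → Finset E}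
    (hS : Pairwise (Function.onFun Disjoint S)) {L : ℕ} (hL : ∀ z, (S z).card ≤ L)
    {W : Finset (Finset X)} {k : ℕ} (hW : ∀ A ∈ W, A.card = k) :
    ∑ b : E → O with ∃ z ∈ (Finset.univ : Finset T) ×ˢ W, ∀ i ∈ z.2, ∃ e ∈ S (z.1, i), err (b e),
        ∏ e, w (b e)
      ≤ Fintype.card T * (W.card * (L * ∑ o with err o, w o) ^ k) :=
  calc _ ≤ ∑ z ∈ Finset.univ ×ˢ W, ∑ b : E → O with ∀ i ∈ z.2, ∃ e ∈ S (z.1, i), err (b e),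
          ∏ e, w (b e) :=
        sum_filter_exists_le (fun b => Finset.prod_nonneg fun e _ => hw _) _
          fun (z : T × Finset X) (b : E → O) => ∀ i ∈ z.2, ∃ e ∈ S (z.1, i), err (b e)
    _ ≤ ∑ _z ∈ (Finset.univ : Finset T) ×ˢ W, (L * ∑ o with err o, w o) ^ k := by
        refine Finset.sum_le_sum fun z hz => ?_
        rw [← hW z.2 (Finset.mem_product.1 hz).2]
        exact sum_filter_forall_exists_mem_prod_le err hw sum_w
          (hS.comp_of_injective (Prod.mk_right_injective z.1)) (fun i => hL (z.1, i)) z.2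
    _ = Fintype.card T * (W.card * (L * ∑ o with err o, w o) ^ k) := by
        rw [Finset.sum_const, Finset.card_product, Finset.card_univ, nsmul_eq_mul, Nat.cast_mul,
          mul_assoc]

lemma sum_pi_prod (sum_w : ∑ o, w o = 1) : ∑ b : E → O, ∏ e, w (b e) = 1 := by
  rw [← Fintype.prod_sum fun (_ : E) o => w o]
  exact Finset.prod_eq_one fun _ _ => sum_w

lemma one_sub_le_sum_filter_forall_exists_forall_not_prod {T X : Type*} [Fintype T]
    (hw : ∀ o, 0 ≤ w o) (sum_w : ∑ o, w o = 1) {S : T × X → Finset E}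
    (hS : Pairwise (Function.onFun Disjoint S)) {L : ℕ} (hL : ∀ z, (S z).card ≤ L)
    {W : Finset (Finset X)} {k : ℕ} (hW : ∀ A ∈ W, A.card = k) :
    1 - Fintype.card T * (W.card * (L * ∑ o with err o, w o) ^ k)
      ≤ ∑ b : E → O with ∀ t, ∀ A ∈ W, ∃ i ∈ A, ∀ e ∈ S (t, i), ¬ err (b e), ∏ e, w (b e) := by
  classical
  have not_iff (b : E → O) : (∀ t, ∀ A ∈ W, ∃ i ∈ A, ∀ e ∈ S (t, i), ¬ err (b e)) ↔
      ¬ ∃ z ∈ (Finset.univ : Finset T) ×ˢ W, ∀ i ∈ z.2, ∃ e ∈ S (z.1, i), err (b e) := by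
    simp only [Prod.exists, Finset.mem_product, Finset.mem_univ, true_and, not_exists, not_and,
      not_forall, exists_prop]
  simp only [not_iff]
  rw [← sum_pi_prod sum_w (E := E), ← Finset.sum_filter_add_sum_filter_not Finset.univ fun b =>
    ∃ z ∈ (Finset.univ : Finset T) ×ˢ W, ∀ i ∈ z.2, ∃ e ∈ S (z.1, i), err (b e)]
  linarith [sum_filter_exists_forall_exists_prod_le err hw sum_w hS hL hW]

end Errors

/-! ### Isotropic network states as mixtures -/

section HalfEdges

variable {V : Type*} (G : SimpleGraph V)

lemma halfEdgeOwner_mem (q : G.edgeSet × Bool) : halfEdgeOwner G q ∈ (q.1 : Sym2 V) := by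
  obtain ⟨e, _ | _⟩ := q
  exacts [Sym2.out_fst_mem e.1, Sym2.out_snd_mem e.1]

lemma mk_halfEdgeOwner (e : G.edgeSet) :
    s(halfEdgeOwner G (e, false), halfEdgeOwner G (e, true)) = e :=
  Quot.out_eq (e : Sym2 V)

lemma halfEdgeOwner_false_ne_true (e : G.edgeSet) :
    halfEdgeOwner G (e, false) ≠ halfEdgeOwner G (e, true) := by
  have h : s(halfEdgeOwner G (e, false), halfEdgeOwner G (e, true)) ∈ G.edgeSet :=
    (mk_halfEdgeOwner G e).symm ▸ e.2
  exact (G.mem_edgeSet.1 h).ne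

lemma halfEdgeOwner_injective (e : G.edgeSet) :
    Function.Injective fun b => halfEdgeOwner G (e, b) := by
  rintro (_ | _) (_ | _) h
  exacts [rfl, (halfEdgeOwner_false_ne_true G e h).elim,
    (halfEdgeOwner_false_ne_true G e h.symm).elim, rfl]

/-- The half-edges owned by `v` correspond to the edges at `v`. -/
noncomputable def halfEdgeEquiv (v : V) : {q // halfEdgeOwner G q = v} ≃ G.incidenceSet v :=
  Equiv.ofBijective (fun q => ⟨q.1.1, q.1.1.2, by
    simpa only [q.2] using halfEdgeOwner_mem G q.1⟩) <| by
    constructor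
    · rintro ⟨⟨e, b⟩, h⟩ ⟨⟨e', b'⟩, h'⟩ heq
      obtain rfl : e = e' := Subtype.ext (congrArg (fun e : G.incidenceSet v => e.1) heq)
      obtain rfl : b = b' := halfEdgeOwner_injective G e (h.trans h'.symm)
      rfl
    · rintro ⟨e, he, hv⟩
      have v_mem : v ∈ s(halfEdgeOwner G (⟨e, he⟩, false), halfEdgeOwner G (⟨e, he⟩, true)) := by
        rwa [mk_halfEdgeOwner]
      rcases Sym2.mem_iff.1 v_mem with h | h
      exacts [⟨⟨(⟨e, he⟩, false), h.symm⟩, rfl⟩, ⟨⟨(⟨e, he⟩, true), h.symm⟩, rfl⟩]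

end HalfEdges

section Network

variable {V : Type u} (G : SimpleGraph V) (d : ℕ)

/-- The labels of the basis of one party, with its qudits indexed by half-edges. -/
noncomputable def partyEquiv (v : V) :
    PartyIdx G d v ≃ ({q // halfEdgeOwner G q = v} → Fin d) :=
  Equiv.arrowCongr (halfEdgeEquiv G v).symm (Equiv.refl _)

/-- The labels of the basis of the network, with its qudits indexed by half-edges. -/
noncomputable def netEquiv : NetIdx G d ≃ (G.edgeSet × Bool → Fin d) :=
  (Equiv.piCongrRight (partyEquiv G d)).trans (ownedEquiv (Fin d) (halfEdgeOwner G))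

lemma edgeIdx_eq (x : NetIdx G d) (e : G.edgeSet) :
    edgeIdx G d x e = (netEquiv G d x (e, false), netEquiv G d x (e, true)) := rfl

/-- The labels of the basis of the network as families of labels of the edges. -/
noncomputable def edgeIdxEquiv : NetIdx G d ≃ (G.edgeSet → Fin d × Fin d) :=
  (netEquiv G d).trans ((Equiv.curry _ _ _).trans
    (Equiv.piCongrRight fun _ => Equiv.boolArrowEquivProd _))

lemma edgeIdxEquiv_apply (x : NetIdx G d) : edgeIdxEquiv G d x = edgeIdx G d x := rfl

variable [Fintype G.edgeSet]

/-- The pure state `⨂ₑ vₑ` of the network. -/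
noncomputable def edgePureState (v : G.edgeSet → Fin d × Fin d → ℂ) (x : NetIdx G d) : ℂ :=
  ∏ e, v e (edgeIdx G d x e)

lemma star_dotProduct_edgePureState [Fintype (NetIdx G d)]
    {v : G.edgeSet → Fin d × Fin d → ℂ} (hv : ∀ e, star (v e) ⬝ᵥ v e = 1) :
    star (edgePureState G d v) ⬝ᵥ edgePureState G d v = 1 := by
  classical
  calc star (edgePureState G d v) ⬝ᵥ edgePureState G d v
      = ∑ x, ∏ e, star (v e (edgeIdx G d x e)) * v e (edgeIdx G d x e) := by
        simp only [dotProduct, Pi.star_apply, edgePureState, star_prod, Finset.prod_mul_distrib]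
    _ = ∑ y : G.edgeSet → Fin d × Fin d, ∏ e, star (v e (y e)) * v e (y e) := by
        simp only [← edgeIdxEquiv_apply]
        exact (edgeIdxEquiv G d).sum_comp fun y => ∏ e, star (v e (y e)) * v e (y e)
    _ = ∏ e, star (v e) ⬝ᵥ v e := (Fintype.prod_sum fun e i => star (v e i) * v e i).symm
    _ = 1 := Finset.prod_eq_one fun e _ => hv e

end Network

section Isotropic

variable (d : ℕ)

/-- The pure states of which the isotropic states are mixtures: the maximally entangled state
and the product basis states. -/
noncomputable def componentVec : Option (Fin d × Fin d) → Fin d × Fin d → ℂ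
  | none => maxEntangledVec d
  | some i => Pi.single i 1

/-- The weight of `componentVec d o` in the isotropic state of visibility `p`. -/
noncomputable def componentWeight (p : ℝ) : Option (Fin d × Fin d) → ℝ
  | none => p
  | some _ => (1 - p) / (d : ℝ) ^ 2

lemma componentWeight_nonneg {p : ℝ} (hp₀ : 0 ≤ p) (hp₁ : p ≤ 1) (o : Option (Fin d × Fin d)) :
    0 ≤ componentWeight d p o := by
  cases o with
  | none => exact hp₀
  | some _ => exact div_nonneg (sub_nonneg.2 hp₁) (sq_nonneg _)

lemma isotropic_eq_sum (p : ℝ) :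
    isotropic d p = ∑ o, (componentWeight d p o : ℂ) •
      Matrix.vecMulVec (componentVec d o) (star (componentVec d o)) := by
  have vecMulVec_some (i : Fin d × Fin d) :
      Matrix.vecMulVec (componentVec d (some i)) (star (componentVec d (some i)))
        = Matrix.single i i 1 := by
    rw [componentVec, ← Pi.single_star, star_one, Matrix.single_eq_single_vecMulVec_single]
  simp only [Fintype.sum_option, vecMulVec_some, componentWeight]
  rw [← Finset.smul_sum, Matrix.sum_single_one]
  rfl

variable [NeZero d]

lemma sum_componentWeight_some (p : ℝ) :
    ∑ i : Fin d × Fin d, componentWeight d p (some i) = 1 - p := by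
  have hd : (d : ℝ) ≠ 0 := Nat.cast_ne_zero.2 (NeZero.ne d)
  simp only [componentWeight, Finset.sum_const, Finset.card_univ, Fintype.card_prod,
    Fintype.card_fin, nsmul_eq_mul, Nat.cast_mul]
  field_simp

lemma sum_componentWeight (p : ℝ) : ∑ o, componentWeight d p o = 1 := by
  rw [Fintype.sum_option, sum_componentWeight_some, componentWeight, add_sub_cancel]

lemma sum_componentWeight_ne_none (p : ℝ) :
    ∑ o with o ≠ none, componentWeight d p o = 1 - p := by
  simp only [Finset.sum_filter, Fintype.sum_option, ne_eq, not_true_eq_false, if_false,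
    reduceCtorEq, not_false_eq_true, if_true, zero_add, sum_componentWeight_some]

lemma star_dotProduct_componentVec (o : Option (Fin d × Fin d)) :
    star (componentVec d o) ⬝ᵥ componentVec d o = 1 := by
  rw [star_dotProduct_self_eq_sum_norm_sq, ← Complex.ofReal_one]
  congr 1
  have hd : (d : ℝ) ≠ 0 := Nat.cast_ne_zero.2 (NeZero.ne d)
  cases o with
  | none =>
    have norm_sq (i j : Fin d) :
        ‖maxEntangledVec d (i, j)‖ ^ 2 = if i = j then (d : ℝ)⁻¹ else 0 := by
      rw [maxEntangledVec]
      split_ifs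
      · rw [Complex.norm_real, Real.norm_eq_abs, sq_abs, div_pow, one_pow,
          Real.sq_sqrt d.cast_nonneg, one_div]
      · rw [norm_zero, zero_pow two_ne_zero]
    simp only [componentVec, Fintype.sum_prod_type, norm_sq, Finset.sum_ite_eq, Finset.mem_univ,
      if_true, Finset.sum_const, Finset.card_univ, Fintype.card_fin, nsmul_eq_mul,
      mul_inv_cancel₀ hd]
  | some i => simp [componentVec, Pi.single_apply, apply_ite]

end Isotropic

section NetworkState

variable {V : Type u} [Fintype V] (G : SimpleGraph V) (d : ℕ) (p : ℝ)

lemma networkState_eq_sum [Fintype G.edgeSet] [DecidableEq G.edgeSet] :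
    networkState G d p = ∑ b : G.edgeSet → Option (Fin d × Fin d),
      ((∏ e, componentWeight d p (b e) : ℝ) : ℂ) •
        Matrix.vecMulVec (edgePureState G d fun e => componentVec d (b e))
          (star (edgePureState G d fun e => componentVec d (b e))) := by
  ext x y
  calc networkState G d p x y
      = ∏ e : G.edgeSet, isotropic d p (edgeIdx G d x e) (edgeIdx G d y e) := by
        rw [networkState, Matrix.of_apply]
        congr!
    _ = ∏ e : G.edgeSet, ∑ o, (componentWeight d p o : ℂ) *
          (componentVec d o (edgeIdx G d x e) * star (componentVec d o (edgeIdx G d y e))) := by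
        simp only [isotropic_eq_sum, Matrix.sum_apply, Matrix.smul_apply, Matrix.vecMulVec_apply,
          Pi.star_apply, smul_eq_mul]
    _ = _ := by
        simp only [Fintype.prod_sum, Matrix.sum_apply, Matrix.smul_apply, Matrix.vecMulVec_apply,
          Pi.star_apply, smul_eq_mul, edgePureState, star_prod, Complex.ofReal_prod,
          Finset.prod_mul_distrib]

variable {p} in
lemma posSemidef_networkState (hp₀ : 0 ≤ p) (hp₁ : p ≤ 1) : (networkState G d p).PosSemidef := by
  classical
  rw [networkState_eq_sum]
  refine Matrix.posSemidef_sum _ fun b _ => (Matrix.posSemidef_vecMulVec_self_star _).smul ?_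
  exact Complex.zero_le_real.2
    (Finset.prod_nonneg fun e _ => componentWeight_nonneg d hp₀ hp₁ (b e))

lemma trace_networkState [NeZero d] [Fintype (NetIdx G d)] : (networkState G d p).trace = 1 := by
  classical
  rw [networkState_eq_sum, Matrix.trace_sum, ← Complex.ofReal_one,
    ← sum_pi_prod (sum_componentWeight d p) (E := G.edgeSet), Complex.ofReal_sum]
  refine Finset.sum_congr rfl fun b _ => ?_
  rw [Matrix.trace_smul, Matrix.trace_vecMulVec, dotProduct_comm,
    star_dotProduct_edgePureState G d fun e => star_dotProduct_componentVec d (b e), smul_eq_mul,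
    mul_one]

end NetworkState

/-! ### Network protocols -/

lemma isScalarOp_curry_componentVec_none (d : ℕ) :
    IsScalarOp (Matrix.of (Function.curry (componentVec d none))) := by
  refine ⟨((1 / Real.sqrt d : ℝ) : ℂ), ?_⟩
  ext i j
  simp only [componentVec, maxEntangledVec, Matrix.of_apply, Function.curry_apply,
    Matrix.smul_apply, Matrix.one_apply, smul_eq_mul, mul_ite, mul_one, mul_zero]

section Routing

variable {V Z : Type u} {G : SimpleGraph V}

lemma exists_isDisjointRouting_of_paths {v₀ : V} {tgt : Z → V} {p : ∀ z, G.Walk v₀ (tgt z)}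
    (hp : ∀ z, (p z).IsPath) (hdisj : Pairwise fun z z' => (p z).edges.Disjoint (p z').edges) :
    ∃ r : Z → List (G.edgeSet × Bool),
      IsDisjointRouting (Sum.elim (fun _ : Z => v₀) (halfEdgeOwner G)) tgt r ∧
        ∀ z (e : G.edgeSet), e ∈ (r z).map Prod.fst ↔ (e : Sym2 V) ∈ (p z).edges := by
  choose r isRoute map_r using fun z => exists_isRoute_of_walk (p z)
  have mem_iff (z) (e : G.edgeSet) : e ∈ (r z).map Prod.fst ↔ (e : Sym2 V) ∈ (p z).edges := by
    rw [← map_r z, List.mem_map_of_injective Subtype.val_injective]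
  refine ⟨r, ⟨isRoute, fun z => List.Nodup.of_map Subtype.val ?_, fun z z' hz e he he' => ?_⟩,
    mem_iff⟩
  · rw [map_r]
    exact (hp z).isTrail.edges_nodup
  · exact hdisj hz ((mem_iff z e).1 he) ((mem_iff z' e).1 he')

end Routing

section NetworkDistills

variable {V : Type u} [Fintype V] [DecidableEq V] {G : SimpleGraph V} [Fintype G.edgeSet]
  {T : Type u} [Fintype T] [DecidableEq T] {X : Type} [Fintype X] [DecidableEq X]
  {d : ℕ} [NeZero d]

open Classical in
lemma distills_partyState_of_paths (C : QuantumCode X (Fin d)) {v₀ : V} {tgt : T → V}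
    {p : ∀ z : T × X, G.Walk v₀ (tgt z.1)} (hp : ∀ z, (p z).IsPath)
    (hdisj : Pairwise fun z z' => (p z).edges.Disjoint (p z').edges)
    {φ : (T → Fin d) → ℂ} (hφ : star φ ⬝ᵥ φ = 1) :
    Distills (partyState tgt φ) (PartyIdx G d) {Φ | ∃ v : G.edgeSet → Fin d × Fin d → ℂ,
      (∀ t, C.Corrects {i | ∃ e : G.edgeSet, (e : Sym2 V) ∈ (p (t, i)).edges ∧
        ¬ IsScalarOp (Matrix.of (Function.curry (v e)))}) ∧ Φ = edgePureState G d v} := by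
  have : Nonempty V := ⟨v₀⟩
  obtain ⟨r, hr, mem_iff⟩ := exists_isDisjointRouting_of_paths hp hdisj
  refine Distills.reindex (partyEquiv G d) (OwnedDistills.network v₀ C hφ hr) ?_
  rintro _ ⟨v, hv, rfl⟩
  refine ⟨fun e => Matrix.of (Function.curry (v e)), fun t => (hv t).mono fun i hi => ?_, ?_⟩
  · simpa only [Set.mem_ofPred_eq, not_forall, mem_iff, exists_prop] using hi
  · funext y
    change edgePureState G d v ((netEquiv G d).symm y) = _
    simp only [edgePureState, edgeIdx_eq, Equiv.apply_symm_apply]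
    rfl

lemma Distills.of_iff {P : Type u} [Fintype P] [DecidableEq P] {I : P → Type u}
    [∀ v, Fintype (I v)] [∀ v, DecidableEq (I v)] {H : Type} [Fintype H] [DecidableEq H]
    {tgt : T → P} {ψ : (T → H) → ℂ} {S : Set ((∀ v, I v) → ℂ)}
    (h : Distills (partyState tgt ψ) I S) {q : T → P → Prop} (hq : ∀ t v, q t v ↔ tgt t = v)
    [∀ v, Fintype ({t // q t v} → H)] [∀ v, DecidableEq ({t // q t v} → H)] :
    Distills (O := fun v => {t // q t v} → H)
      (fun f => ψ fun t => f (tgt t) ⟨t, (hq t (tgt t)).2 rfl⟩) I S := by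
  obtain rfl : q = fun t v => tgt t = v := funext₂ fun t v => propext (hq t v)
  unfold partyState at h
  convert h
  · rfl

end NetworkDistills

section NetworkLOCC

variable {α : Type u} {V V₀ : Finset α} {G : SimpleGraph V} {d : ℕ} {h : V₀ ⊆ V}
  {Λ : Matrix (NetIdx G d) (NetIdx G d) ℂ → Matrix (V₀ → Fin d) (V₀ → Fin d) ℂ}

variable (G d h) in
open Classical in
lemma exists_isNetworkLOCC [NeZero d] : ∃ Λ, IsNetworkLOCC G d h Λ := by
  obtain ⟨Γ, hΓ⟩ := exists_isLOCC (O := fun v : V => OutIdx V₀ d (v : α)) (PartyIdx G d)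
  exact ⟨_, Γ, hΓ, fun _ => rfl⟩

open Classical in
lemma exists_isNetworkLOCC_of_paths [NeZero d] {X : Type} [Fintype X] [DecidableEq X]
    (C : QuantumCode X (Fin d)) {v₀ : V} {p : ∀ z : V₀ × X, G.Walk v₀ ⟨z.1, h z.1.2⟩}
    (hp : ∀ z, (p z).IsPath) (hdisj : Pairwise fun z z' => (p z).edges.Disjoint (p z').edges)
    {φ : (V₀ → Fin d) → ℂ} (hφ : star φ ⬝ᵥ φ = 1) :
    ∃ Λ, IsNetworkLOCC G d h Λ ∧ ∀ v : G.edgeSet → Fin d × Fin d → ℂ,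
      (∀ t, C.Corrects {i | ∃ e : G.edgeSet, (e : Sym2 V) ∈ (p (t, i)).edges ∧
        ¬ IsScalarOp (Matrix.of (Function.curry (v e)))}) →
      ∃ c : ℂ, Λ (Matrix.vecMulVec (edgePureState G d v) (star (edgePureState G d v)))
        = c • Matrix.vecMulVec φ (star φ) := by
  have distills := (distills_partyState_of_paths C (tgt := fun w : V₀ => (⟨w, h w.2⟩ : V)) hp hdisj
    hφ).of_iff (q := fun w v => (w : α) = v) fun _ _ =>
      ⟨fun hw => Subtype.ext hw, congrArg Subtype.val⟩
  obtain ⟨Γ, hΓ, Γ_eq⟩ := distills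
  refine ⟨fun ρ => Matrix.reindex (outEquiv h d) (outEquiv h d) (Γ ρ), ⟨Γ, hΓ, fun _ => rfl⟩,
    fun v hv => ?_⟩
  obtain ⟨c, hc⟩ := Γ_eq _ ⟨v, hv, rfl⟩
  exact ⟨c, congrArg (Matrix.reindex (outEquiv h d) (outEquiv h d)) hc⟩

open Classical in
lemma IsNetworkLOCC.exists_kraus (hΛ : IsNetworkLOCC G d h Λ) :
    ∃ (ι : Type) (_ : Fintype ι) (K : ι → Matrix (V₀ → Fin d) (NetIdx G d) ℂ),
      (∀ ρ, Λ ρ = ∑ i, K i * ρ * (K i)ᴴ) ∧ IsKrausFamily K := by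
  obtain ⟨Γ, hΓ, Λ_eq⟩ := hΛ
  obtain ⟨ι, _, K, Γ_eq, hK⟩ := hΓ.exists_kraus
  refine ⟨ι, inferInstance, fun i => (K i).submatrix (outEquiv h d).symm id, fun ρ => ?_,
    hK.submatrix (outEquiv h d).symm (Equiv.refl _)⟩
  rw [Λ_eq, Γ_eq]
  ext x y
  simp [Matrix.sum_apply, Matrix.mul_apply]

variable {p : ℝ} {φ : (V₀ → Fin d) → ℂ}

open Classical in
lemma IsNetworkLOCC.sum_le_fidelity [NeZero d] (hΛ : IsNetworkLOCC G d h Λ) (hp₀ : 0 ≤ p)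
    (hp₁ : p ≤ 1) (hφ : star φ ⬝ᵥ φ = 1) {good : Finset (G.edgeSet → Option (Fin d × Fin d))}
    (hgood : ∀ b ∈ good, ∃ c : ℂ,
      Λ (Matrix.vecMulVec (edgePureState G d fun e => componentVec d (b e))
        (star (edgePureState G d fun e => componentVec d (b e))))
        = c • Matrix.vecMulVec φ (star φ)) :
    ∑ b ∈ good, ∏ e, componentWeight d p (b e)
      ≤ fidelity (Λ (networkState G d p)) (Matrix.vecMulVec φ (star φ)) := by
  obtain ⟨ι, _, K, Λ_eq, hK⟩ := hΛ.exists_kraus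
  rw [networkState_eq_sum, Λ_eq]
  refine hK.sum_le_fidelity
    (fun b => Finset.prod_nonneg fun e _ => componentWeight_nonneg d hp₀ hp₁ (b e))
    (fun b => Matrix.posSemidef_vecMulVec_self_star _) (fun b => ?_) hφ
    fun b hb => (hgood b hb).imp fun c hc => (Λ_eq _).symm.trans hc
  rw [Matrix.trace_vecMulVec, dotProduct_comm]
  exact star_dotProduct_edgePureState G d fun e => star_dotProduct_componentVec d (b e)

open Classical in
lemma IsNetworkLOCC.fidelity_le_one [NeZero d] (hΛ : IsNetworkLOCC G d h Λ) (hp₀ : 0 ≤ p)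
    (hp₁ : p ≤ 1) (hφ : star φ ⬝ᵥ φ = 1) :
    fidelity (Λ (networkState G d p)) (Matrix.vecMulVec φ (star φ)) ≤ 1 := by
  obtain ⟨ι, _, K, Λ_eq, hK⟩ := hΛ.exists_kraus
  rw [Λ_eq]
  exact hK.fidelity_le_one (posSemidef_networkState G d hp₀ hp₁) (trace_networkState G d p) hφ

end NetworkLOCC

lemma card_filter_mem_edges_le {V : Type*} {G : SimpleGraph V} [Fintype G.edgeSet] {u v : V}
    (q : G.Walk u v) [DecidablePred fun e : G.edgeSet => (e : Sym2 V) ∈ q.edges] :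
    (Finset.univ.filter fun e : G.edgeSet => (e : Sym2 V) ∈ q.edges).card ≤ q.length := by
  classical
  rw [← q.length_edges]
  refine (Finset.card_le_card_of_injOn Subtype.val (fun e he => ?_)
    Subtype.val_injective.injOn).trans (List.toFinset_card_le q.edges)
  exact List.mem_toFinset.2 (Finset.mem_filter.1 he).2

section Achievability

variable {α : Type u} {V V₀ : Finset α} {G : SimpleGraph V} {d : ℕ} [NeZero d] {h : V₀ ⊆ V}
  {X : Type} [Fintype X] [DecidableEq X] {C : QuantumCode X (Fin d)} {W : Finset (Finset X)}
  {k L : ℕ} {p : ℝ} {φ : (V₀ → Fin d) → ℂ}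

open Classical in
lemma exists_isNetworkLOCC_le_fidelity_of_paths (hk : ∀ A ∈ W, A.card = k)
    (hC : ∀ F : Set X, (∀ A ∈ W, ¬ (A : Set X) ⊆ F) → C.Corrects F)
    {v₀ : V} {P : ∀ z : V₀ × X, G.Walk v₀ ⟨z.1, h z.1.2⟩}
    (hP : ∀ z, (P z).IsPath ∧ (P z).length ≤ L)
    (hdisj : Pairwise fun z z' => (P z).edges.Disjoint (P z').edges)
    (hp₀ : 0 ≤ p) (hp₁ : p ≤ 1) (hφ : star φ ⬝ᵥ φ = 1) :
    ∃ Λ, IsNetworkLOCC G d h Λ ∧ 1 - V₀.card * (W.card * (L * (1 - p)) ^ k)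
      ≤ fidelity (Λ (networkState G d p)) (Matrix.vecMulVec φ (star φ)) := by
  obtain ⟨Λ, hΛ, Λ_eq⟩ := exists_isNetworkLOCC_of_paths C (fun z => (hP z).1) hdisj hφ
  let S : V₀ × X → Finset G.edgeSet := fun z =>
    Finset.univ.filter fun e => (e : Sym2 V) ∈ (P z).edges
  have disjoint_S : Pairwise (Function.onFun Disjoint S) := fun z z' hz =>
    Finset.disjoint_left.2 fun e he he' =>
      hdisj hz (Finset.mem_filter.1 he).2 (Finset.mem_filter.1 he').2
  have good_le := one_sub_le_sum_filter_forall_exists_forall_not_prod (· ≠ none)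
    (componentWeight_nonneg d hp₀ hp₁) (sum_componentWeight d p) disjoint_S
    (fun z => (card_filter_mem_edges_le (P z)).trans (hP z).2) hk
  rw [sum_componentWeight_ne_none, Fintype.card_coe] at good_le
  refine ⟨Λ, hΛ, good_le.trans (hΛ.sum_le_fidelity hp₀ hp₁ hφ fun b hb => Λ_eq _ fun t =>
    hC _ fun A hA hsub => ?_)⟩
  simp only [Finset.mem_filter, Finset.mem_univ, true_and] at hb
  obtain ⟨i, hi, b_eq⟩ := hb t A hA
  obtain ⟨e, he, not_scalar⟩ := hsub hi
  refine not_scalar ?_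
  rw [not_not.1 (b_eq e (Finset.mem_filter.2 ⟨Finset.mem_univ e, he⟩))]
  exact isScalarOp_curry_componentVec_none d

open Classical in
lemma exists_isNetworkLOCC_le_fidelity [Nonempty V] (hk : ∀ A ∈ W, A.card = k)
    (hC : ∀ F : Set X, (∀ A ∈ W, ¬ (A : Set X) ⊆ F) → C.Corrects F)
    {c : ℝ} (hc : 0 < c) (hL : 6 / c < L + 1) (hdeg : c * (V.card : ℝ) ≤ minDeg G)
    (horder : (V₀.card * Fintype.card X * L : ℕ) ≤ c / 2 * (V.card : ℝ))
    (hconn : V₀.card * Fintype.card X * L < edgeConnectivity G)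
    (hp₀ : 0 ≤ p) (hp₁ : p ≤ 1) (hφ : star φ ⬝ᵥ φ = 1) :
    ∃ Λ, IsNetworkLOCC G d h Λ ∧ 1 - V₀.card * (W.card * (L * (1 - p)) ^ k)
      ≤ fidelity (Λ (networkState G d p)) (Matrix.vecMulVec φ (star φ)) := by
  have card_eq : Fintype.card (V₀ × X) = V₀.card * Fintype.card X := by
    rw [Fintype.card_prod, Fintype.card_coe]
  rw [← Fintype.card_coe V] at hdeg horder
  rw [← card_eq] at horder hconn
  obtain ⟨P, hP, hdisj⟩ := exists_edgeDisjoint_paths hc hL (Classical.arbitrary V)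
    (fun z : V₀ × X => (⟨z.1, h z.1.2⟩ : V)) hdeg horder hconn
  exact exists_isNetworkLOCC_le_fidelity_of_paths hk hC hP hdisj hp₀ hp₁ hφ

end Achievability

/-! ### Partial distillability -/

lemma exists_tendsto_of_eventually_exists {β : ℕ → Type*} [∀ n, Nonempty (β n)]
    (f : ∀ n, β n → ℝ) {a : ℝ} (hf : ∀ᶠ n in atTop, ∀ b, f n b ≤ a)
    (h : ∀ ε > 0, ∀ᶠ n in atTop, ∃ b, a - ε < f n b) :
    ∃ b : ∀ n, β n, Tendsto (fun n => f n (b n)) atTop (𝓝 a) := by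
  have exists_nearly_optimal (n : ℕ) : ∃ b, BddAbove (Set.range (f n)) →
      ∀ b', f n b' < f n b + 1 / ((n : ℝ) + 1) := by
    by_cases hn : BddAbove (Set.range (f n))
    · obtain ⟨b, hb⟩ := exists_lt_of_lt_ciSup (sub_lt_self (⨆ b, f n b) Nat.one_div_pos_of_nat)
      exact ⟨b, fun _ b' => (le_ciSup hn b').trans_lt (sub_lt_iff_lt_add.1 hb)⟩
    · exact ⟨Classical.arbitrary _, fun h => absurd h hn⟩
  choose b hb using exists_nearly_optimal
  refine ⟨b, tendsto_order.2 ⟨fun a' ha' => ?_, fun a' ha' => ?_⟩⟩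
  · have half_gap_pos : 0 < (a - a') / 2 := half_pos (sub_pos.2 ha')
    filter_upwards [hf, h _ half_gap_pos,
      (tendsto_one_div_add_atTop_nhds_zero_nat (𝕜 := ℝ)).eventually_lt_const half_gap_pos]
      with n le_a ⟨b', lt_f⟩ small
    have nearly_optimal := hb n ⟨a, Set.forall_mem_range.2 le_a⟩ b'
    linarith
  · filter_upwards [hf] with n le_a
    exact (le_a _).trans_lt ha'

lemma exists_forall_mul_pow_two_pow_lt {B x : ℝ} (hB : 0 ≤ B) (hx : 0 ≤ x) (h : B * x < 1) {a : ℝ}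
    (ha : 0 ≤ a) {ε : ℝ} (hε : 0 < ε) : ∃ r : ℕ, ∀ N ≤ B ^ 2 ^ r, a * (N * x ^ 2 ^ r) < ε := by
  have tendsto_zero : Tendsto (fun r : ℕ => a * (B * x) ^ 2 ^ r) atTop (𝓝 (a * 0)) :=
    ((tendsto_pow_atTop_nhds_zero_of_lt_one (mul_nonneg hB hx) h).comp
      (tendsto_pow_atTop_atTop_of_one_lt one_lt_two)).const_mul a
  rw [mul_zero] at tendsto_zero
  obtain ⟨r, hr⟩ := (tendsto_zero.eventually_lt_const hε).exists
  refine ⟨r, fun N hN => lt_of_le_of_lt ?_ hr⟩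
  rw [mul_pow]
  gcongr

open Classical in
lemma exists_forall_isNetworkLOCC {α : Type u} {V : Finset α} (G : SimpleGraph V) (d : ℕ)
    [NeZero d] (V₀ : Finset α) : ∃ Λ, ∀ h : V₀ ⊆ V, IsNetworkLOCC G d h Λ := by
  by_cases h : V₀ ⊆ V
  · exact (exists_isNetworkLOCC G d h).imp fun Λ hΛ _ => hΛ
  · exact ⟨fun _ => 0, fun h' => absurd h' h⟩

namespace GraphSequence

variable {α : Type u} {V₀ : Finset α} (S : GraphSequence α)

lemma eventually_subset_verts {n : ℕ} (h : V₀ ⊆ S.verts n) : ∀ᶠ k in atTop, V₀ ⊆ S.verts k :=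
  eventually_atTop.2 ⟨n, fun _ hk => h.trans (monotone_nat_of_le_succ S.verts_subset_succ hk)⟩

variable {d : ℕ} [NeZero d] {c : ℝ} (hc : 0 < c)
  (hdeg : ∀ᶠ n in atTop, c * ((S.verts n).card : ℝ) ≤ minDeg (S.graph n))
  (hconn : Tendsto (fun n => edgeConnectivity (S.graph n)) atTop atTop)
  {L : ℕ} (hL : 6 / c < L + 1) {p : ℝ} (hp₀ : 0 ≤ p) (hp₁ : p ≤ 1) (hp : 81 * (L * (1 - p)) < 1)
  {φ : (V₀ → Fin d) → ℂ}

include hc hdeg hconn hL hp₀ hp₁ hp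

open Classical in
lemma eventually_exists_isNetworkLOCC_lt_fidelity (hφ : star φ ⬝ᵥ φ = 1)
    {ε : ℝ} (hε : 0 < ε) :
    ∀ᶠ n in atTop, ∀ h : V₀ ⊆ S.verts n, ∃ Λ, IsNetworkLOCC (S.graph n) d h Λ ∧
      1 - ε < fidelity (Λ (networkState (S.graph n) d p)) (Matrix.vecMulVec φ (star φ)) := by
  obtain ⟨r, hr⟩ := exists_forall_mul_pow_two_pow_lt (by norm_num)
    (mul_nonneg L.cast_nonneg (sub_nonneg.2 hp₁)) hp V₀.card.cast_nonneg hε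
  obtain ⟨X, _, _, C, W, card_W, card_eq, hC⟩ := QuantumCode.exists_concatenated (Fin d) r
  have card_W_le : (W.card : ℝ) ≤ 81 ^ 2 ^ r :=
    mod_cast (Nat.le_mul_of_pos_left _ (by norm_num)).trans card_W
  have order_ge : ∀ᶠ n in atTop,
      ((V₀.card * Fintype.card X * L : ℕ) : ℝ) ≤ c / 2 * ((S.verts n).card : ℝ) :=
    ((tendsto_natCast_atTop_atTop.comp S.order_tendsto).const_mul_atTop
      (half_pos hc)).eventually_ge_atTop _
  filter_upwards [hdeg, order_ge, hconn.eventually_gt_atTop (V₀.card * Fintype.card X * L)]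
    with n deg_ge order_ge conn_gt h
  have := (S.connected n).nonempty
  obtain ⟨Λ, hΛ, le_fidelity⟩ := exists_isNetworkLOCC_le_fidelity (h := h) card_eq hC hc hL deg_ge
    order_ge conn_gt hp₀ hp₁ hφ
  exact ⟨Λ, hΛ, (sub_lt_sub_left (hr _ card_W_le) 1).trans_le le_fidelity⟩

open Classical in
lemma exists_isNetworkLOCC_tendsto_fidelity (hφ : star φ ⬝ᵥ φ = 1) {n₀ : ℕ}
    (hV₀ : V₀ ⊆ S.verts n₀) :
    ∃ Λ : ∀ n, Matrix (NetIdx (S.graph n) d) (NetIdx (S.graph n) d) ℂ →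
        Matrix (V₀ → Fin d) (V₀ → Fin d) ℂ,
      (∀ n (h : V₀ ⊆ S.verts n), IsNetworkLOCC (S.graph n) d h (Λ n)) ∧
        Tendsto (fun n => fidelity (Λ n (networkState (S.graph n) d p))
          (Matrix.vecMulVec φ (star φ))) atTop (𝓝 1) := by
  have nonempty (n : ℕ) : Nonempty {Λ // ∀ h : V₀ ⊆ S.verts n,
      IsNetworkLOCC (S.graph n) d h Λ} :=
    nonempty_subtype.2 (exists_forall_isNetworkLOCC (S.graph n) d V₀)
  obtain ⟨Λ, hΛ⟩ := exists_tendsto_of_eventually_exists (a := 1)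
    (β := fun n => {Λ // ∀ h : V₀ ⊆ S.verts n, IsNetworkLOCC (S.graph n) d h Λ})
    (fun n Λ => fidelity (Λ.1 (networkState (S.graph n) d p)) (Matrix.vecMulVec φ (star φ)))
    ((S.eventually_subset_verts hV₀).mono fun n h Λ => (Λ.2 h).fidelity_le_one hp₀ hp₁ hφ)
    fun ε hε => by
      filter_upwards [S.eventually_subset_verts hV₀,
        S.eventually_exists_isNetworkLOCC_lt_fidelity hc hdeg hconn hL hp₀ hp₁ hp hφ hε]
        with n h exists_isNetworkLOCC
      obtain ⟨Λ, hΛ, lt_fidelity⟩ := exists_isNetworkLOCC h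
      exact ⟨⟨Λ, fun _ => hΛ⟩, lt_fidelity⟩
  exact ⟨fun n => Λ n, fun n => (Λ n).2, hΛ⟩

end GraphSequence

theorem theorem6 {α : Type*} (S : GraphSequence α) (d : ℕ) (hd : 1 ≤ d)
    (hdeg : ∃ c : ℝ, 0 < c ∧
      ∀ᶠ n in Filter.atTop, c * ((S.verts n).card : ℝ) ≤ (minDeg (S.graph n) : ℝ))
    (hconn : Filter.Tendsto (fun n => edgeConnectivity (S.graph n)) Filter.atTop Filter.atTop) :
    HasPartialDistillability S d := by
  classical
  have : NeZero d := ⟨Nat.one_le_iff_ne_zero.1 hd⟩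
  obtain ⟨c, hc, hdeg⟩ := hdeg
  obtain ⟨L, hL⟩ : ∃ L : ℕ, 6 / c < L + 1 := ⟨_, Nat.lt_floor_add_one _⟩
  refine ⟨1 - 1 / (81 * (L + 1)), sub_lt_self _ (by positivity), ?_⟩
  rintro m V₀ - ⟨n₀, hV₀⟩ _ ⟨φ, hφ, rfl⟩
  rw [← Complex.ofReal_inj, ← star_dotProduct_self_eq_sum_norm_sq, Complex.ofReal_one] at hφ
  have distillable (p : ℝ) : ∃ Λ : ∀ n, _ → _,
      (∀ n (h : V₀ ⊆ S.verts n), IsNetworkLOCC (S.graph n) d h (Λ n)) ∧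
        (0 ≤ p → p ≤ 1 → 1 - 1 / (81 * (L + 1)) < p →
          Tendsto (fun n => fidelity (Λ n (networkState (S.graph n) d p))
            (Matrix.vecMulVec φ (star φ))) atTop (𝓝 1)) := by
    by_cases hp : 0 ≤ p ∧ p ≤ 1 ∧ 1 - 1 / (81 * (L + 1)) < p
    · obtain ⟨hp₀, hp₁, hp⟩ := hp
      rw [sub_lt_comm, lt_div_iff₀ (by positivity)] at hp
      obtain ⟨Λ, hΛ, tendsto⟩ := S.exists_isNetworkLOCC_tendsto_fidelity hc hdeg hconn hL hp₀ hp₁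
        (by linarith) hφ hV₀
      exact ⟨Λ, hΛ, fun _ _ _ => tendsto⟩
    · choose Λ hΛ using fun n => exists_forall_isNetworkLOCC (S.graph n) d V₀
      exact ⟨Λ, hΛ, fun hp₀ hp₁ hp' => absurd ⟨hp₀, hp₁, hp'⟩ hp⟩
  choose Λ hΛ tendsto using distillable
  exact ⟨fun n p => Λ p n, fun n p => hΛ p n, tendsto⟩
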